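/- Let $k$ be a field of characteristic zero, $S=k[x,y]$, $r\ge -1$ an integer, and let $F\in S$ be a square-free homogeneous polynomial of degree $r+1$ of the form $F=x\bar F+y^{r+1}$ with $\bar F\in S$. Put $Q=xF$. (If $F$ is a product of linear forms over $k$, then $Q$ is a defining polynomial of a central arrangement $\mathcal A$ of $r+2$ lines in the plane, and every central arrangement of $r+2\geq 1$ lines has this form in suitable coordinates.) Let $A=\mathcal D(\mathcal A)$ be the subalgebra of $\operatorname{End}_k(S)$ generated by the multiplications by elements of $S$ and by the derivations $d$ of $S$ with $d(Q)\in QS$. It contains $E=x\partial_x+y\partial_y$ and $D=F\partial_y$. 1. The derivation $E$ of $S$ extends to a $k$-linear derivation of the Ore extension $S[D]=S[D;F\partial_y]$ with $E(D)=rD$, and there is an isomorphism of $k$-algebras from the iterated Ore extension $S[D][E]$ to $A$ that sends each $s\in S$, $D$ and $E$ to the elements of $A$ of the same name. 2. $A$ is a (left and right) noetherian domain, and the elements $x^iy^jD^pE^q$ with $i,j,p,q\ge0$ form a $k$-basis of $A$. 3. Let $V\subset A$ be the span of $x,y,D,E$. Write $A|W|A=A\otimes_k W\otimes_k A$ and $[a,m]=am-ma$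 for $a$ in $A$ and $m$ in a bimodule. Let $\nabla:S\to A|V|A$ be the linear map with $$\nabla(x^iy^j)=\sum_{s+t+1=i}x^s|x|x^ty^j+\sum_{s+t+1=j}x^iy^s|y|y^t,$$ and let $(-)\wedge\omega$ denote the bimodule map $A|V|A\to A|\Lambda^{p+1}V|A$ with $1|v|1\mapsto 1|v\wedge\omega|1$, for $\omega\in\Lambda^pV$. There are morphisms of $A$-bimodules $$A|\Lambda^4V|A\xrightarrow{d_4}A|\Lambda^3V|A\xrightarrow{d_3}A|\Lambda^2V|A\xrightarrow{d_2}A|V|A\xrightarrow{d_1}A|A\xrightarrow{d_0}A$$ with $d_0(1|1)=1$, $d_1(1|v|1)=[v,1|1]$ for all $v\in V$, and \begin{align*} d_2(1|x\wedge y|1)&=[x,1|y|1]-[y,1|x|1],\\ d_2(1|x\wedge E|1)&=[x,1|E|1]-[E,1|x|1]+1|x|1,\\ d_2(1|y\wedge E|1)&=[y,1|E|1]-[E,1|y|1]+1|y|1,\\ d_2(1|x\wedge D|1)&=[x,1|D|1]-[D,1|x|1],\\ d_2(1|y\wedge D|1)&=[y,1|D|1]-[D,1|y|1]+\nabla(F),\\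 d_2(1|D\wedge E|1)&=[D,1|E|1]-[E,1|D|1]+r|D|1,\\ d_3(1|x\wedge y\wedge D|1)&=[x,1|y\wedge D|1]-[y,1|x\wedge D|1]+[D,1|x\wedge y|1]+\nabla(F)\wedge x,\\ d_3(1|x\wedge y\wedge E|1)&=[x,1|y\wedge E|1]-[y,1|x\wedge E|1]+[E,1|x\wedge y|1]-2|x\wedge y|1,\\ d_3(1|x\wedge D\wedge E|1)&=[x,1|D\wedge E|1]-[D,1|x\wedge E|1]+[E,1|x\wedge D|1]-(r+1)|x\wedge D|1,\\ d_3(1|y\wedge D\wedge E|1)&=[y,1|D\wedge E|1]-[D,1|y\wedge E|1]+[E,1|y\wedge D|1]+\nabla(F)\wedge E-(r+1)|y\wedge D|1,\\ d_4(1|x\wedge y\wedge D\wedge E|1)&=[x,1|y\wedge D\wedge E|1]-[y,1|x\wedge D\wedge E|1]+[D,1|x\wedge y\wedge E|1]\\ &\quad-[E,1|x\wedge y\wedge D|1]+\nabla(F)\wedge x\wedge E+(r+2)|x\wedge y\wedge D|1, \end{align*} and the sequence, extended by $0$ at both ends, is exact. The bimodules $A|A$ and $A|\Lambda^pV|A$,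 $1\le p\le4$, are free, so this is a free resolution of length $4$ of $A$ as an $A$-bimodule. 4. If $r\ge0$, then the left and the right global dimensions of $A$ are both equal to $4$. -/

import Mathlib

open CategoryTheory MvPolynomial
open scoped TensorProduct

universe u

/-! ### Global dimension -/

/-- The left global dimension of a ring: the supremum of the projective dimensions of its
left modules. -/
noncomputable def leftGlobalDimension (R : Type u) [Ring R] : WithBot ℕ∞ :=
  ⨆ M : ModuleCat.{u} R, projectiveDimension M

/-- The right global dimension: right modules are left modules over the opposite ring. -/
noncomputable def rightGlobalDimension (R : Type u) [Ring R] : WithBot ℕ∞ :=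
  leftGlobalDimension Rᵐᵒᵖ

/-! ### Ore extensions of derivation type -/

/-- A `k`-linear derivation of a (not necessarily commutative) `k`-algebra into itself. -/
structure AlgDerivation (k R : Type*) [CommRing k] [Ring R] [Algebra k R] extends
    R →ₗ[k] R where
  leibniz' : ∀ a b : R, toFun (a * b) = toFun a * b + a * toFun b

/-- An ordinary derivation of a commutative algebra, seen as an `AlgDerivation`. -/
def AlgDerivation.ofDerivation {k R : Type*} [CommRing k] [CommRing R] [Algebra k R]
    (d : Derivation k R R) : AlgDerivation k R where
  toLinearMap := d.toLinearMap
  leibniz' a b := by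
    change d (a * b) = d a * b + a * d b
    rw [d.leibniz, smul_eq_mul, smul_eq_mul]; ring

namespace Ore

variable {k R : Type*} [CommRing k] [Ring R] [Algebra k R]

/-- Left multiplication by `r` on the free left `R`-module `⨁ᵢ R Xⁱ`. -/
noncomputable def coeffOp (k : Type*) {R : Type*} [CommRing k] [Ring R] [Algebra k R] (r : R) :
    Module.End k (Polynomial R) :=
  LinearMap.mulLeft k (Polynomial.C r)

/-- Left multiplication by the variable, that is, `r Xⁱ ↦ r Xⁱ⁺¹ + δ(r) Xⁱ`. -/
noncomputable def varOp (δ : AlgDerivation k R) : Module.End k (Polynomial R) :=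
  LinearMap.mulLeft k Polynomial.X +
    Polynomial.lsum fun i => (Polynomial.monomial i).restrictScalars k ∘ₗ δ.toLinearMap

theorem coeffOp_monomial (r s : R) (i : ℕ) :
    coeffOp k r (Polynomial.monomial i s) = Polynomial.monomial i (r * s) :=
  Polynomial.C_mul_monomial

theorem varOp_monomial (δ : AlgDerivation k R) (s : R) (i : ℕ) :
    varOp δ (Polynomial.monomial i s)
      = Polynomial.monomial (i + 1) s + Polynomial.monomial i (δ.toLinearMap s) := by
  simp [varOp, Polynomial.lsum_apply, Polynomial.sum_monomial_index]

theorem op_ext {f g : Module.End k (Polynomial R)}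
    (h : ∀ i s, f (Polynomial.monomial i s) = g (Polynomial.monomial i s)) : f = g := by
  refine LinearMap.ext fun p => ?_
  induction p using Polynomial.induction_on' with
  | add p q hp hq => rw [map_add, map_add, hp, hq]
  | monomial i s => exact h i s

/-- The Ore extension `R[t; δ]`, in its standard realization as the algebra of operators
on `⨁ᵢ R Xⁱ` generated by the left multiplications by elements of `R` and by `t`. -/
noncomputable def opAlgebra (δ : AlgDerivation k R) :
    Subalgebra k (Module.End k (Polynomial R)) :=
  Algebra.adjoin k (Set.range (coeffOp k : R → Module.End k (Polynomial R)) ∪ {varOp δ})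

/-- The type of elements of the Ore extension `R[t; δ]`. -/
def Ext (δ : AlgDerivation k R) : Type _ := opAlgebra δ

noncomputable instance Ext.instRing (δ : AlgDerivation k R) : Ring (Ext δ) :=
  inferInstanceAs (Ring (opAlgebra δ))

noncomputable instance Ext.instAlgebra (δ : AlgDerivation k R) : Algebra k (Ext δ) :=
  inferInstanceAs (Algebra k (opAlgebra δ))

/-- The operator on `⨁ᵢ R Xⁱ` which is an element of `R[t; δ]`. -/
noncomputable def Ext.val (δ : AlgDerivation k R) : Ext δ →ₐ[k] Module.End k (Polynomial R) :=
  (opAlgebra δ).val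

theorem Ext.val_injective (δ : AlgDerivation k R) : Function.Injective (Ext.val δ) :=
  Subtype.val_injective

/-- The inclusion `R → R[t; δ]`. -/
noncomputable def C (δ : AlgDerivation k R) : R →ₐ[k] Ext δ where
  toFun r := ⟨coeffOp k r, Algebra.subset_adjoin (Or.inl ⟨r, rfl⟩)⟩
  map_one' := by
    apply Ext.val_injective
    refine op_ext fun i s => ?_
    change coeffOp k 1 _ = Polynomial.monomial i s
    rw [coeffOp_monomial, one_mul]
  map_mul' a b := by
    apply Ext.val_injective
    refine op_ext fun i s => ?_
    change coeffOp k (a * b) _ = coeffOp k a (coeffOp k b _)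
    simp only [coeffOp_monomial, mul_assoc]
  map_zero' := by
    apply Ext.val_injective
    refine op_ext fun i s => ?_
    change coeffOp k 0 _ = 0
    simp [coeffOp_monomial]
  map_add' a b := by
    apply Ext.val_injective
    refine op_ext fun i s => ?_
    change coeffOp k (a + b) _ = coeffOp k a _ + coeffOp k b _
    simp [coeffOp_monomial, add_mul]
  commutes' c := by
    apply Ext.val_injective
    refine op_ext fun i s => ?_
    change coeffOp k _ _ = c • Polynomial.monomial i s
    simp [coeffOp_monomial, Algebra.smul_def]

/-- The variable `t` of `R[t; δ]`. -/
noncomputable def t (δ : AlgDerivation k R) : Ext δ :=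
  ⟨varOp δ, Algebra.subset_adjoin (Or.inr rfl)⟩

/-- The commutation rule `t r = r t + δ(r)`. -/
theorem t_mul_C (δ : AlgDerivation k R) (r : R) :
    t δ * C δ r = C δ r * t δ + C δ (δ.toLinearMap r) := by
  have h : ∀ a b, δ.toLinearMap (a * b) = δ.toLinearMap a * b + a * δ.toLinearMap b := δ.leibniz'
  apply Ext.val_injective
  refine op_ext fun i s => ?_
  change varOp δ (coeffOp k r _) = coeffOp k r (varOp δ _) + coeffOp k (δ.toLinearMap r) _
  simp only [coeffOp_monomial, varOp_monomial, h, map_add]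
  abel

theorem t_pow_apply (δ : AlgDerivation k R) (i : ℕ) :
    Ext.val δ (t δ ^ i) 1 = Polynomial.monomial i 1 := by
  have h1 : δ.toLinearMap 1 = 0 := by
    have h := δ.leibniz' 1 1
    simpa using h
  induction i with
  | zero => simp
  | succ i ih =>
    rw [pow_succ']
    change varOp δ (Ext.val δ (t δ ^ i) 1) = _
    rw [ih, varOp_monomial, h1, map_zero, add_zero]

theorem sum_apply (δ : AlgDerivation k R) (f : ℕ →₀ R) :
    Ext.val δ (f.sum fun i r => C δ r * t δ ^ i) 1
      = ∑ i ∈ f.support, Polynomial.monomial i (f i) := by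
  rw [Finsupp.sum]
  simp only [map_sum, LinearMap.sum_apply]
  refine Finset.sum_congr rfl fun i _ => ?_
  change coeffOp k (f i) (Ext.val δ (t δ ^ i) 1) = _
  rw [t_pow_apply, coeffOp_monomial, mul_one]

/-- `R[t; δ]` is a free left `R`-module on the powers of `t`. -/
theorem existsUnique_sum (δ : AlgDerivation k R) (p : Ext δ) :
    ∃! f : ℕ →₀ R, p = f.sum fun i r => C δ r * t δ ^ i := by
  classical
  have hadd : ∀ f g : ℕ →₀ R, (f + g).sum (fun i r => C δ r * t δ ^ i)
      = (f.sum fun i r => C δ r * t δ ^ i) + g.sum fun i r => C δ r * t δ ^ i := by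
    intro f g
    refine Finsupp.sum_add_index' ?_ ?_
    · intro i; simp
    · intro i a b; simp [add_mul]
  let T : Submodule k (Ext δ) :=
    { carrier := {p | ∃ f : ℕ →₀ R, p = f.sum fun i r => C δ r * t δ ^ i}
      zero_mem' := ⟨0, by simp⟩
      add_mem' := by
        rintro _ _ ⟨f, rfl⟩ ⟨g, rfl⟩
        exact ⟨f + g, (hadd f g).symm⟩
      smul_mem' := by
        rintro c _ ⟨f, rfl⟩
        refine ⟨c • f, ?_⟩
        rw [Finsupp.sum_smul_index' (by intro i; simp)]
        simp [Finsupp.smul_sum] }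
  have hmono : ∀ r i, C δ r * t δ ^ i ∈ T := fun r i =>
    ⟨Finsupp.single i r, by simp⟩
  have hC : ∀ r, ∀ q ∈ T, C δ r * q ∈ T := by
    rintro r _ ⟨f, rfl⟩
    rw [Finsupp.sum, Finset.mul_sum]
    refine T.sum_mem fun i _ => ?_
    change C δ r * (C δ (f i) * t δ ^ i) ∈ T
    rw [← mul_assoc, ← map_mul]
    exact hmono _ _
  have ht : ∀ q ∈ T, t δ * q ∈ T := by
    rintro _ ⟨f, rfl⟩
    rw [Finsupp.sum, Finset.mul_sum]
    refine T.sum_mem fun i _ => ?_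
    change t δ * (C δ (f i) * t δ ^ i) ∈ T
    rw [← mul_assoc, t_mul_C, add_mul, mul_assoc, ← pow_succ']
    exact T.add_mem (hmono _ _) (hmono _ _)
  have hall : ∀ a (ha : a ∈ opAlgebra δ), ∀ q ∈ T, (show Ext δ from ⟨a, ha⟩) * q ∈ T := by
    intro a ha
    induction ha using Algebra.adjoin_induction with
    | mem a ha =>
      rcases ha with ⟨r, rfl⟩ | rfl
      · exact hC r
      · exact ht
    | algebraMap c =>
      intro q hq
      have h := T.smul_mem c hq
      rwa [Algebra.smul_def] at h
    | add a b ha hb iha ihb =>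
      intro q hq
      have h := T.add_mem (iha q hq) (ihb q hq)
      have e : (show Ext δ from ⟨a, ha⟩) * q + (show Ext δ from ⟨b, hb⟩) * q
          = (show Ext δ from ⟨a + b, (opAlgebra δ).add_mem ha hb⟩) * q := (add_mul _ _ _).symm
      exact e ▸ h
    | mul a b ha hb iha ihb =>
      intro q hq
      have h := iha _ (ihb q hq)
      have e : (show Ext δ from ⟨a, ha⟩) * ((show Ext δ from ⟨b, hb⟩) * q)
          = (show Ext δ from ⟨a * b, (opAlgebra δ).mul_mem ha hb⟩) * q := (mul_assoc _ _ _).symm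
      exact e ▸ h
  obtain ⟨f, hf⟩ : p ∈ T := by
    have h1 : (1 : Ext δ) ∈ T := by simpa using hmono 1 0
    have h := hall p.1 p.2 1 h1
    have e : p * 1 = p := mul_one p
    exact e ▸ h
  refine ⟨f, hf, fun g hg => ?_⟩
  have hg : p = g.sum fun i r => C δ r * t δ ^ i := hg
  have h : ∑ i ∈ g.support, Polynomial.monomial i (g i)
      = ∑ i ∈ f.support, Polynomial.monomial i (f i) := by
    rw [← sum_apply δ g, ← hg, hf, sum_apply]
  ext j
  have hj := congrArg (fun p => p.coeff j) h
  have hif : ∀ a : R, (if a = 0 then 0 else a) = a := fun a => by split_ifs with h <;> simp [h]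
  simpa [Polynomial.finsetSum_coeff, Polynomial.coeff_monomial, hif] using hj

end Ore

/-! ### The algebra of differential operators tangent to an arrangement -/

section Tangent

variable {k : Type u} [Field k]

/-- The derivations `d` of `S = k[x, y]` with `d(Q) ∈ QS`. -/
def logDerivations (Q : MvPolynomial (Fin 2) k) :
    Set (Derivation k (MvPolynomial (Fin 2) k) (MvPolynomial (Fin 2) k)) :=
  {d | d Q ∈ Ideal.span {Q}}

/-- The subalgebra of `End_k(S)` generated by the multiplications by elements of `S` and the
derivations `d` of `S` with `d(Q) ∈ QS`. -/
noncomputable def tangentSubalgebra (Q : MvPolynomial (Fin 2) k) :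
    Subalgebra k (Module.End k (MvPolynomial (Fin 2) k)) :=
  Algebra.adjoin k
    (Set.range (LinearMap.mulLeft k : MvPolynomial (Fin 2) k → _) ∪
      (fun d : Derivation k (MvPolynomial (Fin 2) k) (MvPolynomial (Fin 2) k) =>
        (d : MvPolynomial (Fin 2) k →ₗ[k] MvPolynomial (Fin 2) k)) '' logDerivations Q)

/-- The type of elements of that algebra. -/
def TangentAlgebra (Q : MvPolynomial (Fin 2) k) : Type u := tangentSubalgebra Q

noncomputable instance TangentAlgebra.instRing (Q : MvPolynomial (Fin 2) k) :
    Ring (TangentAlgebra Q) :=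
  inferInstanceAs (Ring (tangentSubalgebra Q))

noncomputable instance TangentAlgebra.instAlgebra (Q : MvPolynomial (Fin 2) k) :
    Algebra k (TangentAlgebra Q) :=
  inferInstanceAs (Algebra k (tangentSubalgebra Q))

/-- The inclusion of `S` in the algebra, by left multiplications. -/
noncomputable def TangentAlgebra.ofS (Q : MvPolynomial (Fin 2) k) :
    MvPolynomial (Fin 2) k →ₐ[k] TangentAlgebra Q :=
  (Algebra.lmul k (MvPolynomial (Fin 2) k)).codRestrict (tangentSubalgebra Q)
    fun s => Algebra.subset_adjoin (Or.inl ⟨s, rfl⟩)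

/-- A derivation `d` of `S` with `d(Q) ∈ QS`, as an element of the algebra. -/
noncomputable def TangentAlgebra.ofDer (Q : MvPolynomial (Fin 2) k)
    (d : Derivation k (MvPolynomial (Fin 2) k) (MvPolynomial (Fin 2) k))
    (hd : d ∈ logDerivations Q) : TangentAlgebra Q :=
  ⟨(d : MvPolynomial (Fin 2) k →ₗ[k] MvPolynomial (Fin 2) k),
    Algebra.subset_adjoin (Or.inr ⟨d, hd, rfl⟩)⟩

/-- The derivation `D = F ∂_y`. -/
noncomputable def derD (F : MvPolynomial (Fin 2) k) :
    Derivation k (MvPolynomial (Fin 2) k) (MvPolynomial (Fin 2) k) :=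
  F • pderiv 1

/-- The Euler derivation `E = x ∂_x + y ∂_y`. -/
noncomputable def derE (k : Type u) [Field k] :
    Derivation k (MvPolynomial (Fin 2) k) (MvPolynomial (Fin 2) k) :=
  (X 0 : MvPolynomial (Fin 2) k) • pderiv 0 + (X 1 : MvPolynomial (Fin 2) k) • pderiv 1

theorem derD_mem (F : MvPolynomial (Fin 2) k) : derD F ∈ logDerivations (X 0 * F) := by
  simp only [logDerivations, Set.mem_ofPred_eq, Ideal.mem_span_singleton]
  refine ⟨pderiv 1 F, ?_⟩
  simp [derD]
  ring

theorem derE_mem {F : MvPolynomial (Fin 2) k} {n : ℕ} (hF : F.IsHomogeneous n) :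
    derE k ∈ logDerivations (X 0 * F) := by
  have h := ((isHomogeneous_X k (0 : Fin 2)).mul hF).sum_X_mul_pderiv
  rw [Fin.sum_univ_two] at h
  simp only [logDerivations, Set.mem_ofPred_eq, Ideal.mem_span_singleton]
  refine ⟨((1 + n : ℕ) : MvPolynomial (Fin 2) k), ?_⟩
  simp only [derE, Derivation.add_apply, Derivation.smul_apply, smul_eq_mul]
  rw [h, nsmul_eq_mul, mul_comm]

/-- The element `x` of the algebra. -/
noncomputable def genX (F : MvPolynomial (Fin 2) k) : TangentAlgebra (X 0 * F) :=
  TangentAlgebra.ofS _ (X 0)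

/-- The element `y` of the algebra. -/
noncomputable def genY (F : MvPolynomial (Fin 2) k) : TangentAlgebra (X 0 * F) :=
  TangentAlgebra.ofS _ (X 1)

/-- The element `D` of the algebra. -/
noncomputable def genD (F : MvPolynomial (Fin 2) k) : TangentAlgebra (X 0 * F) :=
  TangentAlgebra.ofDer _ (derD F) (derD_mem F)

/-- The element `E` of the algebra. -/
noncomputable def genE {F : MvPolynomial (Fin 2) k} {n : ℕ} (hF : F.IsHomogeneous n) :
    TangentAlgebra (X 0 * F) :=
  TangentAlgebra.ofDer _ (derE k) (derE_mem hF)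

/-- The subspace `V` of the algebra spanned by `x, y, D, E`. -/
noncomputable def genSpan {F : MvPolynomial (Fin 2) k} {n : ℕ} (hF : F.IsHomogeneous n) :
    Submodule k (TangentAlgebra (X 0 * F)) :=
  Submodule.span k {genX F, genY F, genD F, genE hF}

/-- The elements `x, y, D, E` of `V`. -/
noncomputable def genSpan.x {F : MvPolynomial (Fin 2) k} {n : ℕ} (hF : F.IsHomogeneous n) :
    genSpan hF := ⟨genX F, Submodule.subset_span (by simp)⟩

noncomputable def genSpan.y {F : MvPolynomial (Fin 2) k} {n : ℕ} (hF : F.IsHomogeneous n) :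
    genSpan hF := ⟨genY F, Submodule.subset_span (by simp)⟩

noncomputable def genSpan.D {F : MvPolynomial (Fin 2) k} {n : ℕ} (hF : F.IsHomogeneous n) :
    genSpan hF := ⟨genD F, Submodule.subset_span (by simp)⟩

noncomputable def genSpan.E {F : MvPolynomial (Fin 2) k} {n : ℕ} (hF : F.IsHomogeneous n) :
    genSpan hF := ⟨genE hF, Submodule.subset_span (by simp)⟩

end Tangent

/-! ### The bimodule complex -/

/-- The enveloping algebra `Aᵉ = A ⊗ Aᵒᵖ`; its left modules are the `A`-bimodules. -/
abbrev Env (k A : Type*) [CommRing k] [Ring A] [Algebra k A] : Type _ := A ⊗[k] Aᵐᵒᵖ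

/-- `A` as a bimodule over itself: `(a ⊗ b) • c = a c b`. -/
noncomputable instance Env.instModuleSelf (k A : Type*) [CommRing k] [Ring A] [Algebra k A] :
    Module (Env k A) A :=
  TensorProduct.Algebra.module

section Complex

variable {k A : Type*} [Field k] [Ring A] [Algebra k A]

/-- The commutator `[a, m] = a m - m a` of an element of `A` with one of an `A`-bimodule. -/
noncomputable def bracket (k : Type*) {A M : Type*} [Field k] [Ring A] [Algebra k A]
    [AddCommGroup M] [Module (Env k A) M] (a : A) (m : M) : M :=
  ((a ⊗ₜ[k] (1 : Aᵐᵒᵖ) : Env k A) • m) - (((1 : A) ⊗ₜ[k] MulOpposite.op a : Env k A) • m)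

variable {V : Submodule k A}

/-- The element `1|v|1` of the free bimodule `A|V|A`, realized as `Aᵉ ⊗ V`, where
`a|v|b` is `(a ⊗ b) ⊗ v`. -/
noncomputable def bar (v : V) : Env k A ⊗[k] V := 1 ⊗ₜ[k] v

/-- The element `1|v₁ ∧ ⋯ ∧ vₚ|1` of the free bimodule `A|Λᵖ V|A`, realized as
`Aᵉ ⊗ Λᵖ V`. -/
noncomputable def barWedge {p : ℕ} (v : Fin p → V) : Env k A ⊗[k] ⋀[k]^p V :=
  1 ⊗ₜ[k] exteriorPower.ιMulti k p v

/-- The linear map `V → Λᵖ⁺¹ V`, `v ↦ v ∧ w₁ ∧ ⋯ ∧ wₚ`. -/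
noncomputable def wedgeLin {p : ℕ} (w : Fin p → V) : V →ₗ[k] ⋀[k]^(p + 1) V where
  toFun v := exteriorPower.ιMulti k (p + 1) (Matrix.vecCons v w)
  map_add' a b := AlternatingMap.map_vecCons_add _ w a b
  map_smul' c a := AlternatingMap.map_vecCons_smul _ w c a

/-- The bimodule map `(-) ∧ w₁ ∧ ⋯ ∧ wₚ : A|V|A → A|Λᵖ⁺¹ V|A`. -/
noncomputable def wedge {p : ℕ} (m : Env k A ⊗[k] V) (w : Fin p → V) :
    Env k A ⊗[k] ⋀[k]^(p + 1) V :=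
  (wedgeLin w).baseChange (Env k A) m

/-- The value at `f ∈ k[x, y]` of the derivation `∇` with `∇(x) = 1|x|1` and `∇(y) = 1|y|1`:
`∇(xⁱ yʲ) = ∑_{s + t + 1 = i} xˢ|x|xᵗ yʲ + ∑_{s + t + 1 = j} xⁱ yˢ|y|yᵗ`. -/
noncomputable def nabla (x y : V) (f : MvPolynomial (Fin 2) k) : Env k A ⊗[k] V :=
  ∑ m ∈ f.support, MvPolynomial.coeff m f •
    ((∑ s ∈ Finset.range (m 0), (((x : A) ^ s) ⊗ₜ[k]
        MulOpposite.op ((x : A) ^ (m 0 - 1 - s) * (y : A) ^ m 1) : Env k A) ⊗ₜ[k] x) +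
      ∑ s ∈ Finset.range (m 1), (((x : A) ^ m 0 * (y : A) ^ s) ⊗ₜ[k]
        MulOpposite.op ((y : A) ^ (m 1 - 1 - s)) : Env k A) ⊗ₜ[k] y)

/-- The augmented sequence of bimodules
`A|Λ⁴V|A → A|Λ³V|A → A|Λ²V|A → A|V|A → A|A → A`, where `x, y, D, E` span `V`; the fields
after the maps give the value of each map on the generators of its domain, and so
determine it. -/
structure BimoduleComplex (V : Submodule k A) (x y D E : V) (F : MvPolynomial (Fin 2) k)
    (r : k) where
  d₀ : Env k A →ₗ[Env k A] A
  d₁ : Env k A ⊗[k] V →ₗ[Env k A] Env k A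
  d₂ : Env k A ⊗[k] ⋀[k]^2 V →ₗ[Env k A] Env k A ⊗[k] V
  d₃ : Env k A ⊗[k] ⋀[k]^3 V →ₗ[Env k A] Env k A ⊗[k] ⋀[k]^2 V
  d₄ : Env k A ⊗[k] ⋀[k]^4 V →ₗ[Env k A] Env k A ⊗[k] ⋀[k]^3 V
  d₀_one : d₀ 1 = 1
  d₁_bar : ∀ v : V, d₁ (bar v) = bracket k (v : A) (1 : Env k A)
  d₂_xy : d₂ (barWedge ![x, y]) = bracket k (x : A) (bar y) - bracket k (y : A) (bar x)
  d₂_xE : d₂ (barWedge ![x, E]) =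
    bracket k (x : A) (bar E) - bracket k (E : A) (bar x) + bar x
  d₂_yE : d₂ (barWedge ![y, E]) =
    bracket k (y : A) (bar E) - bracket k (E : A) (bar y) + bar y
  d₂_xD : d₂ (barWedge ![x, D]) = bracket k (x : A) (bar D) - bracket k (D : A) (bar x)
  d₂_yD : d₂ (barWedge ![y, D]) =
    bracket k (y : A) (bar D) - bracket k (D : A) (bar y) + nabla x y F
  d₂_DE : d₂ (barWedge ![D, E]) =
    bracket k (D : A) (bar E) - bracket k (E : A) (bar D) + r • bar D
  d₃_xyD : d₃ (barWedge ![x, y, D]) =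
    bracket k (x : A) (barWedge ![y, D]) - bracket k (y : A) (barWedge ![x, D])
      + bracket k (D : A) (barWedge ![x, y]) + wedge (nabla x y F) ![x]
  d₃_xyE : d₃ (barWedge ![x, y, E]) =
    bracket k (x : A) (barWedge ![y, E]) - bracket k (y : A) (barWedge ![x, E])
      + bracket k (E : A) (barWedge ![x, y]) - (2 : k) • barWedge ![x, y]
  d₃_xDE : d₃ (barWedge ![x, D, E]) =
    bracket k (x : A) (barWedge ![D, E]) - bracket k (D : A) (barWedge ![x, E])
      + bracket k (E : A) (barWedge ![x, D]) - (r + 1) • barWedge ![x, D]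
  d₃_yDE : d₃ (barWedge ![y, D, E]) =
    bracket k (y : A) (barWedge ![D, E]) - bracket k (D : A) (barWedge ![y, E])
      + bracket k (E : A) (barWedge ![y, D]) + wedge (nabla x y F) ![E]
      - (r + 1) • barWedge ![y, D]
  d₄_xyDE : d₄ (barWedge ![x, y, D, E]) =
    bracket k (x : A) (barWedge ![y, D, E]) - bracket k (y : A) (barWedge ![x, D, E])
      + bracket k (D : A) (barWedge ![x, y, E]) - bracket k (E : A) (barWedge ![x, y, D])
      + wedge (nabla x y F) ![x, E] + (r + 2) • barWedge ![x, y, D]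

/-- The sequence is a free bimodule resolution of `A` of length `4`: its terms (other than `A`)
are free bimodules, and it is exact, also at both ends. -/
structure BimoduleComplex.IsFreeResolution {x y D E : V} {F : MvPolynomial (Fin 2) k} {r : k}
    (P : BimoduleComplex V x y D E F r) : Prop where
  free₀ : Module.Free (Env k A) (Env k A)
  free₁ : Module.Free (Env k A) (Env k A ⊗[k] V)
  free₂ : Module.Free (Env k A) (Env k A ⊗[k] ⋀[k]^2 V)
  free₃ : Module.Free (Env k A) (Env k A ⊗[k] ⋀[k]^3 V)
  free₄ : Module.Free (Env k A) (Env k A ⊗[k] ⋀[k]^4 V)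
  injective_d₄ : Function.Injective P.d₄
  exact₃ : Function.Exact P.d₄ P.d₃
  exact₂ : Function.Exact P.d₃ P.d₂
  exact₁ : Function.Exact P.d₂ P.d₁
  exact₀ : Function.Exact P.d₁ P.d₀
  surjective_d₀ : Function.Surjective P.d₀

end Complex

/-! Write `n = r + 1`, so that `(n : k) - 1` is `r`. In `A` one has `[D, y] = F`, `[E, x] = x`, `[E,
y] = y`, `[E, D] = rD`, and `x` commutes with `y` and `D`.

Presentation. These relations give a homomorphism from `S[D][E]` to `A`. It is onto by Saito's
criterion (`exists_of_mem_logDerivations`): as `F` is square-free and prime to `x`, it is prime to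
`∂_y F`, and then `E` and `D` generate the logarithmic derivations over `S`. It is injective by
`Ore.injective_of_central`: in characteristic zero, commuting with a central coefficient which the
derivation does not kill (`y` for `D`, `x` for `E`) lowers the degree of a kernel element by exactly
one. Leading coefficients show that an Ore extension of a domain is a domain and, by Hilbert's
argument, that one of a noetherian ring is noetherian. The PBW basis comes from composing the bases
of powers along `k ⊂ k[x] ⊂ S ⊂ S[D] ⊂ A`.

Resolution. In `Aᵉ` put `ξ(v) = v ⊗ 1 - 1 ⊗ v`. Then `[ξ(a), ξ(b)] = ξ([a, b])`, and `ξ(F)` is the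
combination of `ξ(x)` and `ξ(y)` whose coefficients are the coordinates of `∇(F)`. Hence right
multiplications by the four `ξ`'s and by these two coefficients satisfy the relations of
`TwistedKoszul`. From these relations and the regularity of the sequence `ξ(x), ξ(y), ξ(D), ξ(E)`,
exactness in positive degrees is formal. Regularity comes from the monomial bases: if `A` is free as
a left module over a stage `R` of the tower, then killing the `ξ(c)` with `c` in `R` turns `Aᵒᵖ ⊗ M`
into `M ⊗_R A`, a sum of copies of `M` indexed by monomials. There `ξ` of the next variable `w` is
`m ↦ mw` minus a shift of the monomials, which is injective by looking at the top degree. All this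
is done for an arbitrary right module `M`. The case `M = A` is the bimodule resolution, after
exchanging the tensor factors.

Global dimension. The complexes for all `M` are free resolutions of length four, whence the upper
bound. For `r ≥ 0` there are two characters `χ, χ'` of `A` which together make every entry of `d₄`
vanish, so `d₄` for `M = k_χ` has no retraction and `k_χ` has projective dimension four. The
anti-automorphism fixing `S` and negating `D` and `E` exchanges left and right. -/

namespace Ore

/-! ### Ore extensions: coefficients and the universal property -/

section Basics

variable {k R : Type*} [CommRing k] [Ring R] [Algebra k R]

/-- The polynomial with the same left coefficients. -/
noncomputable def toPoly (δ : AlgDerivation k R) : Ext δ →ₗ[k] Polynomial R :=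
  (LinearMap.applyₗ (1 : Polynomial R)).comp (Ext.val δ).toLinearMap

theorem toPoly_apply (δ : AlgDerivation k R) (p : Ext δ) : toPoly δ p = Ext.val δ p 1 := rfl

theorem toPoly_mul (δ : AlgDerivation k R) (p q : Ext δ) :
    toPoly δ (p * q) = Ext.val δ p (toPoly δ q) := by
  simp [toPoly_apply]

theorem toPoly_C_mul (δ : AlgDerivation k R) (r : R) (q : Ext δ) :
    toPoly δ (C δ r * q) = Polynomial.C r * toPoly δ q := by
  rw [toPoly_mul]; rfl

theorem toPoly_t_pow (δ : AlgDerivation k R) (i : ℕ) :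
    toPoly δ (t δ ^ i) = Polynomial.monomial i 1 := t_pow_apply δ i

theorem toPoly_C_mul_t_pow (δ : AlgDerivation k R) (r : R) (i : ℕ) :
    toPoly δ (C δ r * t δ ^ i) = Polynomial.monomial i r := by
  rw [toPoly_C_mul, toPoly_t_pow, Polynomial.C_mul_monomial, mul_one]

theorem toPoly_C (δ : AlgDerivation k R) (r : R) :
    toPoly δ (C δ r) = Polynomial.C r := by
  simpa using toPoly_C_mul_t_pow δ r 0

theorem coeff_varOp (δ : AlgDerivation k R) (P : Polynomial R) (i : ℕ) :
    (varOp δ P).coeff i = (Polynomial.X * P).coeff i + δ.toLinearMap (P.coeff i) := by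
  induction P using Polynomial.induction_on' with
  | add p q hp hq => simp only [map_add, mul_add, Polynomial.coeff_add, hp, hq]; abel
  | monomial j s =>
    rw [varOp_monomial, Polynomial.X_mul_monomial, Polynomial.coeff_add]
    congr 1
    rw [Polynomial.coeff_monomial, Polynomial.coeff_monomial]
    split_ifs <;> simp

theorem coeff_toPoly_t_mul (δ : AlgDerivation k R) (q : Ext δ) (i : ℕ) :
    (toPoly δ (t δ * q)).coeff i
      = (Polynomial.X * toPoly δ q).coeff i + δ.toLinearMap ((toPoly δ q).coeff i) := by
  rw [toPoly_mul]; exact coeff_varOp δ _ i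

theorem exists_sum (δ : AlgDerivation k R) (p : Ext δ) :
    ∃ f : ℕ →₀ R, p = f.sum fun i r => C δ r * t δ ^ i :=
  (existsUnique_sum δ p).exists

theorem toPoly_sum (δ : AlgDerivation k R) (f : ℕ →₀ R) :
    toPoly δ (f.sum fun i r => C δ r * t δ ^ i) = ∑ i ∈ f.support, Polynomial.monomial i (f i) :=
  sum_apply δ f

/-- Any bound `m` on the degree is allowed, not only the degree itself, so that inductions on the
degree need no separate treatment of vanishing leading coefficients. -/
theorem eq_sum_coeff (δ : AlgDerivation k R) (p : Ext δ) (m : ℕ)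
    (h : (toPoly δ p).natDegree ≤ m) :
    p = ∑ i ∈ Finset.range (m + 1), C δ ((toPoly δ p).coeff i) * t δ ^ i := by
  obtain ⟨f, rfl⟩ := exists_sum δ p
  have hc : ∀ i, (toPoly δ (f.sum fun i r => C δ r * t δ ^ i)).coeff i = f i := by
    intro i
    rw [toPoly_sum, Polynomial.finsetSum_coeff]
    simp only [Polynomial.coeff_monomial]
    simp +contextual [eq_comm]
  simp only [hc]
  refine Finset.sum_subset (fun i hi => ?_) fun i _ hi => ?_
  · rw [Finset.mem_range, Nat.lt_succ_iff]
    refine le_trans (Polynomial.le_natDegree_of_ne_zero ?_) h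
    rw [hc]; exact Finsupp.mem_support_iff.1 hi
  · simp [Finsupp.notMem_support_iff.1 hi]

theorem toPoly_injective (δ : AlgDerivation k R) : Function.Injective (toPoly δ) := by
  rw [injective_iff_map_eq_zero]
  intro p hp
  rw [eq_sum_coeff δ p _ le_rfl]
  simp [hp]

theorem C_injective (δ : AlgDerivation k R) : Function.Injective (C δ) := by
  intro a b h
  have := congrArg (toPoly δ) h
  rwa [toPoly_C, toPoly_C, Polynomial.C_inj] at this

theorem induction_on (δ : AlgDerivation k R) {P : Ext δ → Prop} (p : Ext δ)
    (hC : ∀ r, P (C δ r)) (ht : P (t δ)) (hadd : ∀ p q, P p → P q → P (p + q))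
    (hmul : ∀ p q, P p → P q → P (p * q)) : P p := by
  have hpow : ∀ i, P (t δ ^ i) := by
    intro i
    induction i with
    | zero => rw [pow_zero, ← map_one (C δ)]; exact hC 1
    | succ i ih => rw [pow_succ]; exact hmul _ _ ih ht
  rw [eq_sum_coeff δ p _ le_rfl]
  refine Finset.sum_induction _ P hadd ?_ fun i _ => hmul _ _ (hC _) (hpow i)
  rw [← map_zero (C δ)]; exact hC 0

theorem hom_ext {B : Type*} [Ring B] [Algebra k B] {δ : AlgDerivation k R} {f g : Ext δ →ₐ[k] B}
    (hC : ∀ r, f (C δ r) = g (C δ r)) (ht : f (t δ) = g (t δ)) : f = g := by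
  ext p
  induction p using induction_on with
  | hC r => exact hC r
  | ht => exact ht
  | hadd p q hp hq => rw [map_add, map_add, hp, hq]
  | hmul p q hp hq => rw [map_mul, map_mul, hp, hq]

/-- The evaluation `∑ rᵢ tⁱ ↦ ∑ φ(rᵢ) bⁱ`. -/
noncomputable def liftLin {B : Type*} [Ring B] [Algebra k B] (δ : AlgDerivation k R)
    (φ : R →ₐ[k] B) (b : B) : Ext δ →ₗ[k] B :=
  (Polynomial.lsum (fun i => (LinearMap.mulRight k (b ^ i)).comp φ.toLinearMap)).comp (toPoly δ)

theorem liftLin_C_mul_t_pow {B : Type*} [Ring B] [Algebra k B] (δ : AlgDerivation k R)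
    (φ : R →ₐ[k] B) (b : B) (r : R) (i : ℕ) :
    liftLin δ φ b (C δ r * t δ ^ i) = φ r * b ^ i := by
  rw [liftLin, LinearMap.comp_apply, toPoly_C_mul_t_pow]
  simp [Polynomial.lsum_apply, Polynomial.sum_monomial_index]

theorem ext_linear {B : Type*} [AddCommGroup B] [Module k B] {δ : AlgDerivation k R}
    {f g : Ext δ →ₗ[k] B} (h : ∀ r i, f (C δ r * t δ ^ i) = g (C δ r * t δ ^ i)) : f = g := by
  ext p
  rw [eq_sum_coeff δ p _ le_rfl, map_sum, map_sum]
  exact Finset.sum_congr rfl fun i _ => h _ _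

/-- The universal property of `R[t; δ]`. -/
noncomputable def lift {B : Type*} [Ring B] [Algebra k B] (δ : AlgDerivation k R)
    (φ : R →ₐ[k] B) (b : B) (h : ∀ r, b * φ r = φ r * b + φ (δ.toLinearMap r)) :
    Ext δ →ₐ[k] B :=
  AlgHom.ofLinearMap (liftLin δ φ b)
    (by simpa using liftLin_C_mul_t_pow δ φ b 1 0)
    (by
      intro p
      -- The left factors `p` for which this holds for every `q` are closed under sums and products.
      -- This leaves `p` in `R` and `p = t`, where both sides are linear in `q` and can be compared
      -- on the elements `r tⁱ`.
      suffices H : ∀ q, liftLin δ φ b (p * q) = liftLin δ φ b p * liftLin δ φ b q from H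
      induction p using induction_on with
      | hC r =>
        intro q
        have e : (liftLin δ φ b).comp (LinearMap.mulLeft k (C δ r))
            = (LinearMap.mulLeft k (φ r)).comp (liftLin δ φ b) := by
          refine ext_linear fun s i => ?_
          simp only [LinearMap.comp_apply, LinearMap.mulLeft_apply]
          rw [← mul_assoc, ← map_mul, liftLin_C_mul_t_pow, liftLin_C_mul_t_pow, map_mul, mul_assoc]
        have e' := LinearMap.congr_fun e q
        simp only [LinearMap.comp_apply, LinearMap.mulLeft_apply] at e'
        rw [e', ← mul_one (C δ r), ← pow_zero (t δ), liftLin_C_mul_t_pow, pow_zero, mul_one]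
      | ht =>
        intro q
        have e : (liftLin δ φ b).comp (LinearMap.mulLeft k (t δ))
            = (LinearMap.mulLeft k b).comp (liftLin δ φ b) := by
          refine ext_linear fun s i => ?_
          simp only [LinearMap.comp_apply, LinearMap.mulLeft_apply]
          rw [← mul_assoc, t_mul_C, add_mul, mul_assoc, ← pow_succ', map_add, liftLin_C_mul_t_pow,
            liftLin_C_mul_t_pow, liftLin_C_mul_t_pow, ← mul_assoc, h, add_mul, mul_assoc,
            ← pow_succ']
        have e' := LinearMap.congr_fun e q
        simp only [LinearMap.comp_apply, LinearMap.mulLeft_apply] at e'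
        have et : liftLin δ φ b (t δ) = b := by
          simpa using liftLin_C_mul_t_pow δ φ b 1 1
        rw [e', et]
      | hadd p₁ p₂ h₁ h₂ => intro q; rw [add_mul, map_add, map_add, h₁, h₂, add_mul]
      | hmul p₁ p₂ h₁ h₂ => intro q; rw [mul_assoc, h₁, h₂, h₁, mul_assoc])

@[simp]
theorem lift_C {B : Type*} [Ring B] [Algebra k B] (δ : AlgDerivation k R)
    (φ : R →ₐ[k] B) (b : B) (h : ∀ r, b * φ r = φ r * b + φ (δ.toLinearMap r)) (r : R) :
    lift δ φ b h (C δ r) = φ r := by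
  change liftLin δ φ b (C δ r) = φ r
  simpa using liftLin_C_mul_t_pow δ φ b r 0

@[simp]
theorem lift_t {B : Type*} [Ring B] [Algebra k B] (δ : AlgDerivation k R)
    (φ : R →ₐ[k] B) (b : B) (h : ∀ r, b * φ r = φ r * b + φ (δ.toLinearMap r)) :
    lift δ φ b h (t δ) = b := by
  change liftLin δ φ b (t δ) = b
  simpa using liftLin_C_mul_t_pow δ φ b 1 1

/-! ### Leading coefficients -/

/-- Multiplying by `t` shifts the coefficients by one and adds their images under `δ`, unshifted.
This correction never reaches the top degree. -/
theorem t_pow_mul_lead (δ : AlgDerivation k R) (q : Ext δ) (n : ℕ)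
    (hq : (toPoly δ q).natDegree ≤ n) (i : ℕ) :
    (toPoly δ (t δ ^ i * q)).natDegree ≤ i + n ∧
      (toPoly δ (t δ ^ i * q)).coeff (i + n) = (toPoly δ q).coeff n := by
  induction i with
  | zero => simpa using hq
  | succ i ih =>
    obtain ⟨h1, h2⟩ := ih
    have hz : ∀ j, i + n < j → (toPoly δ (t δ ^ i * q)).coeff j = 0 := fun j hj =>
      Polynomial.coeff_eq_zero_of_natDegree_lt (lt_of_le_of_lt h1 hj)
    rw [pow_succ', mul_assoc]
    constructor
    · rw [Polynomial.natDegree_le_iff_coeff_eq_zero]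
      intro j hj
      obtain ⟨j, rfl⟩ : ∃ j', j = j' + 1 := ⟨j - 1, by omega⟩
      rw [coeff_toPoly_t_mul, Polynomial.coeff_X_mul, hz j (by omega), hz (j + 1) (by omega),
        map_zero, add_zero]
    · rw [show i + 1 + n = (i + n) + 1 by ring, coeff_toPoly_t_mul, Polynomial.coeff_X_mul, h2,
        hz _ (by omega), map_zero, add_zero]

theorem natDegree_C_mul_t_pow_mul_le (δ : AlgDerivation k R) (r : R) (i : ℕ) (q : Ext δ) :
    (toPoly δ (C δ r * t δ ^ i * q)).natDegree ≤ i + (toPoly δ q).natDegree := by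
  rw [mul_assoc, toPoly_C_mul]
  exact (Polynomial.natDegree_C_mul_le _ _).trans (t_pow_mul_lead δ q _ le_rfl i).1

/-- Only the term of degree `m` of `p` reaches degree `m + n`. The commutation rule involves no
automorphism of `R`, so top coefficients multiply as for polynomials. -/
theorem coeff_mul_lead (δ : AlgDerivation k R) (p q : Ext δ) (m n : ℕ)
    (hp : (toPoly δ p).natDegree ≤ m) (hq : (toPoly δ q).natDegree ≤ n) :
    (toPoly δ (p * q)).coeff (m + n) = (toPoly δ p).coeff m * (toPoly δ q).coeff n := by
  conv_lhs => rw [eq_sum_coeff δ p m hp]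
  rw [Finset.sum_mul, map_sum, Polynomial.finsetSum_coeff, Finset.sum_range_succ,
    Finset.sum_eq_zero, zero_add, mul_assoc, toPoly_C_mul, Polynomial.coeff_C_mul,
    (t_pow_mul_lead δ q n hq m).2]
  intro i hi
  refine Polynomial.coeff_eq_zero_of_natDegree_lt
    ((natDegree_C_mul_t_pow_mul_le δ _ i q).trans_lt ?_)
  have := Finset.mem_range.1 hi
  omega

theorem isDomain_ext [IsDomain R] (δ : AlgDerivation k R) : IsDomain (Ext δ) := by
  have : Nontrivial (Ext δ) := (C_injective δ).nontrivial
  have : NoZeroDivisors (Ext δ) := by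
    refine ⟨fun {p q} hpq => ?_⟩
    by_contra! hne
    have h := coeff_mul_lead δ p q _ _ le_rfl le_rfl
    rw [hpq, map_zero, Polynomial.coeff_zero] at h
    have h0 : ∀ a : Ext δ, a ≠ 0 → (toPoly δ a).leadingCoeff ≠ 0 := fun a ha =>
      Polynomial.leadingCoeff_ne_zero.2 fun e => ha (toPoly_injective δ (e.trans (map_zero _).symm))
    exact mul_ne_zero (h0 p hne.1) (h0 q hne.2) h.symm
  exact NoZeroDivisors.to_isDomain _

/-! ### Injectivity of homomorphisms -/

/-- The second term of the expansion `tⁱ⁺¹ z = z tⁱ⁺¹ + (i + 1) δ(z) tⁱ + ⋯`. -/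
theorem coeff_t_pow_mul_C (δ : AlgDerivation k R) (z : R) (i : ℕ) :
    (toPoly δ (t δ ^ (i + 1) * C δ z)).coeff i = (i + 1 : ℕ) * δ.toLinearMap z := by
  have hz : (toPoly δ (C δ z)).natDegree ≤ 0 := by rw [toPoly_C, Polynomial.natDegree_C]
  induction i with
  | zero => simp [coeff_toPoly_t_mul, toPoly_C]
  | succ i ih =>
    rw [pow_succ', mul_assoc, coeff_toPoly_t_mul, Polynomial.coeff_X_mul, ih]
    have h := (t_pow_mul_lead δ (C δ z) 0 hz (i + 1)).2
    rw [toPoly_C, Polynomial.coeff_C_zero, add_zero] at h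
    rw [h, Nat.cast_succ (i + 1), add_one_mul]

theorem natDegree_le_of_coeff_eq_zero {P : Polynomial R} {m : ℕ} (h : P.natDegree ≤ m + 1)
    (h' : P.coeff (m + 1) = 0) : P.natDegree ≤ m := by
  rw [Polynomial.natDegree_le_iff_coeff_eq_zero] at *
  intro j hj
  rcases (Nat.succ_le_of_lt hj).eq_or_lt with rfl | hj'
  · exact h'
  · exact h j hj'

/-- On leading terms, commuting with a central `z` of `R` acts as `δ(z)` times the derivative with
respect to `t`. -/
theorem commutator_lead (δ : AlgDerivation k R) (z : R) (hz : ∀ r, Commute z r) (p : Ext δ) (m : ℕ)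
    (hp : (toPoly δ p).natDegree ≤ m + 1) :
    (toPoly δ (p * C δ z - C δ z * p)).natDegree ≤ m ∧
      (toPoly δ (p * C δ z - C δ z * p)).coeff m
        = (toPoly δ p).coeff (m + 1) * ((m + 1 : ℕ) * δ.toLinearMap z) := by
  have hz0 : (toPoly δ (C δ z)).natDegree ≤ 0 := by rw [toPoly_C, Polynomial.natDegree_C]
  -- The top coefficient of `pz - zp` is `cz - zc = 0`. This is used for `p` in degree `m + 1` and
  -- again for its lower part `q` in degree `m`.
  have hdeg : ∀ (p : Ext δ) (i : ℕ), (toPoly δ p).natDegree ≤ i →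
      (toPoly δ (p * C δ z - C δ z * p)).natDegree ≤ i ∧
      (toPoly δ (p * C δ z - C δ z * p)).coeff i = 0 := by
    intro p i hp
    have h1 := coeff_mul_lead δ p (C δ z) i 0 hp hz0
    rw [map_sub, toPoly_C_mul, Polynomial.coeff_sub]
    constructor
    · refine (Polynomial.natDegree_sub_le _ _).trans (max_le ?_ ?_)
      · conv_lhs => rw [eq_sum_coeff δ p i hp]
        rw [Finset.sum_mul, map_sum]
        refine Polynomial.natDegree_sum_le_of_forall_le _ _ fun j hj => ?_
        refine (natDegree_C_mul_t_pow_mul_le δ _ j _).trans ?_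
        have := Finset.mem_range.1 hj
        omega
      · exact (Polynomial.natDegree_C_mul_le _ _).trans hp
    · rw [add_zero, toPoly_C, Polynomial.coeff_C_zero] at h1
      rw [h1, Polynomial.coeff_C_mul, (hz _).eq, sub_self]
  have h := hdeg p (m + 1) hp
  refine ⟨natDegree_le_of_coeff_eq_zero h.1 h.2, ?_⟩
  set q := ∑ i ∈ Finset.range (m + 1), C δ ((toPoly δ p).coeff i) * t δ ^ i with hq
  have hpq : p = q + C δ ((toPoly δ p).coeff (m + 1)) * t δ ^ (m + 1) := by
    conv_lhs => rw [eq_sum_coeff δ p _ hp]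
    rw [Finset.sum_range_succ]
  have hqd : (toPoly δ q).natDegree ≤ m := by
    rw [hq, map_sum]
    refine Polynomial.natDegree_sum_le_of_forall_le _ _ fun j hj => ?_
    rw [toPoly_C_mul_t_pow]
    have := Finset.mem_range.1 hj
    exact (Polynomial.natDegree_monomial_le _).trans (by omega)
  set c := (toPoly δ p).coeff (m + 1) with hc
  have e : p * C δ z - C δ z * p = (q * C δ z - C δ z * q)
      + (C δ c * (t δ ^ (m + 1) * C δ z) - C δ (z * c) * t δ ^ (m + 1)) := by
    rw [hpq, map_mul]; noncomm_ring
  rw [e, map_add, Polynomial.coeff_add, (hdeg q m hqd).2, zero_add, map_sub, Polynomial.coeff_sub,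
    toPoly_C_mul, Polynomial.coeff_C_mul, coeff_t_pow_mul_C, toPoly_C_mul_t_pow,
    Polynomial.coeff_monomial, if_neg (by omega), sub_zero]

/-- The kernel is closed under commutators with `z`, each of which lowers the degree by one and
multiplies the top coefficient by `(m + 1) δ(z)`. This factor is nonzero in a domain of
characteristic zero, so induction on the degree leaves only kernel elements in `R`. -/
theorem injective_of_central [IsDomain R] [CharZero R] {B : Type*} [Ring B] [Algebra k B]
    {δ : AlgDerivation k R} (φ : Ext δ →ₐ[k] B) (hφ : Function.Injective fun r => φ (C δ r))
    (z : R) (hz : ∀ r, Commute z r) (hδ : δ.toLinearMap z ≠ 0) : Function.Injective φ := by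
  rw [injective_iff_map_eq_zero]
  suffices H : ∀ m p, (toPoly δ p).natDegree ≤ m → φ p = 0 → p = 0 from
    fun p hp => H _ p le_rfl hp
  intro m
  induction m with
  | zero =>
    intro p hp h
    have e := eq_sum_coeff δ p 0 hp
    simp only [zero_add, Finset.sum_range_one, pow_zero, mul_one] at e
    rw [e] at h ⊢
    rw [hφ (h.trans (by simp : (0 : B) = φ (C δ 0))), map_zero]
  | succ m ih =>
    intro p hp h
    obtain ⟨h1, h2⟩ := commutator_lead δ z hz p m hp
    have h0 := ih _ h1 (by simp [h])
    rw [h0, map_zero, Polynomial.coeff_zero] at h2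
    refine ih p (natDegree_le_of_coeff_eq_zero hp ?_) h
    rcases mul_eq_zero.1 h2.symm with h3 | h3
    · exact h3
    · rcases mul_eq_zero.1 h3 with h4 | h4
      · exact absurd (Nat.cast_eq_zero.1 h4) (by omega)
      · exact absurd h4 hδ

/-! ### The Hilbert basis theorem -/

/-- The left ideal of the coefficients of `tⁿ` in the elements of `I` of degree at most `n`. -/
noncomputable def leadIdeal (δ : AlgDerivation k R) (I : Ideal (Ext δ)) (n : ℕ) : Ideal R where
  carrier := {r | ∃ p ∈ I, (toPoly δ p).natDegree ≤ n ∧ (toPoly δ p).coeff n = r}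
  zero_mem' := ⟨0, I.zero_mem, by simp, by simp⟩
  add_mem' := by
    rintro _ _ ⟨p, hp, hp1, rfl⟩ ⟨q, hq, hq1, rfl⟩
    refine ⟨p + q, I.add_mem hp hq, ?_, by simp⟩
    rw [map_add]
    exact (Polynomial.natDegree_add_le _ _).trans (max_le hp1 hq1)
  smul_mem' := by
    rintro r _ ⟨p, hp, hp1, rfl⟩
    refine ⟨C δ r * p, I.mul_mem_left _ hp, ?_, ?_⟩
    · rw [toPoly_C_mul]; exact (Polynomial.natDegree_C_mul_le _ _).trans hp1
    · rw [toPoly_C_mul, Polynomial.coeff_C_mul, smul_eq_mul]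

/-- Left multiplication by a power of `t` raises the degree and keeps the leading coefficient. -/
theorem leadIdeal_mono (δ : AlgDerivation k R) {I J : Ideal (Ext δ)} (h : I ≤ J) {m n : ℕ}
    (hmn : m ≤ n) : leadIdeal δ I m ≤ leadIdeal δ J n := by
  rintro _ ⟨p, hp, hp1, rfl⟩
  obtain ⟨i, rfl⟩ := Nat.exists_eq_add_of_le' hmn
  obtain ⟨h1, h2⟩ := t_pow_mul_lead δ p m hp1 i
  exact ⟨_, J.mul_mem_left _ (h hp), h1, h2⟩

/-- Subtract from an element of `J` an element of `I` with the same leading coefficient and argue by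
induction on the degree. -/
theorem le_of_leadIdeal_le (δ : AlgDerivation k R) {I J : Ideal (Ext δ)} (h : I ≤ J)
    (hl : ∀ n, leadIdeal δ J n ≤ leadIdeal δ I n) : J ≤ I := by
  suffices H : ∀ m p, (toPoly δ p).natDegree ≤ m → p ∈ J → p ∈ I from
    fun p hp => H _ p le_rfl hp
  intro m
  induction m with
  | zero =>
    intro p hp hJ
    obtain ⟨q, hq, hq1, hq2⟩ := hl 0 ⟨p, hJ, hp, rfl⟩
    have : q = p := toPoly_injective δ <| by
      rw [Polynomial.eq_C_of_natDegree_le_zero hq1, Polynomial.eq_C_of_natDegree_le_zero hp, hq2]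
    exact this ▸ hq
  | succ m ih =>
    intro p hp hJ
    obtain ⟨q, hq, hq1, hq2⟩ := hl (m + 1) ⟨p, hJ, hp, rfl⟩
    have hpq : p - q ∈ I := by
      refine ih _ (natDegree_le_of_coeff_eq_zero ?_ ?_) (J.sub_mem hJ (h hq))
      · rw [map_sub]; exact (Polynomial.natDegree_sub_le _ _).trans (max_le hp hq1)
      · rw [map_sub, Polynomial.coeff_sub, hq2, sub_self]
    simpa using I.add_mem hpq hq

/-- For a chain of left ideals, the leading ideals form an array monotone in both indices. Its
diagonal stabilizes at some `N`, which controls all degrees at least `N`. Each of the finitely many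
degrees below `N` gives one more chain in `R`. -/
theorem isNoetherianRing_ext [IsNoetherianRing R] (δ : AlgDerivation k R) :
    IsNoetherianRing (Ext δ) := by
  rw [isNoetherianRing_iff, ← monotone_stabilizes_iff_noetherian]
  intro f
  have hstab : ∀ g : ℕ →o Ideal R, ∃ n, ∀ m, n ≤ m → g n = g m :=
    monotone_stabilizes_iff_noetherian.2 (isNoetherianRing_iff.1 inferInstance)
  obtain ⟨N, hN⟩ := hstab ⟨fun m => leadIdeal δ (f m) m,
    fun a b hab => leadIdeal_mono δ (f.mono hab) hab⟩
  choose M hM using fun n => hstab ⟨fun m => leadIdeal δ (f m) n,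
    fun a b hab => leadIdeal_mono δ (f.mono hab) le_rfl⟩
  replace hN : ∀ m, N ≤ m → leadIdeal δ (f N) N = leadIdeal δ (f m) m := hN
  replace hM : ∀ n m, M n ≤ m → leadIdeal δ (f (M n)) n = leadIdeal δ (f m) n := hM
  -- The sum serves only as an upper bound for the stages at which the chains of degree less than
  -- `N` stabilize.
  obtain ⟨L, hL⟩ : ∃ L, N ≤ L ∧ ∀ n < N, M n ≤ L :=
    ⟨N + ∑ n ∈ Finset.range N, M n, by omega, fun n hn =>
      (Finset.single_le_sum (f := M) (fun _ _ => Nat.zero_le _) (Finset.mem_range.2 hn)).trans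
        (by omega)⟩
  refine ⟨L, fun m hm => le_antisymm (f.mono hm) (le_of_leadIdeal_le δ (f.mono hm) fun n => ?_)⟩
  rcases lt_or_ge n N with hn | hn
  · rw [← hM n m ((hL.2 n hn).trans hm), hM n L (hL.2 n hn)]
  · calc leadIdeal δ (f m) n ≤ leadIdeal δ (f (max m n)) (max m n) :=
          leadIdeal_mono δ (f.mono (le_max_left _ _)) (le_max_right _ _)
      _ = leadIdeal δ (f N) N := (hN _ (hn.trans (le_max_right _ _))).symm
      _ ≤ leadIdeal δ (f L) n := leadIdeal_mono δ (f.mono hL.1) hn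

end Basics

end Ore

/-! ### Bases of algebras over subalgebras -/

section LeftBasis

variable {k R A I : Type*} [CommRing k] [Ring R] [Algebra k R] [Ring A] [Algebra k A]

/-- The map `(cᵢ) ↦ ∑ ι(cᵢ) βᵢ`. -/
noncomputable def leftCombination (ι : R →ₐ[k] A) (β : I → A) : (I →₀ R) →ₗ[k] A :=
  Finsupp.lsum k fun i => (LinearMap.mulRight k (β i)).comp ι.toLinearMap

@[simp]
theorem leftCombination_single (ι : R →ₐ[k] A) (β : I → A) (i : I) (c : R) :
    leftCombination ι β (Finsupp.single i c) = ι c * β i := by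
  simp [leftCombination]

/-- The family `β` is a basis of `A` as a left `R`-module. -/
def IsLeftBasis (ι : R →ₐ[k] A) (β : I → A) : Prop :=
  Function.Bijective (leftCombination ι β)

/-- Summing over `I × I'` is summing over `I'` inside each coefficient of a sum over `I`. With this
factorization, composing bases and cancelling a known one both reduce to bijectivity of a composite.
-/
theorem leftCombination_trans {R' I' : Type*} [Ring R'] [Algebra k R'] (ι : R →ₐ[k] A) (β : I → A)
    (ι' : R' →ₐ[k] R) (β' : I' → R) :
    leftCombination (ι.comp ι') (fun j : I × I' => ι (β' j.2) * β j.1)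
      = (leftCombination ι β).comp ((Finsupp.mapRange.linearMap (leftCombination ι' β')).comp
        (Finsupp.curryLinearEquiv k).toLinearMap) := by
  refine Finsupp.lhom_ext fun ⟨i, i'⟩ c => ?_
  simp [mul_assoc, -Finsupp.single_mul]

theorem IsLeftBasis.bijective_mapRange (I : Type*) {R' I' : Type*} [Ring R'] [Algebra k R']
    {ι' : R' →ₐ[k] R} {β' : I' → R} (h' : IsLeftBasis ι' β') :
    Function.Bijective ((Finsupp.mapRange.linearMap (α := I) (leftCombination ι' β')).comp
      (Finsupp.curryLinearEquiv k).toLinearMap) := by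
  rw [LinearMap.coe_comp]
  exact (Finsupp.mapRange.linearEquiv (α := I)
    (LinearEquiv.ofBijective (leftCombination ι' β') h')).bijective.comp
      (LinearEquiv.bijective _)

theorem IsLeftBasis.trans {R' I' : Type*} [Ring R'] [Algebra k R'] {ι : R →ₐ[k] A} {β : I → A}
    {ι' : R' →ₐ[k] R} {β' : I' → R} (h : IsLeftBasis ι β) (h' : IsLeftBasis ι' β') :
    IsLeftBasis (ι.comp ι') fun j : I × I' => ι (β' j.2) * β j.1 := by
  unfold IsLeftBasis
  rw [leftCombination_trans, LinearMap.coe_comp]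
  exact h.comp (h'.bijective_mapRange I)

/-- Cancellation is what yields the basis of powers of `y` of `k[x, y]` over `k[x]` from the
monomial basis over `k`. -/
theorem IsLeftBasis.of_trans {R' I' : Type*} [Ring R'] [Algebra k R'] {ι : R →ₐ[k] A} {β : I → A}
    {ι' : R' →ₐ[k] R} {β' : I' → R} (h' : IsLeftBasis ι' β')
    (h : IsLeftBasis (ι.comp ι') fun j : I × I' => ι (β' j.2) * β j.1) : IsLeftBasis ι β := by
  unfold IsLeftBasis at h
  rw [leftCombination_trans, LinearMap.coe_comp] at h
  exact (Function.Bijective.of_comp_iff _ (h'.bijective_mapRange I)).1 h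

theorem IsLeftBasis.map_equiv {B : Type*} [Ring B] [Algebra k B] {ι : R →ₐ[k] A} {β : I → A}
    (h : IsLeftBasis ι β) (e : A ≃ₐ[k] B) :
    IsLeftBasis ((e : A →ₐ[k] B).comp ι) fun i => e (β i) := by
  have e' : leftCombination ((e : A →ₐ[k] B).comp ι) (fun i => e (β i))
      = e.toLinearMap.comp (leftCombination ι β) := by
    refine Finsupp.lhom_ext fun i c => ?_
    simp
  unfold IsLeftBasis
  rw [e', LinearMap.coe_comp]
  exact e.bijective.comp h

theorem Ore.isLeftBasis_pow (δ : AlgDerivation k R) :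
    IsLeftBasis (Ore.C δ) fun i : ℕ => Ore.t δ ^ i := by
  have e : ∀ f, leftCombination (Ore.C δ) (fun i : ℕ => Ore.t δ ^ i) f
      = f.sum fun i r => Ore.C δ r * Ore.t δ ^ i := by
    intro f; simp [leftCombination, Finsupp.lsum_apply]; rfl
  constructor
  · intro f g hfg
    rw [e, e] at hfg
    exact (Ore.existsUnique_sum δ _).unique rfl hfg
  · intro p
    obtain ⟨f, hf⟩ := Ore.exists_sum δ p
    exact ⟨f, (e f).trans hf.symm⟩

end LeftBasis

/-! ### Logarithmic derivations -/

section Saito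

variable {k : Type u} [Field k]

/-- A monomial of the derivative comes from a monomial of `p` whose exponent at `i` is larger by
one. -/
theorem degreeOf_pderiv_lt {σ : Type*} {i : σ} {p : MvPolynomial σ k} (h : pderiv i p ≠ 0) :
    degreeOf i (pderiv i p) < degreeOf i p := by
  have key : ∀ m ∈ (pderiv i p).support, m i < degreeOf i p := by
    intro m hm
    rw [mem_support_iff, coeff_pderiv] at hm
    have h1 := left_ne_zero_of_mul hm
    have h2 := monomial_le_degreeOf i (mem_support_iff.2 h1)
    simp at h2
    omega
  obtain ⟨m, hm⟩ := Finset.nonempty_iff_ne_empty.2 (mt support_eq_empty.1 h)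
  exact (degreeOf_lt_iff ((Nat.zero_le _).trans_lt (key m hm))).2 key

/-- A nonzero multiple of `p` has degree in the `i`-th variable at least that of `p`, and the
derivative has a smaller one. -/
theorem pderiv_eq_zero_of_dvd {σ : Type*} {i : σ} {p : MvPolynomial σ k}
    (h : p ∣ pderiv i p) : pderiv i p = 0 := by
  by_contra h0
  have hlt := degreeOf_pderiv_lt h0
  obtain ⟨q, hq⟩ := h
  rw [hq] at h0
  rw [hq, degreeOf_mul_eq (left_ne_zero_of_mul h0) (right_ne_zero_of_mul h0)] at hlt
  omega

theorem eq_C_of_pderiv_eq_zero [CharZero k] {σ : Type*} {p : MvPolynomial σ k}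
    (h : ∀ i, pderiv i p = 0) : p = C (coeff 0 p) := by
  classical
  ext m
  rw [coeff_C]
  split_ifs with hm
  · rw [hm]
  · obtain ⟨i, hi⟩ := Finsupp.ne_iff.1 (Ne.symm hm)
    have h1 := coeff_pderiv (i := i) p (m - Finsupp.single i 1)
    rw [h, coeff_zero, tsub_add_cancel_of_le
      (Finsupp.single_le_iff.2 (Nat.one_le_iff_ne_zero.2 hi))] at h1
    exact (mul_eq_zero.1 h1.symm).resolve_right (Nat.cast_add_one_ne_zero _)

variable {n : ℕ} {F G : MvPolynomial (Fin 2) k}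

theorem derE_apply_of_isHomogeneous (hF : F.IsHomogeneous n) : derE k F = (n : k) • F := by
  have h := hF.sum_X_mul_pderiv
  rw [Fin.sum_univ_two] at h
  simpa [derE, Nat.cast_smul_eq_nsmul] using h

/-- The polynomial `F` takes the value `1` at the point `(0, 1)`. -/
theorem not_X_dvd (hFG : F = X 0 * G + X 1 ^ n) : ¬ (X 0 : MvPolynomial (Fin 2) k) ∣ F := by
  rintro ⟨H, hH⟩
  have h := congrArg (eval ![(0 : k), 1]) (hFG.symm.trans hH)
  simp at h

/-- Let an irreducible `p` divide `F` and `∂_y F`. By Euler's identity it divides `x ∂_x F`, hence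
`∂_x F`, since it is not associated to `x`. As it divides `F` only once, it then divides both its
own partial derivatives, which must vanish. In characteristic zero `p` is constant. -/
theorem isRelPrime_pderiv [CharZero k] (hF : F.IsHomogeneous n) (hsq : Squarefree F)
    (hX : ¬ (X 0 : MvPolynomial (Fin 2) k) ∣ F) : IsRelPrime F (pderiv 1 F) := by
  have hF0 : F ≠ 0 := hsq.ne_zero
  refine WfDvdMonoid.isRelPrime_of_no_irreducible_factors (fun h => hF0 h.1) ?_
  intro p hp hpF hpD
  have hpr : Prime p := hp.prime
  have hE := hF.sum_X_mul_pderiv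
  rw [Fin.sum_univ_two] at hE
  have hpx : ¬ p ∣ (X 0 : MvPolynomial (Fin 2) k) := fun h =>
    hX ((hp.associated_of_dvd (X_prime (i := (0 : Fin 2)) (R := k)).irreducible h).symm.dvd.trans hpF)
  have h0 : p ∣ pderiv 0 F := by
    refine (hpr.dvd_or_dvd ?_).resolve_left hpx
    rw [eq_sub_of_add_eq hE]
    exact dvd_sub (by rw [nsmul_eq_mul]; exact hpF.mul_left _) (hpD.mul_left _)
  obtain ⟨h, hh⟩ := hpF
  have hph : ¬ p ∣ h := by
    rintro ⟨q, rfl⟩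
    exact hp.not_isUnit (hsq p ⟨q, by rw [hh]; ring⟩)
  have hi : ∀ i : Fin 2, pderiv i p = 0 := by
    intro i
    have hd : p ∣ pderiv i F := by fin_cases i <;> assumption
    rw [hh, pderiv_mul] at hd
    exact pderiv_eq_zero_of_dvd
      ((hpr.dvd_or_dvd ((dvd_add_left (dvd_mul_right p _)).1 hd)).resolve_right hph)
  have hc := eq_C_of_pderiv_eq_zero hi
  refine hp.not_isUnit ?_
  rw [hc]
  refine (IsUnit.mk0 _ fun h0 => hp.ne_zero ?_).map C
  rw [hc, h0, C_0]

/-- Saito's criterion: `E` and `D` generate the module of logarithmic derivations. -/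
theorem exists_of_mem_logDerivations [CharZero k] (hF : F.IsHomogeneous n) (hsq : Squarefree F)
    (hX : ¬ (X 0 : MvPolynomial (Fin 2) k) ∣ F)
    {d : Derivation k (MvPolynomial (Fin 2) k) (MvPolynomial (Fin 2) k)}
    (hd : d ∈ logDerivations (X 0 * F)) : ∃ a g : MvPolynomial (Fin 2) k,
      d = a • derE k + g • derD F := by
  simp only [logDerivations, Set.mem_ofPred_eq, Ideal.mem_span_singleton] at hd
  -- The Leibniz rule for `d(xF)` shows that `x` divides `F d(x)`. Subtracting a multiple of `E`
  -- then gives a logarithmic derivation `e` with `e(x) = 0`.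
  have hx : (X 0 : MvPolynomial (Fin 2) k) ∣ d (X 0) := by
    refine ((X_prime (i := (0 : Fin 2)) (R := k)).dvd_or_dvd ?_).resolve_left hX
    rw [d.leibniz, smul_eq_mul, smul_eq_mul] at hd
    exact (dvd_add_right (dvd_mul_right _ _)).1 ((dvd_mul_right _ _).trans hd)
  obtain ⟨a, ha⟩ := hx
  set e := d - a • derE k with he
  have hex : e (X 0) = 0 := by simp [he, derE, ha, mul_comm]
  have heQ : X 0 * F ∣ e (X 0 * F) := by
    have h2 := derE_mem hF
    simp only [logDerivations, Set.mem_ofPred_eq, Ideal.mem_span_singleton] at h2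
    rw [he, Derivation.sub_apply, Derivation.smul_apply, smul_eq_mul]
    exact dvd_sub hd (h2.mul_left a)
  have hform : e = e (X 1) • pderiv 1 := by
    refine derivation_ext fun i => ?_
    fin_cases i
    · simp [hex]
    · simp
  have heF : F ∣ e F := by
    rw [e.leibniz, hex, smul_zero, add_zero, smul_eq_mul] at heQ
    exact (mul_dvd_mul_iff_left (X_ne_zero 0)).1 heQ
  -- Here `F` divides `e(F) = e(y) ∂_y F` and is prime to the second factor.
  have hey : F ∣ e (X 1) := by
    rw [hform, Derivation.smul_apply, smul_eq_mul] at heF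
    exact (isRelPrime_pderiv hF hsq hX).dvd_of_dvd_mul_right heF
  obtain ⟨g, hg⟩ := hey
  refine ⟨a, g, ?_⟩
  rw [← sub_eq_iff_eq_add', ← he, hform, hg, derD, smul_smul, mul_comm]

/-- The bracket `[E, D]` is a derivation, so it is enough to compare values at `x` and `y`. At `y`
one uses `E(F) = nF`. -/
theorem derE_derD (hF : F.IsHomogeneous n) (s : MvPolynomial (Fin 2) k) :
    derE k (derD F s) = derD F (derE k s) + ((n : k) - 1) • derD F s := by
  have h : ⁅derE k, derD F⁆ = ((n : k) - 1) • derD F := by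
    refine derivation_ext fun i => ?_
    have hE := derE_apply_of_isHomogeneous hF
    fin_cases i
    · simp [Derivation.commutator_apply, derD, derE]
    · have e1 : derD F (X 1) = F := by simp [derD]
      have e2 : derE k (X 1 : MvPolynomial (Fin 2) k) = X 1 := by simp [derE]
      simp [Derivation.commutator_apply, e1, e2, hE, sub_smul]
  have h' := congrArg (fun d => d s) h
  simp only [Derivation.commutator_apply, Derivation.smul_apply] at h'
  rw [← h']; abel

end Saito

/-! ### Extending derivations to Ore extensions -/

namespace Ore

section Extend

variable {k R : Type*} [CommRing k] [Ring R] [Algebra k R]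

theorem AlgDerivation.map_mul (δ : AlgDerivation k R) (a b : R) :
    δ.toLinearMap (a * b) = δ.toLinearMap a * b + a * δ.toLinearMap b := δ.leibniz' a b

theorem AlgDerivation.map_one (δ : AlgDerivation k R) : δ.toLinearMap 1 = 0 := by
  have h := AlgDerivation.map_mul δ 1 1
  simpa using h

/-- The homomorphism to the dual numbers given by a derivation `ε` of `R` and `t ↦ t + c t ε`. -/
noncomputable def extendHom (δ ε : AlgDerivation k R) (c : k)
    (h : ∀ r, ε.toLinearMap (δ.toLinearMap r)
      = δ.toLinearMap (ε.toLinearMap r) + c • δ.toLinearMap r) :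
    Ext δ →ₐ[k] TrivSqZeroExt (Ext δ) (Ext δ) :=
  lift δ
    (AlgHom.ofLinearMap
      ((TrivSqZeroExt.inlAlgHom k (Ext δ) (Ext δ)).toLinearMap.comp (C δ).toLinearMap
        + (TrivSqZeroExt.inrHom (Ext δ) (Ext δ)).restrictScalars k ∘ₗ (C δ).toLinearMap
          ∘ₗ ε.toLinearMap)
      (by
        ext <;> simp [AlgDerivation.map_one])
      (fun a b => by
        ext <;> simp [AlgDerivation.map_mul, add_comm]))
    (TrivSqZeroExt.inl (t δ) + TrivSqZeroExt.inr (c • t δ))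
    -- In the component along `ε` the commutation rule is exactly the hypothesis on the commutator
    -- of the two derivations.
    (fun r => by
      ext
      · simp [t_mul_C]
      · simp [t_mul_C, h, mul_add]
        abel)

/-- A homomorphism to the dual numbers that lifts the identity is the same as a derivation. This is
the lifting condition. -/
theorem fst_extendHom (δ ε : AlgDerivation k R) (c : k)
    (h : ∀ r, ε.toLinearMap (δ.toLinearMap r)
      = δ.toLinearMap (ε.toLinearMap r) + c • δ.toLinearMap r) (p : Ext δ) :
    (extendHom δ ε c h p).fst = p := by
  have e : (TrivSqZeroExt.fstHom k (Ext δ) (Ext δ)).comp (extendHom δ ε c h)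
      = AlgHom.id k _ := by
    refine hom_ext (fun r => ?_) ?_
    · simp [extendHom]
    · simp [extendHom]
  exact DFunLike.congr_fun e p

/-- The extension to `R[t; δ]` of a derivation of `R`, with `t ↦ c t`. -/
noncomputable def extendDerivation (δ ε : AlgDerivation k R) (c : k)
    (h : ∀ r, ε.toLinearMap (δ.toLinearMap r)
      = δ.toLinearMap (ε.toLinearMap r) + c • δ.toLinearMap r) :
    AlgDerivation k (Ext δ) where
  toLinearMap := (TrivSqZeroExt.sndHom (Ext δ) (Ext δ)).restrictScalars k ∘ₗ
    (extendHom δ ε c h).toLinearMap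
  leibniz' a b := by
    change (extendHom δ ε c h (a * b)).snd
      = (extendHom δ ε c h a).snd * b + a * (extendHom δ ε c h b).snd
    rw [_root_.map_mul, TrivSqZeroExt.snd_mul, fst_extendHom, fst_extendHom, add_comm]
    rfl

theorem extendDerivation_C (δ ε : AlgDerivation k R) (c : k)
    (h : ∀ r, ε.toLinearMap (δ.toLinearMap r)
      = δ.toLinearMap (ε.toLinearMap r) + c • δ.toLinearMap r) (r : R) :
    (extendDerivation δ ε c h).toLinearMap (C δ r) = C δ (ε.toLinearMap r) := by
  change (extendHom δ ε c h (C δ r)).snd = _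
  simp [extendHom]

theorem extendDerivation_t (δ ε : AlgDerivation k R) (c : k)
    (h : ∀ r, ε.toLinearMap (δ.toLinearMap r)
      = δ.toLinearMap (ε.toLinearMap r) + c • δ.toLinearMap r) :
    (extendDerivation δ ε c h).toLinearMap (t δ) = c • t δ := by
  change (extendHom δ ε c h (t δ)).snd = _
  simp [extendHom]

end Extend

/-- It suffices to check the commutation rule of a further variable on generators. -/
theorem commutation_of_generators {k R B : Type*} [CommRing k] [Ring R] [Algebra k R] [Ring B]
    [Algebra k B] {δ : AlgDerivation k R} (ε : AlgDerivation k (Ext δ)) (φ : Ext δ →ₐ[k] B) (b : B)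
    (hC : ∀ r, b * φ (C δ r) = φ (C δ r) * b + φ (ε.toLinearMap (C δ r)))
    (ht : b * φ (t δ) = φ (t δ) * b + φ (ε.toLinearMap (t δ))) (p : Ext δ) :
    b * φ p = φ p * b + φ (ε.toLinearMap p) := by
  induction p using induction_on with
  | hC r => exact hC r
  | ht => exact ht
  | hadd p q hp hq => simp only [map_add, mul_add, add_mul, hp, hq]; abel
  | hmul p q hp hq =>
    rw [AlgDerivation.map_mul, map_add, map_mul, map_mul, map_mul, ← mul_assoc, hp, add_mul,
      mul_assoc, hq]
    noncomm_ring

end Ore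

/-! ### The presentation of the algebra as an iterated Ore extension -/

section Presentation

variable {k : Type u} [Field k] {n : ℕ} {F G : MvPolynomial (Fin 2) k}

/-- The derivation `E` of `S[D]`. -/
noncomputable def derExt (hF : F.IsHomogeneous n) :
    AlgDerivation k (Ore.Ext (AlgDerivation.ofDerivation (derD F))) :=
  Ore.extendDerivation _ (AlgDerivation.ofDerivation (derE k)) ((n : k) - 1)
    (fun s => derE_derD hF s)

theorem derExt_C (hF : F.IsHomogeneous n) (s : MvPolynomial (Fin 2) k) :
    (derExt hF).toLinearMap (Ore.C _ s) = Ore.C _ (derE k s) :=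
  Ore.extendDerivation_C _ _ _ _ s

theorem derExt_t (hF : F.IsHomogeneous n) :
    (derExt hF).toLinearMap (Ore.t _) = ((n : k) - 1) • Ore.t _ :=
  Ore.extendDerivation_t _ _ _ _

/-- The elements of the algebra, as operators on `S`. -/
noncomputable def TangentAlgebra.val (Q : MvPolynomial (Fin 2) k) :
    TangentAlgebra Q →ₐ[k] Module.End k (MvPolynomial (Fin 2) k) :=
  (tangentSubalgebra Q).val

theorem TangentAlgebra.val_injective (Q : MvPolynomial (Fin 2) k) :
    Function.Injective (TangentAlgebra.val Q) := Subtype.val_injective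

theorem TangentAlgebra.val_ofS (Q s f : MvPolynomial (Fin 2) k) :
    TangentAlgebra.val Q (TangentAlgebra.ofS Q s) f = s * f := rfl

theorem val_genD (f : MvPolynomial (Fin 2) k) :
    TangentAlgebra.val _ (genD F) f = derD F f := rfl

theorem val_genE (hF : F.IsHomogeneous n) (f : MvPolynomial (Fin 2) k) :
    TangentAlgebra.val _ (genE hF) f = derE k f := rfl

theorem ofS_injective (Q : MvPolynomial (Fin 2) k) :
    Function.Injective (TangentAlgebra.ofS Q) := by
  intro a b h
  have := congrArg (fun p => TangentAlgebra.val Q p 1) h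
  simpa [TangentAlgebra.val_ofS] using this

theorem tangent_ext {Q : MvPolynomial (Fin 2) k} {a b : TangentAlgebra Q}
    (h : ∀ f, TangentAlgebra.val Q a f = TangentAlgebra.val Q b f) : a = b :=
  TangentAlgebra.val_injective Q (LinearMap.ext h)

/-- The map `S[D] → A`. -/
noncomputable def oreHom₁ (F : MvPolynomial (Fin 2) k) :
    Ore.Ext (AlgDerivation.ofDerivation (derD F)) →ₐ[k] TangentAlgebra (X 0 * F) :=
  Ore.lift _ (TangentAlgebra.ofS _) (genD F) (fun s => tangent_ext fun f => by
    simp only [map_mul, map_add, Module.End.mul_apply, LinearMap.add_apply,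
      TangentAlgebra.val_ofS, val_genD, Derivation.leibniz, smul_eq_mul]
    change _ = s * derD F f + derD F s * f
    ring)

/-- The map `S[D][E] → A`. -/
noncomputable def oreHom (hF : F.IsHomogeneous n) :
    Ore.Ext (derExt hF) →ₐ[k] TangentAlgebra (X 0 * F) :=
  Ore.lift _ (oreHom₁ F) (genE hF) (Ore.commutation_of_generators _ _ _
    (fun s => by
      rw [derExt_C, oreHom₁, Ore.lift_C, Ore.lift_C]
      refine tangent_ext fun f => ?_
      simp only [map_mul, map_add, Module.End.mul_apply, LinearMap.add_apply,
        TangentAlgebra.val_ofS, val_genE, Derivation.leibniz, smul_eq_mul]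
      ring)
    (by
      rw [derExt_t, oreHom₁, map_smul, Ore.lift_t]
      refine tangent_ext fun f => ?_
      simp only [map_mul, map_add, map_smul, Module.End.mul_apply, LinearMap.add_apply,
        LinearMap.smul_apply, val_genD, val_genE]
      exact derE_derD hF f))

/-- Because `D(x) = 0`, the element `x` is central in `S[D]`. It can therefore serve as the central
coefficient when `E` is adjoined. -/
theorem commute_C_X (p : Ore.Ext (AlgDerivation.ofDerivation (derD F))) :
    Commute (Ore.C (AlgDerivation.ofDerivation (derD F)) (X 0)) p := by
  induction p using Ore.induction_on with
  | hC r => exact (Commute.all _ _).map _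
  | ht =>
    refine Commute.symm ?_
    have e : (AlgDerivation.ofDerivation (derD F)).toLinearMap (X 0) = 0 := by
      change derD F (X 0) = 0
      simp [derD]
    have h := Ore.t_mul_C (AlgDerivation.ofDerivation (derD F)) (X 0)
    rw [e, map_zero, add_zero] at h
    exact h
  | hadd p q hp hq => exact hp.add_right hq
  | hmul p q hp hq => exact hp.mul_right hq

/-- The central coefficient is `y`, with `D(y) = F ≠ 0`. -/
theorem oreHom₁_injective [CharZero k] (hF0 : F ≠ 0) : Function.Injective (oreHom₁ F) := by
  refine Ore.injective_of_central (oreHom₁ F) ?_ (X 1) (fun r => Commute.all _ _) ?_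
  · simpa [oreHom₁] using ofS_injective _
  · change derD F (X 1) ≠ 0
    simpa [derD] using hF0

/-- The central coefficient is `x`, with `E(x) = x ≠ 0`. -/
theorem oreHom_injective [CharZero k] (hF : F.IsHomogeneous n) (hF0 : F ≠ 0) :
    Function.Injective (oreHom hF) := by
  have hdom := Ore.isDomain_ext (AlgDerivation.ofDerivation (derD F))
  have hchar : CharZero (Ore.Ext (AlgDerivation.ofDerivation (derD F))) :=
    charZero_of_injective_algebraMap (algebraMap k _).injective
  refine Ore.injective_of_central (oreHom hF) ?_ (Ore.C _ (X 0)) commute_C_X ?_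
  · simpa [oreHom] using oreHom₁_injective hF0
  · rw [derExt_C]
    have e : derE k (X 0 : MvPolynomial (Fin 2) k) = X 0 := by simp [derE]
    rw [e, Ne, map_eq_zero_iff _ (Ore.C_injective _)]
    exact X_ne_zero 0

/-- Saito's criterion writes each generating derivation as `aE + gD` with `a, g` in `S`, so the
image contains all generators. -/
theorem oreHom_surjective [CharZero k] (hF : F.IsHomogeneous n) (hsq : Squarefree F)
    (hX : ¬ (X 0 : MvPolynomial (Fin 2) k) ∣ F) : Function.Surjective (oreHom hF) := by
  have hle : tangentSubalgebra (X 0 * F) ≤ ((TangentAlgebra.val _).comp (oreHom hF)).range := by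
    have hS : ∀ s, LinearMap.mulLeft k s ∈ ((TangentAlgebra.val _).comp (oreHom hF)).range :=
      fun s => ⟨Ore.C _ (Ore.C _ s), by
        refine LinearMap.ext fun f => ?_
        simp [oreHom, oreHom₁, TangentAlgebra.val_ofS]⟩
    refine Algebra.adjoin_le ?_
    rintro _ (⟨s, rfl⟩ | ⟨d, hd, rfl⟩)
    · exact hS s
    · obtain ⟨a, g, rfl⟩ := exists_of_mem_logDerivations hF hsq hX hd
      have hE : (derE k : MvPolynomial (Fin 2) k →ₗ[k] _) ∈
          ((TangentAlgebra.val _).comp (oreHom hF)).range :=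
        ⟨Ore.t _, by
          refine LinearMap.ext fun f => ?_
          simp [oreHom, val_genE]⟩
      have hD : (derD F : MvPolynomial (Fin 2) k →ₗ[k] _) ∈
          ((TangentAlgebra.val _).comp (oreHom hF)).range :=
        ⟨Ore.C _ (Ore.t _), by
          refine LinearMap.ext fun f => ?_
          simp [oreHom, oreHom₁, val_genD]⟩
      exact add_mem (mul_mem (hS a) hE) (mul_mem (hS g) hD)
  intro a
  obtain ⟨p, hp⟩ := hle a.2
  exact ⟨p, TangentAlgebra.val_injective _ hp⟩

/-- The isomorphism `S[D][E] ≅ A`. -/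
noncomputable def oreEquiv [CharZero k] (hF : F.IsHomogeneous n) (hsq : Squarefree F)
    (hFG : F = X 0 * G + X 1 ^ n) : Ore.Ext (derExt hF) ≃ₐ[k] TangentAlgebra (X 0 * F) :=
  AlgEquiv.ofBijective (oreHom hF)
    ⟨oreHom_injective hF hsq.ne_zero, oreHom_surjective hF hsq (not_X_dvd hFG)⟩

end Presentation

/-! ### A twisted Koszul complex -/

/-- Six endomorphisms of a module which satisfy the relations of the right multiplications
by the elements `v ⊗ 1 - 1 ⊗ v`, for `v = x, y, D, E`, and by the two coordinates of `∇(F)`. -/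
structure TwistedKoszul (k T N : Type*) [CommRing k] [Ring T] [AddCommGroup N] [Module k N]
    [Module T N] (r : k) where
  X : N →ₗ[T] N
  Y : N →ₗ[T] N
  D : N →ₗ[T] N
  E : N →ₗ[T] N
  P : N →ₗ[T] N
  Q : N →ₗ[T] N
  Y_X : ∀ a, Y (X a) = X (Y a)
  D_X : ∀ a, D (X a) = X (D a)
  -- Right multiplications compose in reverse order, so this stands for `ξ(y) ξ(D) = ξ(D) ξ(y) -
  -- ξ(F)`, with `ξ(F)` expanded by means of `∇(F)`.
  D_Y : ∀ a, D (Y a) = Y (D a) - X (P a) - Y (Q a)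
  E_X : ∀ a, E (X a) = X (E a) - X a
  E_Y : ∀ a, E (Y a) = Y (E a) - Y a
  E_D : ∀ a, E (D a) = D (E a) - r • D a
  P_X : ∀ a, P (X a) = X (P a)
  Q_X : ∀ a, Q (X a) = X (Q a)
  P_E : ∀ a, P (E a) = E (P a) + r • P a
  Q_E : ∀ a, Q (E a) = E (Q a) + r • Q a

namespace TwistedKoszul

variable {k T N : Type*} [CommRing k] [Ring T] [Algebra k T] [AddCommGroup N] [Module k N]
  [Module T N] [IsScalarTower k T N] {r : k} (K : TwistedKoszul k T N r)

/-- The differential of degree one, in the coordinates `x, y, D, E`. -/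
def d₁ : (Fin 4 → N) →ₗ[T] N where
  toFun c := K.X (c 0) + K.Y (c 1) + K.D (c 2) + K.E (c 3)
  map_add' a b := by simp; abel
  map_smul' a b := by simp

/-- The differential of degree two, from the coordinates `xy, xD, xE, yD, yE, DE`. -/
def d₂ : (Fin 6 → N) →ₗ[T] (Fin 4 → N) where
  toFun c := ![-K.Y (c 0) - K.D (c 1) + (c 2 - K.E (c 2)) + K.P (c 3),
    K.X (c 0) - K.D (c 3) + K.Q (c 3) + (c 4 - K.E (c 4)),
    K.X (c 1) + K.Y (c 3) + (r • c 5 - K.E (c 5)),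
    K.X (c 2) + K.Y (c 4) + K.D (c 5)]
  map_add' a b := by
    funext i
    fin_cases i <;> simp <;> abel
  map_smul' a b := by
    funext i
    fin_cases i <;> simp [smul_add, smul_sub]
    exact (smul_comm a _ _).symm

/-- The differential of degree three, from the coordinates `xyD, xyE, xDE, yDE`. -/
def d₃ : (Fin 4 → N) →ₗ[T] (Fin 6 → N) where
  toFun c := ![K.D (c 0) - K.Q (c 0) + (K.E (c 1) - (2 : k) • c 1),
    -K.Y (c 0) + (K.E (c 2) - (r + 1) • c 2),
    -K.Y (c 1) - K.D (c 2) + K.P (c 3),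
    K.X (c 0) + (K.E (c 3) - (r + 1) • c 3),
    K.X (c 1) - K.D (c 3) + K.Q (c 3),
    K.X (c 2) + K.Y (c 3)]
  map_add' a b := by
    funext i
    fin_cases i <;> simp <;> abel
  map_smul' a b := by
    funext i
    fin_cases i <;> simp [smul_add, smul_sub] <;> exact (smul_comm a _ _).symm

/-- The differential of degree four. -/
def d₄ : N →ₗ[T] (Fin 4 → N) where
  toFun c := ![(r + 2) • c - K.E c, K.D c - K.Q c, -K.Y c, K.X c]
  map_add' a b := by
    funext i
    fin_cases i <;> simp <;> abel
  map_smul' a b := by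
    funext i
    fin_cases i <;> simp [smul_sub]
    exact (smul_comm a _ _).symm

theorem d₁_d₂ (c : Fin 6 → N) : K.d₁ (K.d₂ c) = 0 := by
  simp [d₁, d₂, K.Y_X, K.D_X, K.D_Y, K.E_X, K.E_Y, K.E_D, LinearMap.map_smul_of_tower]
  abel

theorem d₂_d₃ (c : Fin 4 → N) : K.d₂ (K.d₃ c) = 0 := by
  funext i
  fin_cases i <;>
    simp [d₂, d₃, K.Y_X, K.D_X, K.D_Y, K.E_X, K.E_Y, K.E_D, K.P_X, K.Q_X,
      K.P_E, K.Q_E, LinearMap.map_smul_of_tower] <;> module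

theorem d₃_d₄ (c : N) : K.d₃ (K.d₄ c) = 0 := by
  funext i
  fin_cases i <;>
    simp [d₃, d₄, K.Y_X, K.D_X, K.D_Y, K.E_X, K.E_Y, K.E_D, K.P_X, K.Q_X,
      K.Q_E, LinearMap.map_smul_of_tower] <;> module

/-- The endomorphisms `X, Y, D, E` form a regular sequence. -/
structure IsRegular {k T N : Type*} [CommRing k] [Ring T] [AddCommGroup N] [Module k N]
    [Module T N] {r : k} (K : TwistedKoszul k T N r) : Prop where
  X : ∀ a, K.X a = 0 → a = 0
  Y : ∀ a b, K.Y a = K.X b → ∃ p, a = K.X p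
  D : ∀ a b c, K.D a = K.X b + K.Y c → ∃ p q, a = K.X p + K.Y q
  E : ∀ a b c d, K.E a = K.X b + K.Y c + K.D d → ∃ p q s, a = K.X p + K.Y q + K.D s

variable {K}

namespace IsRegular

omit [Algebra k T] [IsScalarTower k T N] in
theorem eq_of_X_eq (h : K.IsRegular) {a b : N} (e : K.X a = K.X b) : a = b :=
  sub_eq_zero.1 (h.X _ (by rw [map_sub, e, sub_self]))

omit [Algebra k T] [IsScalarTower k T N] in
-- Regularity of `Y` modulo the image of `X` gives `b = X p`. Then `X` is cancelled, using that it
-- commutes with `Y`.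
theorem exact_xy (h : K.IsRegular) {a b : N} (e : K.X a + K.Y b = 0) :
    ∃ p, a = -K.Y p ∧ b = K.X p := by
  obtain ⟨p, rfl⟩ := h.Y b (-a) (by rw [map_neg]; exact eq_neg_of_add_eq_zero_right e)
  refine ⟨p, h.eq_of_X_eq ?_, rfl⟩
  rw [map_neg, ← K.Y_X]
  exact eq_neg_of_add_eq_zero_left e

omit [Algebra k T] [IsScalarTower k T N] in
-- Exactness in degree one of the complex on `X, Y, D` alone. Regularity gives `d = X q + Y s`, and
-- removing the boundary given by `q` and `s` leaves a relation between `X` and `Y`.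
theorem exact_xyD₁ (h : K.IsRegular) {a b d : N} (e : K.X a + K.Y b + K.D d = 0) :
    ∃ p q s, a = -K.Y p - K.D q + K.P s ∧ b = K.X p - K.D s + K.Q s ∧ d = K.X q + K.Y s := by
  obtain ⟨q, s, rfl⟩ := h.D d (-a) (-b) (by
    rw [map_neg, map_neg, ← neg_add]; exact eq_neg_of_add_eq_zero_right e)
  obtain ⟨p, hp, hp'⟩ := h.exact_xy (a := a + K.D q - K.P s) (b := b + K.D s - K.Q s) (by
    rw [← e]
    simp only [map_add, map_sub, K.D_X, K.D_Y]
    abel)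
  refine ⟨p, q, s, ?_, ?_, rfl⟩
  · rw [← hp]; abel
  · rw [← hp']; abel

omit [Algebra k T] [IsScalarTower k T N] in
-- Exactness in degree two of the complex on `X, Y, D`. The last equation produces `c`, and the
-- value of `p` follows by cancelling `X`.
theorem exact_xyD₂ (h : K.IsRegular) {p q s : N} (e₁ : -K.Y p - K.D q + K.P s = 0)
    (e₂ : K.X p - K.D s + K.Q s = 0) (e₃ : K.X q + K.Y s = 0) :
    ∃ c, p = K.D c - K.Q c ∧ q = -K.Y c ∧ s = K.X c := by
  obtain ⟨c, rfl, rfl⟩ := h.exact_xy e₃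
  refine ⟨c, h.eq_of_X_eq ?_, rfl, rfl⟩
  rw [← sub_eq_zero, ← e₂]
  simp only [map_sub, K.D_X, K.Q_X]
  abel

/-- The full complex is the cone of `E`, shifted by weights, on the complex of `X, Y, D`. Here
regularity puts the `E`-coordinate in the sum of the images of `X, Y, D`, and removing a boundary
leaves a cycle of the smaller complex. -/
theorem exact₁ (h : K.IsRegular) {c : Fin 4 → N} (e : K.d₁ c = 0) : ∃ b, K.d₂ b = c := by
  replace e : K.X (c 0) + K.Y (c 1) + K.D (c 2) + K.E (c 3) = 0 := e
  obtain ⟨p, q, s, h3⟩ := h.E (c 3) (-c 0) (-c 1) (-c 2) (by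
    simp only [map_neg, ← neg_add]; exact eq_neg_of_add_eq_zero_right e)
  obtain ⟨p', q', s', h0, h1, h2⟩ := h.exact_xyD₁ (a := c 0 + K.E p - p) (b := c 1 + K.E q - q)
    (d := c 2 + K.E s - r • s) (by
      rw [← e, h3]
      simp only [map_add, map_sub, K.E_X, K.E_Y, K.E_D, LinearMap.map_smul_of_tower]
      abel)
  refine ⟨![p', q', p, s', q, s], ?_⟩
  funext i
  fin_cases i
  · simp [d₂]
    linear_combination (norm := module) -h0
  · simp [d₂]
    linear_combination (norm := module) -h1
  · simp [d₂]
    linear_combination (norm := module) -h2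
  · simp [d₂]
    linear_combination (norm := module) -h3

/-- The coordinates `xE, yE, DE` form a cycle of degree one on `X, Y, D`, hence a boundary of some
`p, q, s`. Once that is removed, the other coordinates form a cycle of degree two there. The scalars
`2` and `r + 1` are the weights under `E` of `xy` and of `xD, yD`. -/
theorem exact₂ (h : K.IsRegular) {c : Fin 6 → N} (e : K.d₂ c = 0) : ∃ b, K.d₃ b = c := by
  have e0 : -K.Y (c 0) - K.D (c 1) + (c 2 - K.E (c 2)) + K.P (c 3) = 0 := congrFun e 0
  have e1 : K.X (c 0) - K.D (c 3) + K.Q (c 3) + (c 4 - K.E (c 4)) = 0 := congrFun e 1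
  have e2 : K.X (c 1) + K.Y (c 3) + (r • c 5 - K.E (c 5)) = 0 := congrFun e 2
  have e3 : K.X (c 2) + K.Y (c 4) + K.D (c 5) = 0 := congrFun e 3
  obtain ⟨p, q, s, h2, h4, h5⟩ := h.exact_xyD₁ e3
  obtain ⟨b, h0, h1, h3⟩ := h.exact_xyD₂ (p := c 0 - (K.E p - (2 : k) • p))
    (q := c 1 - (K.E q - (r + 1) • q)) (s := c 3 - (K.E s - (r + 1) • s))
    (by
      rw [← e0, h2]
      simp only [map_add, map_sub, map_neg, K.E_Y, K.E_D, K.P_E, LinearMap.map_smul_of_tower]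
      module)
    (by
      rw [← e1, h4]
      simp only [map_add, map_sub, K.E_X, K.E_D, K.Q_E, LinearMap.map_smul_of_tower]
      module)
    (by
      rw [← e2, h5]
      simp only [map_add, map_sub, K.E_X, K.E_Y, LinearMap.map_smul_of_tower]
      module)
  refine ⟨![b, p, q, s], ?_⟩
  funext i
  fin_cases i
  · simp [d₃]
    linear_combination (norm := module) -h0
  · simp [d₃]
    linear_combination (norm := module) -h1
  · simp [d₃]
    linear_combination (norm := module) -h2
  · simp [d₃]
    linear_combination (norm := module) -h3
  · simp [d₃]
    linear_combination (norm := module) -h4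
  · simp [d₃]
    linear_combination (norm := module) -h5

/-- The coordinates involving `E` form a cycle of degree two on `X, Y, D` and so come from some `b`.
The remaining coordinate agrees with that of `d₄ b` because `X` is injective. The scalar `r + 2` is
the weight of `xyD`. -/
theorem exact₃ (h : K.IsRegular) {c : Fin 4 → N} (e : K.d₃ c = 0) : ∃ b, K.d₄ b = c := by
  have e2 : -K.Y (c 1) - K.D (c 2) + K.P (c 3) = 0 := congrFun e 2
  have e3 : K.X (c 0) + (K.E (c 3) - (r + 1) • c 3) = 0 := congrFun e 3
  have e4 : K.X (c 1) - K.D (c 3) + K.Q (c 3) = 0 := congrFun e 4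
  have e5 : K.X (c 2) + K.Y (c 3) = 0 := congrFun e 5
  obtain ⟨b, h1, h2, h3⟩ := h.exact_xyD₂ e2 e4 e5
  refine ⟨b, ?_⟩
  have h0 : c 0 + K.E b - (r + 2) • b = 0 := by
    refine h.X _ ?_
    rw [← e3, h3]
    simp only [map_add, map_sub, K.E_X, LinearMap.map_smul_of_tower]
    module
  funext i
  fin_cases i
  · simp [d₄]
    linear_combination (norm := module) -h0
  · exact h1.symm
  · exact h2.symm
  · exact h3.symm

theorem injective_d₄ (h : K.IsRegular) : Function.Injective K.d₄ :=
  fun _ _ e => h.eq_of_X_eq (congrFun e 3)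

end IsRegular

end TwistedKoszul

/-! ### Relations in the enveloping algebra -/

section Env

variable {k A : Type*} [Field k] [Ring A] [Algebra k A]

/-- The element `v ⊗ 1 - 1 ⊗ v` of the enveloping algebra. -/
noncomputable def xi (k : Type*) {A : Type*} [Field k] [Ring A] [Algebra k A] (v : A) : Env k A :=
  v ⊗ₜ 1 - 1 ⊗ₜ MulOpposite.op v

theorem xi_add (a b : A) : xi k (a + b) = xi k a + xi k b := by
  simp only [xi, TensorProduct.add_tmul, MulOpposite.op_add, TensorProduct.tmul_add]; abel

theorem xi_neg (a : A) : xi k (-a) = -xi k a := by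
  simp only [xi, TensorProduct.neg_tmul, MulOpposite.op_neg, TensorProduct.tmul_neg]; abel

theorem xi_smul (c : k) (a : A) : xi k (c • a) = c • xi k a := by
  simp only [xi, MulOpposite.op_smul, TensorProduct.tmul_smul, smul_sub, TensorProduct.smul_tmul']

/-- `xi` as a linear map. -/
noncomputable def xiLin (k A : Type*) [Field k] [Ring A] [Algebra k A] : A →ₗ[k] Env k A where
  toFun := xi k
  map_add' := xi_add
  map_smul' := xi_smul

/-- The map `ξ` preserves commutators, so each commutation rule of `A` becomes one between the
operators of the complex. -/
theorem xi_mul_xi (a b : A) : xi k a * xi k b = xi k b * xi k a + xi k (a * b - b * a) := by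
  simp only [xi, mul_sub, sub_mul, Algebra.TensorProduct.tmul_mul_tmul, one_mul, mul_one,
    MulOpposite.op_sub, MulOpposite.op_mul, TensorProduct.sub_tmul, TensorProduct.tmul_sub]
  abel

/-- The map `ξ` is the universal derivation of `A`. Its Leibniz rule lets statements about all
`ξ(a)` be checked on generators, and it underlies the formula for `∇`. -/
theorem xi_mul (a b : A) : xi k (a * b)
    = (a ⊗ₜ 1 : Env k A) * xi k b + ((1 : A) ⊗ₜ MulOpposite.op b : Env k A) * xi k a := by
  simp only [xi, mul_sub, Algebra.TensorProduct.tmul_mul_tmul, one_mul, mul_one,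
    MulOpposite.op_mul]
  abel

theorem commute_tmul_xi {a b v : A} (ha : Commute a v) (hb : Commute b v) :
    Commute (a ⊗ₜ MulOpposite.op b : Env k A) (xi k v) := by
  simp only [Commute, SemiconjBy, xi, mul_sub, sub_mul, Algebra.TensorProduct.tmul_mul_tmul,
    one_mul, mul_one, ← MulOpposite.op_mul, ha.eq, hb.eq]

/-- If `a` and `b` are eigenvectors of `[E, -]`, then `a ⊗ b` is one for `[ξ(E), -]`, and the
eigenvalues add. -/
theorem xi_mul_tmul {E a b : A} {p q : k} (ha : E * a = a * E + p • a)
    (hb : E * b = b * E + q • b) :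
    xi k E * (a ⊗ₜ MulOpposite.op b : Env k A)
      = (a ⊗ₜ MulOpposite.op b : Env k A) * xi k E + (p + q) • (a ⊗ₜ MulOpposite.op b) := by
  simp only [xi, mul_sub, sub_mul, Algebra.TensorProduct.tmul_mul_tmul,
    one_mul, mul_one, ← MulOpposite.op_mul, ha, hb, TensorProduct.add_tmul, MulOpposite.op_add,
    TensorProduct.tmul_add, MulOpposite.op_smul, TensorProduct.tmul_smul,
    ← TensorProduct.smul_tmul']
  module

/-- The coefficient of `x` in `∇(f)`. -/
noncomputable def gradX (x y : A) (f : MvPolynomial (Fin 2) k) : Env k A :=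
  ∑ m ∈ f.support, MvPolynomial.coeff m f • ∑ s ∈ Finset.range (m 0),
    (x ^ s) ⊗ₜ[k] MulOpposite.op (x ^ (m 0 - 1 - s) * y ^ m 1)

/-- The coefficient of `y` in `∇(f)`. -/
noncomputable def gradY (x y : A) (f : MvPolynomial (Fin 2) k) : Env k A :=
  ∑ m ∈ f.support, MvPolynomial.coeff m f • ∑ s ∈ Finset.range (m 1),
    (x ^ m 0 * y ^ s) ⊗ₜ[k] MulOpposite.op (y ^ (m 1 - 1 - s))

theorem nabla_eq {V : Submodule k A} (x y : V) (f : MvPolynomial (Fin 2) k) :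
    nabla x y f = gradX (x : A) (y : A) f ⊗ₜ x + gradY (x : A) (y : A) f ⊗ₜ y := by
  simp only [nabla, gradX, gradY, TensorProduct.sum_tmul, smul_add, Finset.sum_add_distrib,
    ← TensorProduct.smul_tmul', Finset.smul_sum]

/-- The elements `u = a ⊗ 1` and `v = 1 ⊗ a` commute, so this is the factorization of `uⁱ - vⁱ`. -/
theorem xi_pow (a : A) (i : ℕ) : xi k (a ^ i)
    = (∑ s ∈ Finset.range i, (a ^ s) ⊗ₜ MulOpposite.op (a ^ (i - 1 - s)) : Env k A) * xi k a := by
  have hc : Commute (a ⊗ₜ 1 : Env k A) (1 ⊗ₜ MulOpposite.op a) := by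
    simp [Commute, SemiconjBy]
  have h := hc.geom_sum₂_mul i
  simp only [Algebra.TensorProduct.tmul_pow, one_pow, Algebra.TensorProduct.tmul_mul_tmul, one_mul,
    mul_one, ← MulOpposite.op_pow] at h
  exact h.symm

theorem xi_monomial (x y : A) (i j : ℕ) : xi k (x ^ i * y ^ j)
    = (∑ s ∈ Finset.range i, (x ^ s) ⊗ₜ MulOpposite.op (x ^ (i - 1 - s) * y ^ j) : Env k A)
        * xi k x
      + (∑ s ∈ Finset.range j, (x ^ i * y ^ s) ⊗ₜ MulOpposite.op (y ^ (j - 1 - s)) : Env k A)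
        * xi k y := by
  rw [xi_mul, xi_pow, xi_pow, ← mul_assoc, ← mul_assoc, Finset.mul_sum, Finset.mul_sum, add_comm]
  simp only [Algebra.TensorProduct.tmul_mul_tmul, one_mul, ← MulOpposite.op_mul]

/-- In other words `d₁(∇(f)) = ξ(f)`. This is why `∇(F)` is the correction term that the relation
`[D, y] = F` requires in `d₂`. -/
theorem xi_aeval (s : MvPolynomial (Fin 2) k →ₐ[k] A) (f : MvPolynomial (Fin 2) k) :
    xi k (s f) = gradX (s (X 0)) (s (X 1)) f * xi k (s (X 0))
      + gradY (s (X 0)) (s (X 1)) f * xi k (s (X 1)) := by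
  have hf : s f = ∑ m ∈ f.support, coeff m f • (s (X 0) ^ m 0 * s (X 1) ^ m 1) := by
    conv_lhs => rw [f.as_sum, map_sum]
    refine Finset.sum_congr rfl fun m _ => ?_
    rw [monomial_eq, Finsupp.prod_fintype _ _ (by simp), Fin.prod_univ_two, ← smul_eq_C_mul]
    simp
  rw [hf]
  change xiLin k A _ = _
  rw [map_sum, gradX, gradY, Finset.sum_mul, Finset.sum_mul, ← Finset.sum_add_distrib]
  refine Finset.sum_congr rfl fun m _ => ?_
  rw [map_smul]
  change _ • xi k _ = _
  rw [xi_monomial, smul_add, smul_mul_assoc, smul_mul_assoc]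

theorem commute_gradX_xi {x y v : A} (hx : Commute x v) (hy : Commute y v)
    (f : MvPolynomial (Fin 2) k) : Commute (gradX x y f) (xi k v) :=
  Commute.sum_left _ _ _ fun _ _ => Commute.smul_left (Commute.sum_left _ _ _ fun _ _ =>
    commute_tmul_xi (hx.pow_left _) ((hx.pow_left _).mul_left (hy.pow_left _))) _

theorem commute_gradY_xi {x y v : A} (hx : Commute x v) (hy : Commute y v)
    (f : MvPolynomial (Fin 2) k) : Commute (gradY x y f) (xi k v) :=
  Commute.sum_left _ _ _ fun _ _ => Commute.smul_left (Commute.sum_left _ _ _ fun _ _ =>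
    commute_tmul_xi ((hx.pow_left _).mul_left (hy.pow_left _)) (hy.pow_left _)) _

theorem weight_mul {E a b : A} {p q : k} (ha : E * a = a * E + p • a)
    (hb : E * b = b * E + q • b) : E * (a * b) = a * b * E + (p + q) • (a * b) := by
  rw [← mul_assoc, ha, add_mul, mul_assoc, hb, mul_add, ← mul_assoc, add_smul]
  simp only [smul_mul_assoc, mul_smul_comm]
  abel

theorem weight_pow {E a : A} (ha : E * a = a * E + a) (i : ℕ) :
    E * a ^ i = a ^ i * E + (i : k) • a ^ i := by
  induction i with
  | zero => simp
  | succ i ih =>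
    rw [pow_succ, weight_mul ih (q := 1) (by simpa using ha), Nat.cast_succ]

/-- Each term of the coefficient of `x` in `∇(f)` has lost one variable, so its weight under `E` is
`n - 1`. -/
theorem xi_mul_gradX {x y E : A} (hx : E * x = x * E + x) (hy : E * y = y * E + y)
    {f : MvPolynomial (Fin 2) k} {n : ℕ} (hf : f.IsHomogeneous n) :
    xi k E * gradX x y f = gradX x y f * xi k E + ((n : k) - 1) • gradX x y f := by
  rw [gradX, Finset.mul_sum, Finset.sum_mul, Finset.smul_sum, ← Finset.sum_add_distrib]
  refine Finset.sum_congr rfl fun m hm => ?_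
  rw [mul_smul_comm, smul_mul_assoc, smul_comm _ (coeff m f), ← smul_add]
  congr 1
  rw [Finset.mul_sum, Finset.sum_mul, Finset.smul_sum, ← Finset.sum_add_distrib]
  refine Finset.sum_congr rfl fun s hs => ?_
  rw [xi_mul_tmul (weight_pow hx s) (weight_mul (weight_pow hx _) (weight_pow hy _))]
  congr 2
  have h1 := hf (mem_support_iff.1 hm)
  rw [Finsupp.weight_apply, Finsupp.sum_fintype _ _ (by simp), Fin.sum_univ_two] at h1
  simp at h1
  have h2 := Finset.mem_range.1 hs
  -- The truncated subtraction is harmless since `s < m 0`. The added `1` accounts for the removed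
  -- variable.
  have h3 : s + (m 0 - 1 - s + m 1) + 1 = n := by omega
  rw [← h3]; push_cast; ring

theorem xi_mul_gradY {x y E : A} (hx : E * x = x * E + x) (hy : E * y = y * E + y)
    {f : MvPolynomial (Fin 2) k} {n : ℕ} (hf : f.IsHomogeneous n) :
    xi k E * gradY x y f = gradY x y f * xi k E + ((n : k) - 1) • gradY x y f := by
  rw [gradY, Finset.mul_sum, Finset.sum_mul, Finset.smul_sum, ← Finset.sum_add_distrib]
  refine Finset.sum_congr rfl fun m hm => ?_
  rw [mul_smul_comm, smul_mul_assoc, smul_comm _ (coeff m f), ← smul_add]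
  congr 1
  rw [Finset.mul_sum, Finset.sum_mul, Finset.smul_sum, ← Finset.sum_add_distrib]
  refine Finset.sum_congr rfl fun s hs => ?_
  rw [xi_mul_tmul (weight_mul (weight_pow hx _) (weight_pow hy s)) (weight_pow hy _)]
  congr 2
  have h1 := hf (mem_support_iff.1 hm)
  rw [Finsupp.weight_apply, Finsupp.sum_fintype _ _ (by simp), Fin.sum_univ_two] at h1
  simp at h1
  have h2 := Finset.mem_range.1 hs
  have h3 : m 0 + s + (m 1 - 1 - s) + 1 = n := by omega
  rw [← h3]; push_cast; ring

end Env

/-! ### The twisted Koszul complex of an iterated Ore extension -/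

section Koszul

/-- An algebra with a map from `S = k[x, y]` and elements `D` and `E` which satisfy the
commutation rules of `S[D; F∂_y][E]`. -/
structure OreTriple {k : Type*} [Field k] (F : MvPolynomial (Fin 2) k) (n : ℕ) (A : Type*)
    [Ring A] [Algebra k A] where
  s : MvPolynomial (Fin 2) k →ₐ[k] A
  D : A
  E : A
  D_s : ∀ f, D * s f = s f * D + s (F * pderiv 1 f)
  E_s : ∀ f, E * s f = s f * E + s (X 0 * pderiv 0 f + X 1 * pderiv 1 f)
  E_D : E * D = D * E + ((n : k) - 1) • D

variable {k A : Type*} [Field k] [Ring A] [Algebra k A] {n : ℕ} {F : MvPolynomial (Fin 2) k}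

namespace OreTriple

variable (O : OreTriple F n A)

/-- The element `x`. -/
noncomputable def x : A := O.s (X 0)

/-- The element `y`. -/
noncomputable def y : A := O.s (X 1)

theorem commute_x_y : Commute O.x O.y := (Commute.all _ _).map O.s

theorem D_x : O.D * O.x = O.x * O.D := by
  simpa [x, y] using O.D_s (X 0)

theorem D_y : O.D * O.y = O.y * O.D + O.s F := by
  simpa [x, y] using O.D_s (X 1)

theorem E_x : O.E * O.x = O.x * O.E + O.x := by
  simpa [x, y] using O.E_s (X 0)

theorem E_y : O.E * O.y = O.y * O.E + O.y := by
  simpa [x, y] using O.E_s (X 1)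

/-- The twisted Koszul complex on a right module over the enveloping algebra. -/
noncomputable def koszul {T N : Type*} [Ring T] [Algebra k T] [AddCommGroup N] [Module k N]
    [Module T N] [IsScalarTower k T N] (hF : F.IsHomogeneous n)
    (θ : Env k A →ₐ[k] (Module.End T N)ᵐᵒᵖ) : TwistedKoszul k T N ((n : k) - 1) :=
  -- The enveloping algebra acts on the right: in a product `u v` the factor `u` acts first. Each
  -- field below is thereby an identity in `Aᵉ`.
  have key : ∀ (u v w : Env k A) (a : N), u * v = w →
      (θ v).unop ((θ u).unop a) = (θ w).unop a := by
    rintro u v _ a rfl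
    rw [map_mul]; rfl
  have hadd : ∀ (u v : Env k A) (a : N), (θ (u + v)).unop a = (θ u).unop a + (θ v).unop a := by
    intro u v a; rw [map_add]; rfl
  have hsub : ∀ (u v : Env k A) (a : N), (θ (u - v)).unop a = (θ u).unop a - (θ v).unop a := by
    intro u v a; rw [map_sub]; rfl
  have hsmul : ∀ (c : k) (v : Env k A) (a : N), (θ (c • v)).unop a = c • (θ v).unop a := by
    intro u v a; rw [map_smul]; rfl
  { X := (θ (xi k O.x)).unop
    Y := (θ (xi k O.y)).unop
    D := (θ (xi k O.D)).unop
    E := (θ (xi k O.E)).unop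
    P := (θ (gradX O.x O.y F)).unop
    Q := (θ (gradY O.x O.y F)).unop
    Y_X := fun a => by
      rw [key _ _ (xi k O.y * xi k O.x) a, key _ _ _ a rfl]
      rw [xi_mul_xi, O.commute_x_y.eq, sub_self]
      simp [xi]
    D_X := fun a => by
      rw [key _ _ (xi k O.D * xi k O.x) a, key _ _ _ a rfl]
      rw [xi_mul_xi, O.D_x, sub_self]
      simp [xi]
    D_Y := fun a => by
      rw [key _ _ (xi k O.D * xi k O.y - gradX O.x O.y F * xi k O.x
        - gradY O.x O.y F * xi k O.y) a, key _ _ _ a rfl, key _ _ _ a rfl, key _ _ _ a rfl,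
        hsub, hsub]
      rw [xi_mul_xi, O.D_y, sub_add_cancel_left, xi_neg, xi_aeval]
      simp only [x, y]
      abel
    E_X := fun a => by
      rw [key _ _ (xi k O.E * xi k O.x - xi k O.x) a, key _ _ _ a rfl, hsub]
      rw [xi_mul_xi, O.E_x, sub_add_cancel_left, xi_neg]
      abel
    E_Y := fun a => by
      rw [key _ _ (xi k O.E * xi k O.y - xi k O.y) a, key _ _ _ a rfl, hsub]
      rw [xi_mul_xi, O.E_y, sub_add_cancel_left, xi_neg]
      abel
    E_D := fun a => by
      rw [key _ _ (xi k O.E * xi k O.D - ((n : k) - 1) • xi k O.D) a, key _ _ _ a rfl, hsub,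
        hsmul]
      rw [xi_mul_xi, O.E_D, sub_add_cancel_left, xi_neg, xi_smul]
      abel
    P_X := fun a => by
      rw [key _ _ (gradX O.x O.y F * xi k O.x) a, key _ _ _ a rfl]
      exact (commute_gradX_xi (Commute.refl _) O.commute_x_y.symm F).eq.symm
    Q_X := fun a => by
      rw [key _ _ (gradY O.x O.y F * xi k O.x) a, key _ _ _ a rfl]
      exact (commute_gradY_xi (Commute.refl _) O.commute_x_y.symm F).eq.symm
    P_E := fun a => by
      rw [key _ _ (gradX O.x O.y F * xi k O.E + ((n : k) - 1) • gradX O.x O.y F) a,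
        key _ _ _ a rfl, hadd, hsmul]
      exact xi_mul_gradX O.E_x O.E_y hF
    Q_E := fun a => by
      rw [key _ _ (gradY O.x O.y F * xi k O.E + ((n : k) - 1) • gradY O.x O.y F) a,
        key _ _ _ a rfl, hadd, hsmul]
      exact xi_mul_gradY O.E_x O.E_y hF }

end OreTriple

end Koszul

/-! ### Free modules and their projections -/

section Regularity

variable {k A M : Type*} [Field k] [Ring A] [Algebra k A] [AddCommGroup M] [Module k M]
  [Module Aᵐᵒᵖ M] [IsScalarTower k Aᵐᵒᵖ M]

/-- The action of `A` on `Aᵐᵒᵖ ⊗ M` through the right module `M`. -/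
noncomputable def envActionLeft (k A M : Type*) [Field k] [Ring A] [Algebra k A] [AddCommGroup M]
    [Module k M] [Module Aᵐᵒᵖ M] [IsScalarTower k Aᵐᵒᵖ M] :
    A →ₐ[k] (Module.End Aᵐᵒᵖ (Aᵐᵒᵖ ⊗[k] M))ᵐᵒᵖ :=
  AlgHom.ofLinearMap
    { toFun := fun a => MulOpposite.op (TensorProduct.AlgebraTensorModule.map LinearMap.id
        (Algebra.lsmul k k M (MulOpposite.op a)))
      map_add' := fun a b => by
        rw [← MulOpposite.op_add]
        congr 1
        ext; simp [TensorProduct.tmul_add]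
      map_smul' := fun c a => by
        rw [RingHom.id_apply, ← MulOpposite.op_smul]
        congr 1
        ext; simp [TensorProduct.tmul_smul] }
    (by
      apply MulOpposite.unop_injective
      ext; simp)
    (fun a b => by
      apply MulOpposite.unop_injective
      ext; simp)

/-- The action of `Aᵐᵒᵖ` on `Aᵐᵒᵖ ⊗ M` by right multiplication. -/
noncomputable def envActionRight (k A M : Type*) [Field k] [Ring A] [Algebra k A] [AddCommGroup M]
    [Module k M] [Module Aᵐᵒᵖ M] [IsScalarTower k Aᵐᵒᵖ M] :
    Aᵐᵒᵖ →ₐ[k] (Module.End Aᵐᵒᵖ (Aᵐᵒᵖ ⊗[k] M))ᵐᵒᵖ :=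
  AlgHom.ofLinearMap
    { toFun := fun b => MulOpposite.op (TensorProduct.AlgebraTensorModule.map
        (LinearMap.toSpanSingleton Aᵐᵒᵖ Aᵐᵒᵖ b) LinearMap.id)
      map_add' := fun a b => by
        rw [← MulOpposite.op_add]
        congr 1
        ext; simp [TensorProduct.add_tmul]
      map_smul' := fun c a => by
        rw [RingHom.id_apply, ← MulOpposite.op_smul]
        congr 1
        ext; simp [TensorProduct.smul_tmul'] }
    (by
      apply MulOpposite.unop_injective
      ext; simp)
    (fun a b => by
      apply MulOpposite.unop_injective
      ext; simp)

theorem envActionLeft_tmul (a : A) (c : Aᵐᵒᵖ) (m : M) :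
    (envActionLeft k A M a).unop (c ⊗ₜ m) = c ⊗ₜ (MulOpposite.op a • m) := rfl

theorem envActionRight_tmul (b c : Aᵐᵒᵖ) (m : M) :
    (envActionRight k A M b).unop (c ⊗ₜ m) = (c * b) ⊗ₜ m := rfl

theorem commute_envAction (a : A) (b : Aᵐᵒᵖ) :
    Commute (envActionLeft k A M a) (envActionRight k A M b) := by
  apply MulOpposite.unop_injective
  ext
  simp [envActionLeft_tmul, envActionRight_tmul]

/-- The right action of the enveloping algebra on `Aᵐᵒᵖ ⊗ M`, for a right `A`-module `M`:
`a ⊗ b` acts on `Aᵐᵒᵖ` by `b` and on `M` by `a`. -/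
noncomputable def envAction (k A M : Type*) [Field k] [Ring A] [Algebra k A] [AddCommGroup M]
    [Module k M] [Module Aᵐᵒᵖ M] [IsScalarTower k Aᵐᵒᵖ M] :
    Env k A →ₐ[k] (Module.End Aᵐᵒᵖ (Aᵐᵒᵖ ⊗[k] M))ᵐᵒᵖ :=
  Algebra.TensorProduct.lift (envActionLeft k A M) (envActionRight k A M) commute_envAction

theorem envAction_tmul (a : A) (b c : Aᵐᵒᵖ) (m : M) :
    (envAction k A M (a ⊗ₜ b)).unop (c ⊗ₜ m) = (c * b) ⊗ₜ (MulOpposite.op a • m) := by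
  rw [envAction, Algebra.TensorProduct.lift_tmul, MulOpposite.unop_mul, Module.End.mul_apply,
    envActionLeft_tmul, envActionRight_tmul]

/-- The action of `v ⊗ 1 - 1 ⊗ v`. -/
noncomputable def xiOp (k M : Type*) {A : Type*} [Field k] [Ring A] [Algebra k A] [AddCommGroup M]
    [Module k M] [Module Aᵐᵒᵖ M] [IsScalarTower k Aᵐᵒᵖ M] (v : A) :
    Module.End Aᵐᵒᵖ (Aᵐᵒᵖ ⊗[k] M) :=
  (envAction k A M (xi k v)).unop

theorem xiOp_tmul (v b : A) (m : M) :
    xiOp k M v (MulOpposite.op b ⊗ₜ m)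
      = MulOpposite.op b ⊗ₜ (MulOpposite.op v • m) - MulOpposite.op (v * b) ⊗ₜ m := by
  rw [xiOp, xi, map_sub, MulOpposite.unop_sub, LinearMap.sub_apply, envAction_tmul, envAction_tmul]
  simp

/-- The elements `v` such that `v ⊗ 1 - 1 ⊗ v` maps everything into a given subspace. -/
noncomputable def xiSubalgebra (K : Submodule k (Aᵐᵒᵖ ⊗[k] M)) : Subalgebra k A where
  carrier := {v | ∀ z, xiOp k M v z ∈ K}
  mul_mem' := by
    intro u v hu hv z
    -- By the Leibniz rule `ξ(uv) = (u ⊗ 1) ξ(v) + (1 ⊗ v) ξ(u)`, where the final factors act last.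
    have e : xiOp k M (u * v) z = xiOp k M v ((envAction k A M (u ⊗ₜ 1)).unop z)
        + xiOp k M u ((envAction k A M (1 ⊗ₜ MulOpposite.op v)).unop z) := by
      rw [xiOp, xi_mul, map_add, map_mul, map_mul]; rfl
    rw [e]
    exact K.add_mem (hv _) (hu _)
  add_mem' := by
    intro u v hu hv z
    have e : xiOp k M (u + v) z = xiOp k M u z + xiOp k M v z := by
      rw [xiOp, xi_add, map_add]; rfl
    rw [e]
    exact K.add_mem (hu z) (hv z)
  algebraMap_mem' := by
    intro c z
    have e : xi k (algebraMap k A c) = 0 := by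
      rw [Algebra.algebraMap_eq_smul_one, xi_smul]
      simp [xi]
    rw [xiOp, e]
    simp

variable {R I : Type*} [Ring R] [Algebra k R] {ι : R →ₐ[k] A} {β : I → A}

omit [Module Aᵐᵒᵖ M] [IsScalarTower k Aᵐᵒᵖ M] in
theorem tensor_ext_of_isLeftBasis (h : IsLeftBasis ι β) {P : Type*} [AddCommGroup P] [Module k P]
    {f g : Aᵐᵒᵖ ⊗[k] M →ₗ[k] P}
    (H : ∀ c i m, f (MulOpposite.op (ι c * β i) ⊗ₜ m) = g (MulOpposite.op (ι c * β i) ⊗ₜ m)) :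
    f = g := by
  refine TensorProduct.ext' fun b m => ?_
  induction b using MulOpposite.rec' with | _ b =>
  obtain ⟨p, rfl⟩ := h.2 b
  induction p using Finsupp.induction_linear with
  | zero => simp
  | add p q hp hq => simp only [map_add, MulOpposite.op_add, TensorProduct.add_tmul, hp, hq]
  | single i c => rw [leftCombination_single]; exact H c i m

/-- The isomorphism of `A` with the direct sum of copies of `R` given by a basis. -/
noncomputable def IsLeftBasis.equiv (h : IsLeftBasis ι β) : (I →₀ R) ≃ₗ[k] A :=
  LinearEquiv.ofBijective (leftCombination ι β) h

theorem IsLeftBasis.equiv_symm (h : IsLeftBasis ι β) (c : R) (i : I) :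
    h.equiv.symm (ι c * β i) = Finsupp.single i c := by
  rw [LinearEquiv.symm_apply_eq]
  exact (leftCombination_single ι β i c).symm

/-- The map `R ⊗ M → M`, `c ⊗ m ↦ m ι(c)`. -/
noncomputable def rightAct (M : Type*) [AddCommGroup M] [Module k M]
    [Module Aᵐᵒᵖ M] [IsScalarTower k Aᵐᵒᵖ M] (ι : R →ₐ[k] A) : R ⊗[k] M →ₗ[k] M :=
  TensorProduct.lift ((Algebra.lsmul k k M).toLinearMap ∘ₗ
      (MulOpposite.opLinearEquiv k).toLinearMap ∘ₗ ι.toLinearMap)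

theorem rightAct_tmul (ι : R →ₐ[k] A) (c : R) (m : M) :
    rightAct M ι (c ⊗ₜ m) = MulOpposite.op (ι c) • m := rfl

open Classical in
/-- The projection of `Aᵐᵒᵖ ⊗ M` onto the direct sum of copies of `M` given by a basis of `A` as a
left `R`-module. -/
noncomputable def leftProj (M : Type*) [AddCommGroup M] [Module k M]
    [Module Aᵐᵒᵖ M] [IsScalarTower k Aᵐᵒᵖ M] (h : IsLeftBasis ι β) :
    Aᵐᵒᵖ ⊗[k] M →ₗ[k] (I →₀ M) :=
  Finsupp.mapRange.linearMap (rightAct M ι) ∘ₗ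
    (TensorProduct.finsuppLeft k k R M I).toLinearMap ∘ₗ
    (h.equiv.symm.toLinearMap ∘ₗ (MulOpposite.opLinearEquiv k).symm.toLinearMap).rTensor M

theorem leftProj_tmul (h : IsLeftBasis ι β) (c : R) (i : I) (m : M) :
    leftProj M h (MulOpposite.op (ι c * β i) ⊗ₜ m)
      = Finsupp.single i (MulOpposite.op (ι c) • m) := by
  classical
  simp only [leftProj, LinearMap.comp_apply, LinearMap.rTensor_tmul, LinearEquiv.coe_coe,
    MulOpposite.coe_opLinearEquiv_symm, MulOpposite.unop_op, h.equiv_symm]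
  rw [TensorProduct.finsuppLeft_apply_tmul, Finsupp.sum_single_index (by simp)]
  simp [rightAct_tmul]

/-- The projection identifies the target with `M ⊗_R A`, where `c` passes through the tensor sign.
-/
theorem leftProj_xiOp_base (h : IsLeftBasis ι β) (c : R) (z : Aᵐᵒᵖ ⊗[k] M) :
    leftProj M h (xiOp k M (ι c) z) = 0 := by
  have e : leftProj M h ∘ₗ (xiOp k M (ι c)).restrictScalars k = 0 := by
    refine tensor_ext_of_isLeftBasis h fun c' i m => ?_
    rw [LinearMap.comp_apply, LinearMap.restrictScalars_apply, xiOp_tmul, map_sub, leftProj_tmul,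
      ← mul_assoc, ← map_mul, leftProj_tmul, map_mul, MulOpposite.op_mul, mul_smul, sub_self,
      LinearMap.zero_apply]
  exact LinearMap.congr_fun e z

/-- On the direct sum, `ξ(w)` sends `m` in position `i` to `mw` in position `i` minus `m` in
position `s(i)`. The terms with `δ(c)` cancel against those from exchanging `w` and `c` in `M`. -/
theorem leftProj_xiOp_next (h : IsLeftBasis ι β) {w : A} {δ : R → R} {s : I → I}
    (hw : ∀ c, w * ι c = ι c * w + ι (δ c)) (hs : ∀ i, w * β i = β (s i)) (z : Aᵐᵒᵖ ⊗[k] M) :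
    leftProj M h (xiOp k M w z)
      = Finsupp.mapRange.linearMap (Algebra.lsmul k k M (MulOpposite.op w)) (leftProj M h z)
        - Finsupp.lmapDomain M k s (leftProj M h z) := by
  have e : leftProj M h ∘ₗ (xiOp k M w).restrictScalars k
      = (Finsupp.mapRange.linearMap (Algebra.lsmul k k M (MulOpposite.op w))
        - Finsupp.lmapDomain M k s) ∘ₗ leftProj M h := by
    refine tensor_ext_of_isLeftBasis h fun c i m => ?_
    have e1 : w * (ι c * β i) = ι c * β (s i) + ι (δ c) * β i := by
      rw [← mul_assoc, hw, add_mul, mul_assoc, hs]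
    have e2 : MulOpposite.op (ι c) • MulOpposite.op w • m
        = MulOpposite.op w • MulOpposite.op (ι c) • m + MulOpposite.op (ι (δ c)) • m := by
      rw [← mul_smul, ← mul_smul, ← add_smul, ← MulOpposite.op_mul, ← MulOpposite.op_mul,
        ← MulOpposite.op_add, hw]
    rw [LinearMap.comp_apply, LinearMap.restrictScalars_apply, xiOp_tmul, map_sub, leftProj_tmul,
      e1, MulOpposite.op_add, TensorProduct.add_tmul, map_add, leftProj_tmul, leftProj_tmul, e2,
      LinearMap.comp_apply, leftProj_tmul, Finsupp.single_add]
    simp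
  exact LinearMap.congr_fun e z

/-- The inclusion of the direct sum of copies of `M` in `Aᵐᵒᵖ ⊗ M`. -/
noncomputable def leftIncl (k M : Type*) [Field k] [Algebra k A] [AddCommGroup M] [Module k M]
    (β : I → A) : (I →₀ M) →ₗ[k] Aᵐᵒᵖ ⊗[k] M :=
  Finsupp.lsum k fun i => TensorProduct.mk k Aᵐᵒᵖ M (MulOpposite.op (β i))

/-- Modulo the images of the `ξ(c)`, the element `cβᵢ ⊗ m` equals `βᵢ ⊗ mc`. So the projection
followed by `leftIncl` is the identity modulo `K`, and the kernel of the projection lies in `K`. -/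
theorem mem_of_leftProj_eq_zero (h : IsLeftBasis ι β) {K : Submodule k (Aᵐᵒᵖ ⊗[k] M)}
    (hK : ∀ c, ι c ∈ xiSubalgebra K) {z : Aᵐᵒᵖ ⊗[k] M} (hz : leftProj M h z = 0) : z ∈ K := by
  have e : K.mkQ = (K.mkQ ∘ₗ leftIncl k M β) ∘ₗ leftProj M h := by
    refine tensor_ext_of_isLeftBasis h fun c i m => ?_
    rw [LinearMap.comp_apply, leftProj_tmul, LinearMap.comp_apply, ← sub_eq_zero, ← map_sub,
      Submodule.mkQ_apply, Submodule.Quotient.mk_eq_zero]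
    have h1 := hK c (MulOpposite.op (β i) ⊗ₜ m)
    rw [xiOp_tmul, ← Submodule.neg_mem_iff, neg_sub] at h1
    simpa [leftIncl] using h1
  have h1 := LinearMap.congr_fun e z
  rwa [LinearMap.comp_apply, hz, map_zero, Submodule.mkQ_apply,
    Submodule.Quotient.mk_eq_zero] at h1

omit [IsScalarTower k Aᵐᵒᵖ M] [Module Aᵐᵒᵖ M] in
-- Take `i` of largest degree in the support and compare the entries at `s(i)`: the left one
-- vanishes and the right one is `P i`.
theorem eq_zero_of_mapRange_eq_mapDomain {f : M →ₗ[k] M} {s : I → I} (hs : Function.Injective s)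
    (deg : I → ℕ) (hdeg : ∀ i, deg (s i) = deg i + 1) {P : I →₀ M}
    (hP : Finsupp.mapRange.linearMap f P = Finsupp.lmapDomain M k s P) : P = 0 := by
  by_contra h0
  obtain ⟨i, hi, hmax⟩ := P.support.exists_max_image deg (Finsupp.support_nonempty_iff.2 h0)
  have h1 := DFunLike.congr_fun hP (s i)
  have h2 : P (s i) = 0 := by
    by_contra h2
    have := hmax _ (Finsupp.mem_support_iff.2 h2)
    rw [hdeg] at this
    omega
  rw [Finsupp.mapRange.linearMap_apply, Finsupp.mapRange_apply, h2, map_zero,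
    Finsupp.lmapDomain_apply, Finsupp.mapDomain_apply hs] at h1
  exact Finsupp.mem_support_iff.1 hi h1.symm

/-- The element `w ⊗ 1 - 1 ⊗ w` is regular modulo the ideal generated by the elements `c ⊗ 1 - 1 ⊗ c`
with `c` in `R`, if `w` is one of the variables in a monomial basis of `A` over `R`. -/
theorem mem_of_xiOp_mem (h : IsLeftBasis ι β) {K : Submodule k (Aᵐᵒᵖ ⊗[k] M)}
    (hK : ∀ c, ι c ∈ xiSubalgebra K) (hK' : ∀ z ∈ K, leftProj M h z = 0)
    {w : A} {δ : R → R} {s : I → I} (hs : Function.Injective s)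
    (deg : I → ℕ) (hdeg : ∀ i, deg (s i) = deg i + 1)
    (hw : ∀ c, w * ι c = ι c * w + ι (δ c)) (hβ : ∀ i, w * β i = β (s i)) {z : Aᵐᵒᵖ ⊗[k] M}
    (hz : xiOp k M w z ∈ K) : z ∈ K := by
  have h1 := hK' _ hz
  rw [leftProj_xiOp_next h hw hβ, sub_eq_zero] at h1
  exact mem_of_leftProj_eq_zero h hK (eq_zero_of_mapRange_eq_mapDomain hs deg hdeg h1)

end Regularity

/-! ### Monomial bases -/

section Monomials

variable {k A : Type*} [Field k] [Ring A] [Algebra k A]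

theorem isLeftBasis_of_basis {I : Type*} (b : Module.Basis I k A) :
    IsLeftBasis (Algebra.ofId k A) b := by
  have e : leftCombination (Algebra.ofId k A) b = b.repr.symm.toLinearMap := by
    refine Finsupp.lhom_ext fun i c => ?_
    simp [Algebra.ofId_apply, Algebra.smul_def]
  unfold IsLeftBasis
  rw [e]
  exact b.repr.symm.bijective

theorem isLeftBasis_X_pow (k : Type*) [Field k] :
    IsLeftBasis (Algebra.ofId k (Polynomial k)) fun i => Polynomial.X ^ i := by
  have h := isLeftBasis_of_basis (Polynomial.basisMonomials k)
  have e : ⇑(Polynomial.basisMonomials k) = fun i => Polynomial.X ^ i := by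
    funext i; simp [Polynomial.X_pow_eq_monomial]
  rwa [e] at h

/-- The exponent of `y` comes first in the index to match the order produced by `IsLeftBasis.trans`.
-/
theorem isLeftBasis_monomial (k : Type*) [Field k] :
    IsLeftBasis (Algebra.ofId k (MvPolynomial (Fin 2) k))
      fun j : ℕ × ℕ => X 0 ^ j.2 * X 1 ^ j.1 := by
  have h := isLeftBasis_of_basis ((basisMonomials (Fin 2) k).reindex
    ((Finsupp.linearEquivFunOnFinite ℕ ℕ (Fin 2)).toEquiv.trans
      ((finTwoArrowEquiv ℕ).trans (Equiv.prodComm ℕ ℕ))))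
  convert h using 1
  funext j
  simp [monomial_eq, Finsupp.prod_fintype, Fin.prod_univ_two]

theorem isLeftBasis_X_one_pow (k : Type*) [Field k] :
    IsLeftBasis (Polynomial.aeval (R := k) (X 0 : MvPolynomial (Fin 2) k)) fun j => X 1 ^ j := by
  refine (isLeftBasis_X_pow k).of_trans ?_
  have h := isLeftBasis_monomial k
  have e : (Polynomial.aeval (R := k) (X 0 : MvPolynomial (Fin 2) k)).comp
      (Algebra.ofId k (Polynomial k)) = Algebra.ofId k _ := Subsingleton.elim _ _
  rw [e]
  simpa using h

end Monomials

/-! ### The tower `k ⊂ k[x] ⊂ S ⊂ S[D] ⊂ A` and the resolution of a right module -/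

section Tower

variable {k A : Type*} [Field k] [Ring A] [Algebra k A] {n : ℕ} {F : MvPolynomial (Fin 2) k}
  {hF : F.IsHomogeneous n} (e : Ore.Ext (derExt hF) ≃ₐ[k] A)

/-- The inclusion of `S[D]`. -/
noncomputable def incl₃ : Ore.Ext (AlgDerivation.ofDerivation (derD F)) →ₐ[k] A :=
  (e : Ore.Ext (derExt hF) →ₐ[k] A).comp (Ore.C _)

/-- The inclusion of `S`. -/
noncomputable def incl₂ : MvPolynomial (Fin 2) k →ₐ[k] A := (incl₃ e).comp (Ore.C _)

/-- The inclusion of `k[x]`. -/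
noncomputable def incl₁ : Polynomial k →ₐ[k] A := (incl₂ e).comp (Polynomial.aeval (X 0))

theorem incl₁_apply (p : Polynomial k) : incl₁ e p = incl₂ e (Polynomial.aeval (X 0) p) := rfl

theorem t_mul_incl₃ (p) :
    e (Ore.t _) * incl₃ e p = incl₃ e p * e (Ore.t _) + incl₃ e ((derExt hF).toLinearMap p) := by
  have h := congrArg e (Ore.t_mul_C (derExt hF) p)
  rw [map_mul, map_add, map_mul] at h
  exact h

theorem t_mul_incl₂ (s) : incl₃ e (Ore.t _) * incl₂ e s
    = incl₂ e s * incl₃ e (Ore.t _) + incl₂ e (F * pderiv 1 s) := by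
  have h := congrArg (incl₃ e) (Ore.t_mul_C (AlgDerivation.ofDerivation (derD F)) s)
  rw [map_mul, map_add, map_mul] at h
  exact h

/-- The generators of an algebra isomorphic to `S[D][E]`. -/
noncomputable def OreTriple.ofEquiv : OreTriple F n A where
  s := incl₂ e
  D := incl₃ e (Ore.t _)
  E := e (Ore.t _)
  D_s := t_mul_incl₂ e
  E_s s := by
    have h := t_mul_incl₃ e (Ore.C _ s)
    rw [derExt_C] at h
    exact h
  E_D := by
    have h := t_mul_incl₃ e (Ore.t _)
    rwa [derExt_t, map_smul] at h

theorem isLeftBasis₃ : IsLeftBasis (incl₃ e) fun q : ℕ => e (Ore.t _ ^ q) :=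
  (Ore.isLeftBasis_pow _).map_equiv e

theorem isLeftBasis₂ : IsLeftBasis (incl₂ e) fun j : ℕ × ℕ =>
    incl₃ e (Ore.t _ ^ j.2) * e (Ore.t _ ^ j.1) :=
  (isLeftBasis₃ e).trans (Ore.isLeftBasis_pow _)

theorem isLeftBasis₁ : IsLeftBasis (incl₁ e) fun j : (ℕ × ℕ) × ℕ =>
    incl₂ e (X 1 ^ j.2) * (incl₃ e (Ore.t _ ^ j.1.2) * e (Ore.t _ ^ j.1.1)) :=
  (isLeftBasis₂ e).trans (isLeftBasis_X_one_pow k)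

theorem isLeftBasis₀ : IsLeftBasis (Algebra.ofId k A) fun j : ((ℕ × ℕ) × ℕ) × ℕ =>
    incl₁ e (Polynomial.X ^ j.2) * (incl₂ e (X 1 ^ j.1.2) *
      (incl₃ e (Ore.t _ ^ j.1.1.2) * e (Ore.t _ ^ j.1.1.1))) := by
  have h := (isLeftBasis₁ e).trans (isLeftBasis_X_pow k)
  rwa [Subsingleton.elim ((incl₁ e).comp _) (Algebra.ofId k A)] at h

/-- The Poincaré–Birkhoff–Witt basis. -/
theorem exists_basis : ∃ b : Module.Basis (ℕ × ℕ × ℕ × ℕ) k A, ∀ i j p q : ℕ,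
    b (i, j, p, q) = incl₂ e (X 0) ^ i * incl₂ e (X 1) ^ j * incl₃ e (Ore.t _) ^ p
      * e (Ore.t _) ^ q := by
  -- The nested index lists the exponents of `E, D, y, x`, in the reverse of the desired order.
  let σ : ((ℕ × ℕ) × ℕ) × ℕ ≃ ℕ × ℕ × ℕ × ℕ :=
    { toFun := fun j => (j.2, j.1.2, j.1.1.2, j.1.1.1)
      invFun := fun j => (((j.2.2.2, j.2.2.1), j.2.1), j.1)
      left_inv := fun _ => rfl
      right_inv := fun _ => rfl }
  refine ⟨(Module.Basis.ofRepr (isLeftBasis₀ e).equiv.symm).reindex σ, fun i j p q => ?_⟩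
  have h : (isLeftBasis₀ e).equiv (Finsupp.single (((q, p), j), i) 1) = _ :=
    leftCombination_single _ _ _ _
  rw [Module.Basis.reindex_apply, Module.Basis.coe_ofRepr, LinearEquiv.symm_symm]
  change (isLeftBasis₀ e).equiv (Finsupp.single (((q, p), j), i) 1) = _
  rw [h]
  simp [incl₁_apply, mul_assoc]

variable {M : Type*} [AddCommGroup M] [Module k M] [Module Aᵐᵒᵖ M] [IsScalarTower k Aᵐᵒᵖ M]

/-- The twisted Koszul complex on `Aᵐᵒᵖ ⊗ M`, for a right `A`-module `M`. -/
noncomputable def moduleKoszul (M : Type*) [AddCommGroup M] [Module k M] [Module Aᵐᵒᵖ M]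
    [IsScalarTower k Aᵐᵒᵖ M] : TwistedKoszul k Aᵐᵒᵖ (Aᵐᵒᵖ ⊗[k] M) ((n : k) - 1) :=
  (OreTriple.ofEquiv e).koszul hF (envAction k A M)

/-- The image of the endomorphism given by `v ⊗ 1 - 1 ⊗ v`. -/
noncomputable def xiRange (k M : Type*) {A : Type*} [Field k] [Ring A] [Algebra k A]
    [AddCommGroup M] [Module k M] [Module Aᵐᵒᵖ M] [IsScalarTower k Aᵐᵒᵖ M] (v : A) :
    Submodule k (Aᵐᵒᵖ ⊗[k] M) :=
  LinearMap.range ((xiOp k M v).restrictScalars k)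

theorem xiOp_mem_xiRange (v : A) (z : Aᵐᵒᵖ ⊗[k] M) : xiOp k M v z ∈ xiRange k M v := ⟨z, rfl⟩

theorem incl₁_mem {K : Submodule k (Aᵐᵒᵖ ⊗[k] M)} (hx : incl₂ e (X 0) ∈ xiSubalgebra K) (c) :
    incl₁ e c ∈ xiSubalgebra K := by
  have h : (⊤ : Subalgebra k (Polynomial k)) ≤ (xiSubalgebra K).comap (incl₁ e) := by
    rw [← Polynomial.adjoin_X]
    refine Algebra.adjoin_le ?_
    rintro _ rfl
    simpa [incl₁_apply] using hx
  exact h Algebra.mem_top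

theorem incl₂_mem {K : Submodule k (Aᵐᵒᵖ ⊗[k] M)} (hx : incl₂ e (X 0) ∈ xiSubalgebra K)
    (hy : incl₂ e (X 1) ∈ xiSubalgebra K) (c) : incl₂ e c ∈ xiSubalgebra K := by
  have h : (⊤ : Subalgebra k (MvPolynomial (Fin 2) k)) ≤ (xiSubalgebra K).comap (incl₂ e) := by
    rw [← MvPolynomial.adjoin_range_X]
    refine Algebra.adjoin_le ?_
    rintro _ ⟨i, rfl⟩
    exact (Fin.forall_fin_two (p := fun i => incl₂ e (X i) ∈ xiSubalgebra K)).2 ⟨hx, hy⟩ i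
  exact h Algebra.mem_top

theorem incl₃_mem {K : Submodule k (Aᵐᵒᵖ ⊗[k] M)} (hx : incl₂ e (X 0) ∈ xiSubalgebra K)
    (hy : incl₂ e (X 1) ∈ xiSubalgebra K) (hD : incl₃ e (Ore.t _) ∈ xiSubalgebra K) (c) :
    incl₃ e c ∈ xiSubalgebra K := by
  induction c using Ore.induction_on with
  | hC r => exact incl₂_mem e hx hy r
  | ht => exact hD
  | hadd p q hp hq => rw [map_add]; exact add_mem hp hq
  | hmul p q hp hq => rw [map_mul]; exact mul_mem hp hq

theorem mem_xiSubalgebra {K : Submodule k (Aᵐᵒᵖ ⊗[k] M)} (hx : incl₂ e (X 0) ∈ xiSubalgebra K)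
    (hy : incl₂ e (X 1) ∈ xiSubalgebra K) (hD : incl₃ e (Ore.t _) ∈ xiSubalgebra K)
    (hE : e (Ore.t _) ∈ xiSubalgebra K) (a : A) : a ∈ xiSubalgebra K := by
  obtain ⟨c, rfl⟩ := e.surjective a
  induction c using Ore.induction_on with
  | hC r => exact incl₃_mem e hx hy hD r
  | ht => exact hE
  | hadd p q hp hq => rw [map_add]; exact add_mem hp hq
  | hmul p q hp hq => rw [map_mul]; exact mul_mem hp hq

/-- The four conditions are `mem_of_xiOp_mem` at the four stages of the tower. The subspace `K` is
the sum of the images of the earlier variables, and `w` is the next variable. In each basis used,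
`w` is the leftmost factor, so multiplying by it only raises its exponent. -/
theorem moduleKoszul_isRegular : (moduleKoszul e M).IsRegular where
  X a ha := by
    have h := mem_of_xiOp_mem (M := M) (isLeftBasis₀ e) (K := ⊥)
      (fun c => Subalgebra.algebraMap_mem _ c)
      (fun z hz => by rw [(Submodule.mem_bot k).1 hz, map_zero])
      (w := incl₂ e (X 0)) (δ := fun _ => 0) (s := fun j => (j.1, j.2 + 1))
      (fun i j hij => by simpa [Prod.ext_iff] using hij) (fun j => j.2) (fun _ => rfl)
      (fun c => by
        rw [Algebra.ofId_apply, map_zero, add_zero, Algebra.commutes c])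
      (fun i => by
        rw [← mul_assoc, pow_succ', map_mul]
        simp [incl₁_apply])
      (z := a) ((Submodule.mem_bot k).2 ha)
    exact (Submodule.mem_bot k).1 h
  Y a b hab := by
    have h := mem_of_xiOp_mem (M := M) (isLeftBasis₁ e) (K := xiRange k M (incl₂ e (X 0)))
      (incl₁_mem e (xiOp_mem_xiRange _))
      (by
        rintro _ ⟨z, rfl⟩
        have h := leftProj_xiOp_base (isLeftBasis₁ e) Polynomial.X z
        rwa [incl₁_apply, Polynomial.aeval_X] at h)
      (w := incl₂ e (X 1)) (δ := fun _ => 0) (s := fun j => (j.1, j.2 + 1))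
      (fun i j hij => by simpa [Prod.ext_iff] using hij) (fun j => j.2) (fun _ => rfl)
      (fun c => by
        rw [map_zero, add_zero, incl₁_apply, ← map_mul, ← map_mul, mul_comm])
      (fun i => by rw [← mul_assoc, pow_succ', map_mul])
      (z := a) ⟨b, hab.symm⟩
    obtain ⟨p, hp⟩ := h
    exact ⟨p, hp.symm⟩
  D a b c habc := by
    have h := mem_of_xiOp_mem (M := M) (isLeftBasis₂ e)
      (K := xiRange k M (incl₂ e (X 0)) ⊔ xiRange k M (incl₂ e (X 1)))
      (incl₂_mem e (fun z => Submodule.mem_sup_left (xiOp_mem_xiRange _ z))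
        (fun z => Submodule.mem_sup_right (xiOp_mem_xiRange _ z)))
      (by
        intro z hz
        obtain ⟨_, ⟨u, rfl⟩, _, ⟨v, rfl⟩, rfl⟩ := Submodule.mem_sup.1 hz
        rw [map_add]
        exact (congrArg₂ (· + ·) (leftProj_xiOp_base (isLeftBasis₂ e) (X 0) u)
          (leftProj_xiOp_base (isLeftBasis₂ e) (X 1) v)).trans (add_zero _))
      (w := incl₃ e (Ore.t _)) (δ := fun s => F * pderiv 1 s) (s := fun j => (j.1, j.2 + 1))
      (fun i j hij => by simpa [Prod.ext_iff] using hij) (fun j => j.2) (fun _ => rfl)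
      (t_mul_incl₂ e)
      (fun i => by rw [← mul_assoc, pow_succ', map_mul])
      (z := a) (Submodule.mem_sup.2 ⟨_, ⟨b, rfl⟩, _, ⟨c, rfl⟩, habc.symm⟩)
    obtain ⟨_, ⟨u, rfl⟩, _, ⟨v, rfl⟩, huv⟩ := Submodule.mem_sup.1 h
    exact ⟨u, v, huv.symm⟩
  E a b c d habcd := by
    have h := mem_of_xiOp_mem (M := M) (isLeftBasis₃ e)
      (K := xiRange k M (incl₂ e (X 0)) ⊔ xiRange k M (incl₂ e (X 1))
        ⊔ xiRange k M (incl₃ e (Ore.t _)))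
      (incl₃_mem e
        (fun z => Submodule.mem_sup_left (Submodule.mem_sup_left (xiOp_mem_xiRange _ z)))
        (fun z => Submodule.mem_sup_left (Submodule.mem_sup_right (xiOp_mem_xiRange _ z)))
        (fun z => Submodule.mem_sup_right (xiOp_mem_xiRange _ z)))
      (by
        intro z hz
        obtain ⟨_, h, _, ⟨w, rfl⟩, rfl⟩ := Submodule.mem_sup.1 hz
        obtain ⟨_, ⟨u, rfl⟩, _, ⟨v, rfl⟩, rfl⟩ := Submodule.mem_sup.1 h
        rw [map_add, map_add]
        refine (congrArg₂ (· + ·) (congrArg₂ (· + ·)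
          (leftProj_xiOp_base (isLeftBasis₃ e) (Ore.C _ (X 0)) u)
          (leftProj_xiOp_base (isLeftBasis₃ e) (Ore.C _ (X 1)) v))
          (leftProj_xiOp_base (isLeftBasis₃ e) (Ore.t _) w)).trans ?_
        simp)
      (w := e (Ore.t _)) (δ := (derExt hF).toLinearMap) (s := fun j => j + 1)
      (fun i j hij => by simpa using hij) id (fun _ => rfl)
      (t_mul_incl₃ e)
      (fun i => by rw [pow_succ', map_mul])
      (z := a) (Submodule.mem_sup.2 ⟨_, Submodule.mem_sup.2 ⟨_, ⟨b, rfl⟩, _, ⟨c, rfl⟩, rfl⟩,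
        _, ⟨d, rfl⟩, habcd.symm⟩)
    obtain ⟨_, h, _, ⟨w, rfl⟩, hw⟩ := Submodule.mem_sup.1 h
    obtain ⟨_, ⟨u, rfl⟩, _, ⟨v, rfl⟩, rfl⟩ := Submodule.mem_sup.1 h
    exact ⟨u, v, w, hw.symm⟩

/-- The augmentation `Aᵐᵒᵖ ⊗ M → M`. -/
noncomputable def augmentation (k A M : Type*) [Field k] [Ring A] [Algebra k A] [AddCommGroup M]
    [Module k M] [Module Aᵐᵒᵖ M] [IsScalarTower k Aᵐᵒᵖ M] : Aᵐᵒᵖ ⊗[k] M →ₗ[Aᵐᵒᵖ] M :=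
  TensorProduct.AlgebraTensorModule.lift
    { toFun := fun b => Algebra.lsmul k k M b
      map_add' := fun a b => by ext; simp
      map_smul' := fun a b => by ext; simp }

theorem augmentation_tmul (b : Aᵐᵒᵖ) (m : M) :
    augmentation k A M (b ⊗ₜ m) = b • m := rfl

theorem augmentation_surjective : Function.Surjective (augmentation k A M) :=
  fun m => ⟨1 ⊗ₜ m, by rw [augmentation_tmul, one_smul]⟩

theorem augmentation_xiOp (v : A) (z : Aᵐᵒᵖ ⊗[k] M) : augmentation k A M (xiOp k M v z) = 0 := by
  induction z using TensorProduct.induction_on with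
  | zero => simp
  | add a b ha hb => rw [map_add, map_add, ha, hb, add_zero]
  | tmul b m =>
    induction b using MulOpposite.rec' with | _ b =>
    rw [xiOp_tmul, map_sub, augmentation_tmul, augmentation_tmul, MulOpposite.op_mul, mul_smul,
      sub_self]

/-- The elements `a` such that `ξ(a)` maps into the image of `d₁` form a subalgebra containing the
generators, hence all of `A`. Modulo that image, `b ⊗ m` is therefore `1 ⊗ mb`, which depends only
on the augmentation. -/
theorem moduleKoszul_exact₀ :
    Function.Exact (moduleKoszul e M).d₁ (augmentation k A M) := by
  intro z
  constructor
  · intro hz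
    let K : Submodule k (Aᵐᵒᵖ ⊗[k] M) :=
      LinearMap.range ((moduleKoszul e M).d₁.restrictScalars k)
    have hK : ∀ a, a ∈ xiSubalgebra K := by
      refine mem_xiSubalgebra e (fun z => ⟨![z, 0, 0, 0], ?_⟩) (fun z => ⟨![0, z, 0, 0], ?_⟩)
        (fun z => ⟨![0, 0, z, 0], ?_⟩) (fun z => ⟨![0, 0, 0, z], ?_⟩) <;>
      · simp [TwistedKoszul.d₁]
        rfl
    have h1 : K.mkQ = (K.mkQ ∘ₗ TensorProduct.mk k Aᵐᵒᵖ M 1) ∘ₗ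
        (augmentation k A M).restrictScalars k := by
      refine TensorProduct.ext' fun b m => ?_
      rw [← sub_eq_zero, LinearMap.comp_apply, LinearMap.comp_apply, ← map_sub,
        Submodule.mkQ_apply, Submodule.Quotient.mk_eq_zero]
      -- The value of `ξ(b)` at `1 ⊗ m` is `1 ⊗ mb - b ⊗ m`.
      have h2 := hK b.unop (1 ⊗ₜ m)
      rw [← MulOpposite.op_one, xiOp_tmul, ← Submodule.neg_mem_iff, neg_sub, mul_one] at h2
      exact h2
    have h3 := LinearMap.congr_fun h1 z
    rw [LinearMap.comp_apply, LinearMap.restrictScalars_apply, hz, map_zero, Submodule.mkQ_apply,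
      Submodule.Quotient.mk_eq_zero] at h3
    exact h3
  · rintro ⟨c, rfl⟩
    change augmentation k A M (xiOp k M _ (c 0) + xiOp k M _ (c 1) + xiOp k M _ (c 2)
      + xiOp k M _ (c 3)) = 0
    simp only [map_add, augmentation_xiOp, add_zero]

end Tower

/-! ### Bases of exterior powers -/

section Exterior

variable {k V : Type*} [Field k] [AddCommGroup V] [Module k V]

/-- Monomials whose index matrices have determinant one or zero form a basis of the exterior power,
if their number is right. -/
noncomputable def exteriorBasis {ι : Type*} [Fintype ι] [DecidableEq ι] [Nonempty ι] {m : ℕ}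
    (b : Module.Basis (Fin m) k V) {p : ℕ} (c : ι → Fin p → Fin m)
    (hc : ∀ s t, (Matrix.of fun i j => if c t i = c s j then (1 : k) else 0).det
      = if s = t then 1 else 0)
    (hcard : Fintype.card ι = m.choose p) : Module.Basis ι k (⋀[k]^p V) :=
  basisOfLinearIndependentOfCardEqFinrank
    (b := fun s => exteriorPower.ιMulti k p fun i => b (c s i))
    -- The pairing with monomials in the dual basis is given by determinants, and `hc` says that
    -- these form the identity matrix. The count of dimensions then yields a basis.
    (LinearIndependent.of_pairwise_dual_eq_zero_one _
      (fun s => exteriorPower.pairingDual k V p (exteriorPower.ιMulti k p fun j => b.coord (c s j)))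
      (fun s t hst => by
        have h := hc s t
        rw [if_neg hst] at h
        beta_reduce
        rw [exteriorPower.pairingDual_ιMulti_ιMulti, ← h]
        simp [Finsupp.single_apply])
      (fun s => by
        have h := hc s s
        rw [if_pos rfl] at h
        rw [exteriorPower.pairingDual_ιMulti_ιMulti, ← h]
        simp [Finsupp.single_apply]))
    (by
      have := Module.Finite.of_basis b
      rw [hcard, exteriorPower.finrank_eq, Module.finrank_eq_card_basis b, Fintype.card_fin])

theorem exteriorBasis_apply {ι : Type*} [Fintype ι] [DecidableEq ι] [Nonempty ι] {m : ℕ}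
    (b : Module.Basis (Fin m) k V) {p : ℕ} (c : ι → Fin p → Fin m)
    (hc : ∀ s t, (Matrix.of fun i j => if c t i = c s j then (1 : k) else 0).det
      = if s = t then 1 else 0)
    (hcard : Fintype.card ι = m.choose p) (s : ι) :
    exteriorBasis b c hc hcard s = exteriorPower.ιMulti k p fun i => b (c s i) := by
  simp [exteriorBasis]

/-- The basis `xy, xD, xE, yD, yE, DE` of `Λ² V`. -/
noncomputable def exteriorBasis₂ (b : Module.Basis (Fin 4) k V) :
    Module.Basis (Fin 6) k (⋀[k]^2 V) :=
  exteriorBasis b ![![0, 1], ![0, 2], ![0, 3], ![1, 2], ![1, 3], ![2, 3]]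
    (by
      intro s t
      fin_cases s <;> fin_cases t <;> simp [Matrix.det_fin_two])
    (by decide)

/-- The basis `xyD, xyE, xDE, yDE` of `Λ³ V`. -/
noncomputable def exteriorBasis₃ (b : Module.Basis (Fin 4) k V) :
    Module.Basis (Fin 4) k (⋀[k]^3 V) :=
  exteriorBasis b ![![0, 1, 2], ![0, 1, 3], ![0, 2, 3], ![1, 2, 3]]
    (by
      intro s t
      fin_cases s <;> fin_cases t <;> simp [Matrix.det_fin_three])
    (by decide)

/-- The basis `xyDE` of `Λ⁴ V`. -/
noncomputable def exteriorBasis₄ (b : Module.Basis (Fin 4) k V) :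
    Module.Basis Unit k (⋀[k]^4 V) :=
  exteriorBasis b (fun _ => id)
    (by
      intro s t
      rw [if_pos rfl]
      have h : (Matrix.of fun i j : Fin 4 => if id i = id j then (1 : k) else 0) = 1 := by
        ext i j
        simp [Matrix.one_apply]
      rw [h, Matrix.det_one])
    (by decide)

end Exterior

/-! ### The bimodule resolution -/

section Bimodule

variable {k A : Type*} [Field k] [Ring A] [Algebra k A] {n : ℕ} {F : MvPolynomial (Fin 2) k}

/-- The right multiplications of the enveloping algebra. -/
noncomputable def envSelf (k A : Type*) [Field k] [Ring A] [Algebra k A] :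
    Env k A →ₐ[k] (Module.End (Env k A) (Env k A))ᵐᵒᵖ :=
  AlgHom.ofLinearMap
    { toFun := fun c => MulOpposite.op (LinearMap.toSpanSingleton (Env k A) (Env k A) c)
      map_add' := fun a b => by
        rw [← MulOpposite.op_add]
        congr 1
        ext; simp
      map_smul' := fun c a => by
        rw [RingHom.id_apply, ← MulOpposite.op_smul]
        congr 1
        ext; simp }
    (by
      apply MulOpposite.unop_injective
      ext; simp)
    (fun a b => by
      apply MulOpposite.unop_injective
      ext; simp)

/-- Regularity speaks only of images and kernels of `X, Y, D, E`, so a `k`-linear bijection that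
intertwines these four suffices. -/
theorem TwistedKoszul.IsRegular.of_equiv {T T' N N' : Type*} [Ring T] [AddCommGroup N] [Module k N]
    [Module T N] [Ring T'] [AddCommGroup N'] [Module k N'] [Module T' N'] {r : k}
    {K : TwistedKoszul k T N r} {K' : TwistedKoszul k T' N' r} (h : K'.IsRegular) (φ : N ≃ₗ[k] N')
    (hX : ∀ a, φ (K.X a) = K'.X (φ a)) (hY : ∀ a, φ (K.Y a) = K'.Y (φ a))
    (hD : ∀ a, φ (K.D a) = K'.D (φ a)) (hE : ∀ a, φ (K.E a) = K'.E (φ a)) : K.IsRegular where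
  X a ha := φ.injective <| by rw [h.X (φ a) (by rw [← hX, ha, map_zero]), map_zero]
  Y a b hab := by
    obtain ⟨p, hp⟩ := h.Y (φ a) (φ b) (by rw [← hX, ← hY, hab])
    exact ⟨φ.symm p, φ.injective (by simpa [hX] using hp)⟩
  D a b c habc := by
    obtain ⟨p, q, hp⟩ := h.D (φ a) (φ b) (φ c) (by rw [← hX, ← hY, ← hD, habc, map_add])
    exact ⟨φ.symm p, φ.symm q, φ.injective (by simpa [hX, hY] using hp)⟩
  E a b c d habcd := by
    obtain ⟨p, q, s, hp⟩ := h.E (φ a) (φ b) (φ c) (φ d)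
      (by rw [← hX, ← hY, ← hD, ← hE, habcd, map_add, map_add])
    exact ⟨φ.symm p, φ.symm q, φ.symm s, φ.injective (by simpa [hX, hY, hD] using hp)⟩

/-- Exchanging the factors of `A ⊗ Aᵒᵖ` identifies right multiplications in `Aᵉ` with the action for
the right module `M = A`. This carries regularity over to bimodules. -/
theorem comm_mul (c z : Env k A) : TensorProduct.comm k A Aᵐᵒᵖ (z * c)
    = (envAction k A A c).unop (TensorProduct.comm k A Aᵐᵒᵖ z) := by
  induction c using TensorProduct.induction_on with
  | zero => simp
  | add c d hc hd => rw [mul_add, map_add, hc, hd, map_add]; rfl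
  | tmul a b =>
    induction z using TensorProduct.induction_on with
    | zero => simp
    | add c d hc hd => rw [add_mul, map_add, hc, hd, map_add, map_add]
    | tmul a' b' =>
      rw [Algebra.TensorProduct.tmul_mul_tmul, TensorProduct.comm_tmul, TensorProduct.comm_tmul,
        envAction_tmul]
      simp

theorem bracket_eq {M : Type*} [AddCommGroup M] [Module (Env k A) M] (a : A) (m : M) :
    bracket k a m = xi k a • m := by
  rw [bracket, xi, sub_smul]

theorem wedge_smul_bar {V : Submodule k A} {p : ℕ} (c : Env k A) (v : V) (w : Fin p → V) :
    wedge (c ⊗ₜ v) w = c • barWedge (Matrix.vecCons v w) := by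
  simp [wedge, barWedge, wedgeLin, TensorProduct.smul_tmul']

theorem wedge_add {V : Submodule k A} {p : ℕ} (m m' : Env k A ⊗[k] V) (w : Fin p → V) :
    wedge (m + m') w = wedge m w + wedge m' w := by
  simp [wedge]

variable {hF : F.IsHomogeneous n} (e : Ore.Ext (derExt hF) ≃ₐ[k] A)

/-- The twisted Koszul complex of bimodules. -/
noncomputable def bimoduleKoszul : TwistedKoszul k (Env k A) (Env k A) ((n : k) - 1) :=
  (OreTriple.ofEquiv e).koszul hF (envSelf k A)

theorem bimoduleKoszul_isRegular : (bimoduleKoszul e).IsRegular :=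
  (moduleKoszul_isRegular e (M := A)).of_equiv (TensorProduct.comm k A Aᵐᵒᵖ)
    (fun _ => comm_mul _ _) (fun _ => comm_mul _ _) (fun _ => comm_mul _ _) (fun _ => comm_mul _ _)

variable {V : Submodule k A} (b : Module.Basis (Fin 4) k V)

/-- The coordinates on `A|V|A`. -/
noncomputable def coord₁ : Env k A ⊗[k] V ≃ₗ[Env k A] (Fin 4 → Env k A) :=
  (b.baseChange (Env k A)).equivFun

/-- The coordinates on `A|Λ²V|A`. -/
noncomputable def coord₂ : Env k A ⊗[k] ⋀[k]^2 V ≃ₗ[Env k A] (Fin 6 → Env k A) :=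
  ((exteriorBasis₂ b).baseChange (Env k A)).equivFun

/-- The coordinates on `A|Λ³V|A`. -/
noncomputable def coord₃ : Env k A ⊗[k] ⋀[k]^3 V ≃ₗ[Env k A] (Fin 4 → Env k A) :=
  ((exteriorBasis₃ b).baseChange (Env k A)).equivFun

/-- The coordinate on `A|Λ⁴V|A`. -/
noncomputable def coord₄ : Env k A ⊗[k] ⋀[k]^4 V ≃ₗ[Env k A] Env k A :=
  ((exteriorBasis₄ b).baseChange (Env k A)).equivFun ≪≫ₗ LinearEquiv.funUnique Unit _ _

theorem coord₁_bar (i : Fin 4) : coord₁ b (bar (b i)) = Pi.single i 1 := by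
  have h : bar (b i) = b.baseChange (Env k A) i := by
    rw [Module.Basis.baseChange_apply]; rfl
  rw [h]
  funext j
  rw [coord₁, Module.Basis.equivFun_self]
  simp [Pi.single_apply, eq_comm]

theorem coord₂_barWedge (s : Fin 6) (v : Fin 2 → V)
    (hv : v = fun i => b ((![![0, 1], ![0, 2], ![0, 3], ![1, 2], ![1, 3], ![2, 3]] :
      Fin 6 → Fin 2 → Fin 4) s i)) :
    coord₂ b (barWedge v) = Pi.single s 1 := by
  have h : barWedge v = (exteriorBasis₂ b).baseChange (Env k A) s := by
    rw [Module.Basis.baseChange_apply, exteriorBasis₂, exteriorBasis_apply, hv]; rfl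
  rw [h]
  funext j
  rw [coord₂, Module.Basis.equivFun_self]
  simp [Pi.single_apply, eq_comm]

theorem coord₃_barWedge (s : Fin 4) (v : Fin 3 → V)
    (hv : v = fun i => b ((![![0, 1, 2], ![0, 1, 3], ![0, 2, 3], ![1, 2, 3]] :
      Fin 4 → Fin 3 → Fin 4) s i)) :
    coord₃ b (barWedge v) = Pi.single s 1 := by
  have h : barWedge v = (exteriorBasis₃ b).baseChange (Env k A) s := by
    rw [Module.Basis.baseChange_apply, exteriorBasis₃, exteriorBasis_apply, hv]; rfl
  rw [h]
  funext j
  rw [coord₃, Module.Basis.equivFun_self]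
  simp [Pi.single_apply, eq_comm]

theorem coord₄_barWedge : coord₄ b (barWedge b) = 1 := by
  have h : barWedge b = (exteriorBasis₄ b).baseChange (Env k A) () := by
    rw [Module.Basis.baseChange_apply, exteriorBasis₄, exteriorBasis_apply]; rfl
  rw [h]
  change ((exteriorBasis₄ b).baseChange (Env k A)).equivFun _ () = 1
  rw [Module.Basis.equivFun_self]
  simp

theorem barWedge_swap {p : ℕ} (v w : V) (u : Fin p → V) :
    barWedge (Matrix.vecCons v (Matrix.vecCons w u))
      = -barWedge (Matrix.vecCons w (Matrix.vecCons v u)) := by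
  have h := AlternatingMap.map_swap (exteriorPower.ιMulti k (p + 2))
    (Matrix.vecCons w (Matrix.vecCons v u)) (i := 0) (j := 1) (by simp)
  have e : (Matrix.vecCons w (Matrix.vecCons v u)) ∘ Equiv.swap (0 : Fin (p + 2)) 1
      = Matrix.vecCons v (Matrix.vecCons w u) := by
    funext i
    refine Fin.cases ?_ (fun i => Fin.cases ?_ (fun i => ?_) i) i
    · simp
    · simp
    · rw [Function.comp_apply, Equiv.swap_apply_of_ne_of_ne]
      · simp
      · exact Fin.succ_ne_zero _
      · rw [← Fin.succ_zero_eq_one, Ne, Fin.succ_inj]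
        exact Fin.succ_ne_zero _
  rw [e] at h
  rw [barWedge, h, TensorProduct.tmul_neg]
  rfl

theorem barWedge_self {p : ℕ} (v : V) (u : Fin p → V) :
    barWedge (Matrix.vecCons v (Matrix.vecCons v u)) = 0 := by
  rw [barWedge, AlternatingMap.map_eq_zero_of_eq _ _ (i := 0) (j := 1) (by simp) (by simp),
    TensorProduct.tmul_zero]

theorem coord_simps :
    (coord₂ b (barWedge ![b 0, b 1]) = Pi.single 0 1 ∧
      coord₂ b (barWedge ![b 0, b 2]) = Pi.single 1 1 ∧
      coord₂ b (barWedge ![b 0, b 3]) = Pi.single 2 1 ∧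
      coord₂ b (barWedge ![b 1, b 2]) = Pi.single 3 1 ∧
      coord₂ b (barWedge ![b 1, b 3]) = Pi.single 4 1 ∧
      coord₂ b (barWedge ![b 2, b 3]) = Pi.single 5 1) ∧
    (coord₃ b (barWedge ![b 0, b 1, b 2]) = Pi.single 0 1 ∧
      coord₃ b (barWedge ![b 0, b 1, b 3]) = Pi.single 1 1 ∧
      coord₃ b (barWedge ![b 0, b 2, b 3]) = Pi.single 2 1 ∧
      coord₃ b (barWedge ![b 1, b 2, b 3]) = Pi.single 3 1) ∧
    coord₄ b (barWedge ![b 0, b 1, b 2, b 3]) = 1 := by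
  have hv2 : ∀ (i j : Fin 4), ![b i, b j] = (fun l => b (![i, j] l)) := by
    intro i j; funext l; fin_cases l <;> rfl
  have hv3 : ∀ (i j m : Fin 4), ![b i, b j, b m] = (fun l => b (![i, j, m] l)) := by
    intro i j m; funext l; fin_cases l <;> rfl
  have hv4 : ![b 0, b 1, b 2, b 3] = b := by
    funext l; fin_cases l <;> rfl
  refine ⟨⟨coord₂_barWedge b 0 _ (hv2 0 1), coord₂_barWedge b 1 _ (hv2 0 2),
    coord₂_barWedge b 2 _ (hv2 0 3), coord₂_barWedge b 3 _ (hv2 1 2),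
    coord₂_barWedge b 4 _ (hv2 1 3), coord₂_barWedge b 5 _ (hv2 2 3)⟩,
    ⟨coord₃_barWedge b 0 _ (hv3 0 1 2), coord₃_barWedge b 1 _ (hv3 0 1 3),
    coord₃_barWedge b 2 _ (hv3 0 2 3), coord₃_barWedge b 3 _ (hv3 1 2 3)⟩, ?_⟩
  rw [hv4]
  exact coord₄_barWedge b

theorem nabla_eq_smul (x y : V) : nabla x y F
    = gradX (x : A) (y : A) F • bar x + gradY (x : A) (y : A) F • bar y := by
  rw [nabla_eq, bar, bar, TensorProduct.smul_tmul', TensorProduct.smul_tmul', smul_eq_mul,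
    smul_eq_mul, mul_one, mul_one]

theorem wedge_nabla {p : ℕ} (x y : V) (w : Fin p → V) : wedge (nabla x y F) w
    = gradX (x : A) (y : A) F • barWedge (Matrix.vecCons x w)
      + gradY (x : A) (y : A) F • barWedge (Matrix.vecCons y w) := by
  rw [nabla_eq, wedge_add, wedge_smul_bar, wedge_smul_bar]

/-- The elements of a basis of a subspace are the generators of the algebra. -/
def IsGeneratingBasis : Prop :=
  (b 0 : A) = incl₂ e (X 0) ∧ (b 1 : A) = incl₂ e (X 1) ∧ (b 2 : A) = incl₃ e (Ore.t _) ∧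
    (b 3 : A) = e (Ore.t _)

variable {e b}

theorem IsGeneratingBasis.koszul_apply (h : IsGeneratingBasis e b) :
    (∀ z, (bimoduleKoszul e).X z = z * xi k (b 0 : A)) ∧
    (∀ z, (bimoduleKoszul e).Y z = z * xi k (b 1 : A)) ∧
    (∀ z, (bimoduleKoszul e).D z = z * xi k (b 2 : A)) ∧
    (∀ z, (bimoduleKoszul e).E z = z * xi k (b 3 : A)) ∧
    (∀ z, (bimoduleKoszul e).P z = z * gradX (b 0 : A) (b 1 : A) F) ∧
    (∀ z, (bimoduleKoszul e).Q z = z * gradY (b 0 : A) (b 1 : A) F) := by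
  obtain ⟨h0, h1, h2, h3⟩ := h
  rw [h0, h1, h2, h3]
  exact ⟨fun _ => rfl, fun _ => rfl, fun _ => rfl, fun _ => rfl, fun _ => rfl, fun _ => rfl⟩

theorem coord_smul (b : Module.Basis (Fin 4) k V) (c : k) :
    (∀ m, coord₁ b (c • m) = c • coord₁ b m) ∧ (∀ m, coord₂ b (c • m) = c • coord₂ b m) ∧
      ∀ m, coord₃ b (c • m) = c • coord₃ b m :=
  ⟨LinearMap.map_smul_of_tower (coord₁ b).toLinearMap c,
    LinearMap.map_smul_of_tower (coord₂ b).toLinearMap c,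
    LinearMap.map_smul_of_tower (coord₃ b).toLinearMap c⟩

/-- In the first and third expressions the `x`-part of `∇(F)` dies against `x`, while moving `y`
past `x` in the other part produces the sign. -/
theorem coord_wedge_nabla (b : Module.Basis (Fin 4) k V) :
    coord₂ b (wedge (nabla (b 0) (b 1) F) ![b 0])
      = -(Pi.single 0 (gradY (b 0 : A) (b 1 : A) F) : Fin 6 → Env k A) ∧
    coord₂ b (wedge (nabla (b 0) (b 1) F) ![b 3])
      = (Pi.single 2 (gradX (b 0 : A) (b 1 : A) F) : Fin 6 → Env k A)
        + (Pi.single 4 (gradY (b 0 : A) (b 1 : A) F) : Fin 6 → Env k A) ∧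
    coord₃ b (wedge (nabla (b 0) (b 1) F) ![b 0, b 3])
      = -(Pi.single 1 (gradY (b 0 : A) (b 1 : A) F) : Fin 4 → Env k A) := by
  obtain ⟨⟨h01, -, h03, -, h13, -⟩, ⟨-, h013, -, -⟩, -⟩ := coord_simps b
  have e2 : ∀ u : V, wedge (nabla (b 0) (b 1) F) ![u]
      = gradX (b 0 : A) (b 1 : A) F • (barWedge ![b 0, u] : Env k A ⊗[k] ⋀[k]^2 V)
        + gradY (b 0 : A) (b 1 : A) F • (barWedge ![b 1, u] : Env k A ⊗[k] ⋀[k]^2 V) :=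
    fun u => wedge_nabla _ _ _
  have e3 : wedge (nabla (b 0) (b 1) F) ![b 0, b 3]
      = gradX (b 0 : A) (b 1 : A) F • (barWedge ![b 0, b 0, b 3] : Env k A ⊗[k] ⋀[k]^3 V)
        + gradY (b 0 : A) (b 1 : A) F • (barWedge ![b 1, b 0, b 3] : Env k A ⊗[k] ⋀[k]^3 V) :=
    wedge_nabla _ _ _
  have s2 : (barWedge ![b 0, b 0] : Env k A ⊗[k] ⋀[k]^2 V) = 0 := barWedge_self _ _
  have s3 : (barWedge ![b 0, b 0, b 3] : Env k A ⊗[k] ⋀[k]^3 V) = 0 := barWedge_self _ _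
  have w2 : (barWedge ![b 1, b 0] : Env k A ⊗[k] ⋀[k]^2 V) = -barWedge ![b 0, b 1] :=
    barWedge_swap _ _ _
  have w3 : (barWedge ![b 1, b 0, b 3] : Env k A ⊗[k] ⋀[k]^3 V) = -barWedge ![b 0, b 1, b 3] :=
    barWedge_swap _ _ _
  have hs : ∀ {m : ℕ} (i : Fin m) (c : Env k A), c • (Pi.single i 1 : Fin m → Env k A)
      = Pi.single i c := fun i c => by
    funext j; simp [Pi.single_apply]
  have n2 : coord₂ b (barWedge ![b 1, b 0]) = -Pi.single 0 1 := by
    rw [← h01, w2]; exact map_neg (coord₂ b) _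
  have n3 : coord₃ b (barWedge ![b 1, b 0, b 3]) = -Pi.single 1 1 := by
    rw [← h013, w3]; exact map_neg (coord₃ b) _
  refine ⟨?_, ?_, ?_⟩
  · rw [e2, s2, smul_zero, zero_add, map_smul, n2, smul_neg, hs]
  · rw [e2, map_add, map_smul, map_smul, h03, h13, hs, hs]
  · rw [e3, s3, smul_zero, zero_add, map_smul, n3, smul_neg, hs]

end Bimodule

/-! ### The differentials of the bimodule complex -/

section Bimodule

variable {k A : Type*} [Field k] [Ring A] [Algebra k A] {n : ℕ} {F : MvPolynomial (Fin 2) k}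
  {hF : F.IsHomogeneous n} {e : Ore.Ext (derExt hF) ≃ₐ[k] A} {V : Submodule k A}
  {b : Module.Basis (Fin 4) k V}

set_option linter.unusedSimpArgs false in
set_option maxHeartbeats 2000000 in
/-- The resolution of `A`. -/
noncomputable def bimoduleComplex (h : IsGeneratingBasis e b) :
    BimoduleComplex V (b 0) (b 1) (b 2) (b 3) F ((n : k) - 1) where
  d₀ := LinearMap.toSpanSingleton (Env k A) A 1
  d₁ := (bimoduleKoszul e).d₁ ∘ₗ (coord₁ b).toLinearMap
  d₂ := (coord₁ b).symm.toLinearMap ∘ₗ (bimoduleKoszul e).d₂ ∘ₗ (coord₂ b).toLinearMap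
  d₃ := (coord₂ b).symm.toLinearMap ∘ₗ (bimoduleKoszul e).d₃ ∘ₗ (coord₃ b).toLinearMap
  d₄ := (coord₃ b).symm.toLinearMap ∘ₗ (bimoduleKoszul e).d₄ ∘ₗ (coord₄ b).toLinearMap
  d₀_one := by simp
  d₁_bar := by
    obtain ⟨KX, KY, KD, KE, KP, KQ⟩ := h.koszul_apply
    intro v
    -- Both sides are `k`-linear in `v`, so it is enough to compare them on the basis.
    let f : V →ₗ[k] Env k A := (((bimoduleKoszul e).d₁ ∘ₗ (coord₁ b).toLinearMap).restrictScalars k)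
      ∘ₗ TensorProduct.mk k (Env k A) V 1
    have hf : f = xiLin k A ∘ₗ V.subtype := by
      refine b.ext fun i => ?_
      change (bimoduleKoszul e).d₁ (coord₁ b (bar (b i))) = xi k (b i : A)
      rw [coord₁_bar]
      fin_cases i <;> simp [TwistedKoszul.d₁, KX, KY, KD, KE]
    rw [bracket_eq, smul_eq_mul, mul_one]
    exact LinearMap.congr_fun hf v
  d₂_xy := by
    obtain ⟨KX, KY, KD, KE, KP, KQ⟩ := h.koszul_apply
    obtain ⟨⟨h01, h02, h03, h12, h13, h23⟩, -⟩ := coord_simps b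
    obtain ⟨w₁, w₂, w₃⟩ := coord_wedge_nabla (F := F) b
    have c₁ := fun c => (coord_smul b c).1
    have c₂ := fun c => (coord_smul b c).2.1
    have c₃ := fun c => (coord_smul b c).2.2
    -- In coordinates the generators become unit vectors and both sides become vectors over `Aᵉ`,
    -- compared entry by entry. The other formulas are checked in the same way.
    rw [LinearMap.comp_apply, LinearEquiv.coe_coe, LinearEquiv.symm_apply_eq]
    simp only [LinearMap.comp_apply, LinearEquiv.coe_coe, map_add, map_sub, map_smul,
      c₁, c₂, c₃, w₁, w₂, w₃, bracket_eq, coord₁_bar, h01, h02, h03, h12, h13, h23,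
      nabla_eq_smul]
    funext i
    fin_cases i <;> simp [TwistedKoszul.d₂, KX, KY, KD, KE, KP, KQ]
  d₂_xE := by
    obtain ⟨KX, KY, KD, KE, KP, KQ⟩ := h.koszul_apply
    obtain ⟨⟨h01, h02, h03, h12, h13, h23⟩, -⟩ := coord_simps b
    obtain ⟨w₁, w₂, w₃⟩ := coord_wedge_nabla (F := F) b
    have c₁ := fun c => (coord_smul b c).1
    have c₂ := fun c => (coord_smul b c).2.1
    have c₃ := fun c => (coord_smul b c).2.2
    rw [LinearMap.comp_apply, LinearEquiv.coe_coe, LinearEquiv.symm_apply_eq]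
    simp only [LinearMap.comp_apply, LinearEquiv.coe_coe, map_add, map_sub, map_smul,
      c₁, c₂, c₃, w₁, w₂, w₃, bracket_eq, coord₁_bar, h01, h02, h03, h12, h13, h23,
      nabla_eq_smul]
    funext i
    fin_cases i <;> simp [TwistedKoszul.d₂, KX, KY, KD, KE, KP, KQ]; abel
  d₂_yE := by
    obtain ⟨KX, KY, KD, KE, KP, KQ⟩ := h.koszul_apply
    obtain ⟨⟨h01, h02, h03, h12, h13, h23⟩, -⟩ := coord_simps b
    obtain ⟨w₁, w₂, w₃⟩ := coord_wedge_nabla (F := F) b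
    have c₁ := fun c => (coord_smul b c).1
    have c₂ := fun c => (coord_smul b c).2.1
    have c₃ := fun c => (coord_smul b c).2.2
    rw [LinearMap.comp_apply, LinearEquiv.coe_coe, LinearEquiv.symm_apply_eq]
    simp only [LinearMap.comp_apply, LinearEquiv.coe_coe, map_add, map_sub, map_smul,
      c₁, c₂, c₃, w₁, w₂, w₃, bracket_eq, coord₁_bar, h01, h02, h03, h12, h13, h23,
      nabla_eq_smul]
    funext i
    fin_cases i <;> simp [TwistedKoszul.d₂, KX, KY, KD, KE, KP, KQ]; abel
  d₂_xD := by
    obtain ⟨KX, KY, KD, KE, KP, KQ⟩ := h.koszul_apply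
    obtain ⟨⟨h01, h02, h03, h12, h13, h23⟩, -⟩ := coord_simps b
    obtain ⟨w₁, w₂, w₃⟩ := coord_wedge_nabla (F := F) b
    have c₁ := fun c => (coord_smul b c).1
    have c₂ := fun c => (coord_smul b c).2.1
    have c₃ := fun c => (coord_smul b c).2.2
    rw [LinearMap.comp_apply, LinearEquiv.coe_coe, LinearEquiv.symm_apply_eq]
    simp only [LinearMap.comp_apply, LinearEquiv.coe_coe, map_add, map_sub, map_smul,
      c₁, c₂, c₃, w₁, w₂, w₃, bracket_eq, coord₁_bar, h01, h02, h03, h12, h13, h23,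
      nabla_eq_smul]
    funext i
    fin_cases i <;> simp [TwistedKoszul.d₂, KX, KY, KD, KE, KP, KQ]
  d₂_yD := by
    obtain ⟨KX, KY, KD, KE, KP, KQ⟩ := h.koszul_apply
    obtain ⟨⟨h01, h02, h03, h12, h13, h23⟩, -⟩ := coord_simps b
    obtain ⟨w₁, w₂, w₃⟩ := coord_wedge_nabla (F := F) b
    have c₁ := fun c => (coord_smul b c).1
    have c₂ := fun c => (coord_smul b c).2.1
    have c₃ := fun c => (coord_smul b c).2.2
    rw [LinearMap.comp_apply, LinearEquiv.coe_coe, LinearEquiv.symm_apply_eq]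
    simp only [LinearMap.comp_apply, LinearEquiv.coe_coe, map_add, map_sub, map_smul,
      c₁, c₂, c₃, w₁, w₂, w₃, bracket_eq, coord₁_bar, h01, h02, h03, h12, h13, h23,
      nabla_eq_smul]
    funext i
    fin_cases i <;> simp [TwistedKoszul.d₂, KX, KY, KD, KE, KP, KQ]
  d₂_DE := by
    obtain ⟨KX, KY, KD, KE, KP, KQ⟩ := h.koszul_apply
    obtain ⟨⟨h01, h02, h03, h12, h13, h23⟩, -⟩ := coord_simps b
    obtain ⟨w₁, w₂, w₃⟩ := coord_wedge_nabla (F := F) b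
    have c₁ := fun c => (coord_smul b c).1
    have c₂ := fun c => (coord_smul b c).2.1
    have c₃ := fun c => (coord_smul b c).2.2
    rw [LinearMap.comp_apply, LinearEquiv.coe_coe, LinearEquiv.symm_apply_eq]
    simp only [LinearMap.comp_apply, LinearEquiv.coe_coe, map_add, map_sub, map_smul,
      c₁, c₂, c₃, w₁, w₂, w₃, bracket_eq, coord₁_bar, h01, h02, h03, h12, h13, h23,
      nabla_eq_smul]
    funext i
    fin_cases i <;> simp [TwistedKoszul.d₂, KX, KY, KD, KE, KP, KQ]; abel
  d₃_xyD := by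
    obtain ⟨KX, KY, KD, KE, KP, KQ⟩ := h.koszul_apply
    obtain ⟨⟨h01, h02, h03, h12, h13, h23⟩, ⟨h012, h013, h023, h123⟩, -⟩ := coord_simps b
    obtain ⟨w₁, w₂, w₃⟩ := coord_wedge_nabla (F := F) b
    have c₁ := fun c => (coord_smul b c).1
    have c₂ := fun c => (coord_smul b c).2.1
    have c₃ := fun c => (coord_smul b c).2.2
    rw [LinearMap.comp_apply, LinearEquiv.coe_coe, LinearEquiv.symm_apply_eq]
    simp only [LinearMap.comp_apply, LinearEquiv.coe_coe, map_add, map_sub, map_smul, map_neg,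
      map_zero, smul_zero, smul_neg, c₁, c₂, c₃, w₁, w₂, w₃, bracket_eq, h01, h02, h03, h12,
      h13, h23, h012, h013, h023, h123]
    funext i
    fin_cases i <;> simp [TwistedKoszul.d₃, KX, KY, KD, KE, KP, KQ]; abel
  d₃_xyE := by
    obtain ⟨KX, KY, KD, KE, KP, KQ⟩ := h.koszul_apply
    obtain ⟨⟨h01, h02, h03, h12, h13, h23⟩, ⟨h012, h013, h023, h123⟩, -⟩ := coord_simps b
    obtain ⟨w₁, w₂, w₃⟩ := coord_wedge_nabla (F := F) b
    have c₁ := fun c => (coord_smul b c).1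
    have c₂ := fun c => (coord_smul b c).2.1
    have c₃ := fun c => (coord_smul b c).2.2
    rw [LinearMap.comp_apply, LinearEquiv.coe_coe, LinearEquiv.symm_apply_eq]
    simp only [LinearMap.comp_apply, LinearEquiv.coe_coe, map_add, map_sub, map_smul, map_neg,
      map_zero, smul_zero, smul_neg, c₁, c₂, c₃, w₁, w₂, w₃, bracket_eq, h01, h02, h03, h12,
      h13, h23, h012, h013, h023, h123]
    funext i
    fin_cases i <;> simp [TwistedKoszul.d₃, KX, KY, KD, KE, KP, KQ]
  d₃_xDE := by
    obtain ⟨KX, KY, KD, KE, KP, KQ⟩ := h.koszul_apply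
    obtain ⟨⟨h01, h02, h03, h12, h13, h23⟩, ⟨h012, h013, h023, h123⟩, -⟩ := coord_simps b
    obtain ⟨w₁, w₂, w₃⟩ := coord_wedge_nabla (F := F) b
    have c₁ := fun c => (coord_smul b c).1
    have c₂ := fun c => (coord_smul b c).2.1
    have c₃ := fun c => (coord_smul b c).2.2
    rw [LinearMap.comp_apply, LinearEquiv.coe_coe, LinearEquiv.symm_apply_eq]
    simp only [LinearMap.comp_apply, LinearEquiv.coe_coe, map_add, map_sub, map_smul, map_neg,
      map_zero, smul_zero, smul_neg, c₁, c₂, c₃, w₁, w₂, w₃, bracket_eq, h01, h02, h03, h12,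
      h13, h23, h012, h013, h023, h123]
    funext i
    fin_cases i <;> simp [TwistedKoszul.d₃, KX, KY, KD, KE, KP, KQ]
  d₃_yDE := by
    obtain ⟨KX, KY, KD, KE, KP, KQ⟩ := h.koszul_apply
    obtain ⟨⟨h01, h02, h03, h12, h13, h23⟩, ⟨h012, h013, h023, h123⟩, -⟩ := coord_simps b
    obtain ⟨w₁, w₂, w₃⟩ := coord_wedge_nabla (F := F) b
    have c₁ := fun c => (coord_smul b c).1
    have c₂ := fun c => (coord_smul b c).2.1
    have c₃ := fun c => (coord_smul b c).2.2
    rw [LinearMap.comp_apply, LinearEquiv.coe_coe, LinearEquiv.symm_apply_eq]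
    simp only [LinearMap.comp_apply, LinearEquiv.coe_coe, map_add, map_sub, map_smul, map_neg,
      map_zero, smul_zero, smul_neg, c₁, c₂, c₃, w₁, w₂, w₃, bracket_eq, h01, h02, h03, h12,
      h13, h23, h012, h013, h023, h123]
    funext i
    fin_cases i <;> simp [TwistedKoszul.d₃, KX, KY, KD, KE, KP, KQ]
  d₄_xyDE := by
    obtain ⟨KX, KY, KD, KE, KP, KQ⟩ := h.koszul_apply
    obtain ⟨-, ⟨h012, h013, h023, h123⟩, h0123⟩ := coord_simps b
    obtain ⟨w₁, w₂, w₃⟩ := coord_wedge_nabla (F := F) b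
    have c₁ := fun c => (coord_smul b c).1
    have c₂ := fun c => (coord_smul b c).2.1
    have c₃ := fun c => (coord_smul b c).2.2
    rw [LinearMap.comp_apply, LinearEquiv.coe_coe, LinearEquiv.symm_apply_eq]
    simp only [LinearMap.comp_apply, LinearEquiv.coe_coe, map_add, map_sub, map_smul, map_neg,
      map_zero, smul_zero, smul_neg, c₁, c₂, c₃, w₁, w₂, w₃, bracket_eq, h012, h013, h023,
      h123, h0123]
    funext i
    fin_cases i <;> simp [TwistedKoszul.d₄, KX, KY, KD, KE, KP, KQ] <;> abel

end Bimodule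

/-! ### Exactness of the bimodule complex -/

section Resolution

variable {k A : Type*} [Field k] [Ring A] [Algebra k A] {n : ℕ} {F : MvPolynomial (Fin 2) k}
  {hF : F.IsHomogeneous n} {e : Ore.Ext (derExt hF) ≃ₐ[k] A} {V : Submodule k A}
  {b : Module.Basis (Fin 4) k V}

theorem TwistedKoszul.IsRegular.exact {k T N : Type*} [CommRing k] [Ring T] [Algebra k T]
    [AddCommGroup N] [Module k N] [Module T N] [IsScalarTower k T N] {r : k}
    {K : TwistedKoszul k T N r} (h : K.IsRegular) :
    Function.Exact K.d₂ K.d₁ ∧ Function.Exact K.d₃ K.d₂ ∧ Function.Exact K.d₄ K.d₃ :=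
  ⟨fun _ => ⟨h.exact₁, by rintro ⟨c, rfl⟩; exact K.d₁_d₂ c⟩,
    fun _ => ⟨h.exact₂, by rintro ⟨c, rfl⟩; exact K.d₂_d₃ c⟩,
    fun _ => ⟨h.exact₃, by rintro ⟨c, rfl⟩; exact K.d₃_d₄ c⟩⟩

/-- For `M = A` both sides are the multiplication `a ⊗ b ↦ ab`. -/
theorem augmentation_comm (z : Env k A) :
    augmentation k A A (TensorProduct.comm k A Aᵐᵒᵖ z) = z • (1 : A) := by
  induction z using TensorProduct.induction_on with
  | zero =>
    rw [map_zero, map_zero]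
    exact (zero_smul (Env k A) (1 : A)).symm
  | add a b ha hb => rw [map_add, map_add, ha, hb, add_smul]
  | tmul a b =>
    rw [TensorProduct.comm_tmul, augmentation_tmul]
    change b • a = a • b • (1 : A)
    simp [MulOpposite.smul_eq_mul_unop]

theorem comm_bimoduleKoszul_d₁ (e : Ore.Ext (derExt hF) ≃ₐ[k] A) (c : Fin 4 → Env k A) :
    TensorProduct.comm k A Aᵐᵒᵖ ((bimoduleKoszul e).d₁ c)
      = (moduleKoszul e A).d₁ fun i => TensorProduct.comm k A Aᵐᵒᵖ (c i) := by
  change TensorProduct.comm k A Aᵐᵒᵖ (_ + _ + _ + _) = _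
  rw [map_add, map_add, map_add]
  exact congrArg₂ (· + ·) (congrArg₂ (· + ·) (congrArg₂ (· + ·) (comm_mul _ _) (comm_mul _ _))
    (comm_mul _ _)) (comm_mul _ _)

theorem bimoduleKoszul_exact₀ (e : Ore.Ext (derExt hF) ≃ₐ[k] A) :
    Function.Exact (bimoduleKoszul e).d₁ (LinearMap.toSpanSingleton (Env k A) A 1) := by
  intro z
  rw [LinearMap.toSpanSingleton_apply, ← augmentation_comm, moduleKoszul_exact₀ e _]
  constructor
  · rintro ⟨c, hc⟩
    refine ⟨fun i => (TensorProduct.comm k A Aᵐᵒᵖ).symm (c i),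
      (TensorProduct.comm k A Aᵐᵒᵖ).injective ?_⟩
    rw [comm_bimoduleKoszul_d₁, ← hc]
    simp
  · rintro ⟨c, rfl⟩
    exact ⟨_, (comm_bimoduleKoszul_d₁ e c).symm⟩

theorem bimoduleComplex_isFreeResolution (h : IsGeneratingBasis e b) :
    (bimoduleComplex h).IsFreeResolution where
  free₀ := inferInstance
  free₁ := inferInstance
  free₂ := .of_basis ((exteriorBasis₂ b).baseChange _)
  free₃ := .of_basis ((exteriorBasis₃ b).baseChange _)
  free₄ := .of_basis ((exteriorBasis₄ b).baseChange _)
  injective_d₄ := (coord₃ b).symm.injective.comp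
    ((bimoduleKoszul_isRegular e).injective_d₄.comp (coord₄ b).injective)
  exact₃ := by
    refine (Function.Exact.iff_of_ladder_linearEquiv (e₁ := coord₄ b) (e₂ := coord₃ b)
      (e₃ := coord₂ b) (g₁₂ := (bimoduleKoszul e).d₄) (g₂₃ := (bimoduleKoszul e).d₃)
      ?_ ?_).1 (bimoduleKoszul_isRegular e).exact.2.2 <;>
    · refine LinearMap.ext fun z => ?_
      simp [bimoduleComplex]
  exact₂ := by
    refine (Function.Exact.iff_of_ladder_linearEquiv (e₁ := coord₃ b) (e₂ := coord₂ b)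
      (e₃ := coord₁ b) (g₁₂ := (bimoduleKoszul e).d₃) (g₂₃ := (bimoduleKoszul e).d₂)
      ?_ ?_).1 (bimoduleKoszul_isRegular e).exact.2.1 <;>
    · refine LinearMap.ext fun z => ?_
      simp [bimoduleComplex]
  exact₁ := by
    refine (Function.Exact.iff_of_ladder_linearEquiv (e₁ := coord₂ b) (e₂ := coord₁ b)
      (e₃ := LinearEquiv.refl (Env k A) (Env k A))
      (g₁₂ := (bimoduleKoszul e).d₂) (g₂₃ := (bimoduleKoszul e).d₁)
      ?_ ?_).1 (bimoduleKoszul_isRegular e).exact.1 <;>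
    · refine LinearMap.ext fun z => ?_
      simp [bimoduleComplex]
  exact₀ := by
    refine (Function.Exact.iff_of_ladder_linearEquiv (e₁ := coord₁ b)
      (e₂ := LinearEquiv.refl (Env k A) (Env k A)) (e₃ := LinearEquiv.refl (Env k A) A)
      (g₁₂ := (bimoduleKoszul e).d₁) (g₂₃ := LinearMap.toSpanSingleton (Env k A) A 1)
      ?_ ?_).1 (bimoduleKoszul_exact₀ e) <;>
    · refine LinearMap.ext fun z => ?_
      simp [bimoduleComplex]
  surjective_d₀ a := ⟨a ⊗ₜ 1, by
    change a • (1 : Aᵐᵒᵖ) • (1 : A) = a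
    simp⟩

end Resolution

/-! ### The case of the algebra of tangent operators -/

section TangentResolution

variable {k : Type u} [Field k] [CharZero k] {n : ℕ} {F G : MvPolynomial (Fin 2) k}
  (hF : F.IsHomogeneous n) (hsq : Squarefree F) (hFG : F = X 0 * G + X 1 ^ n)

theorem oreEquiv_values :
    (∀ s, incl₂ (oreEquiv hF hsq hFG) s = TangentAlgebra.ofS _ s) ∧
    incl₃ (oreEquiv hF hsq hFG) (Ore.t _) = genD F ∧
    oreEquiv hF hsq hFG (Ore.t _) = genE hF := by
  refine ⟨fun s => ?_, ?_, ?_⟩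
  · change oreHom hF (Ore.C _ (Ore.C _ s)) = _
    rw [oreHom, Ore.lift_C, oreHom₁, Ore.lift_C]
  · change oreHom hF (Ore.C _ (Ore.t _)) = _
    rw [oreHom, Ore.lift_C, oreHom₁, Ore.lift_t]
  · change oreHom hF (Ore.t _) = _
    rw [oreHom, Ore.lift_t]

include hsq hFG in
theorem exists_basis_tangentAlgebra :
    ∃ b : Module.Basis (ℕ × ℕ × ℕ × ℕ) k (TangentAlgebra (X 0 * F)), ∀ i j p q : ℕ,
      b (i, j, p, q) = genX F ^ i * genY F ^ j * genD F ^ p * genE hF ^ q := by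
  obtain ⟨b, hb⟩ := exists_basis (oreEquiv hF hsq hFG)
  obtain ⟨h, hD, hE⟩ := oreEquiv_values hF hsq hFG
  refine ⟨b, fun i j p q => ?_⟩
  rw [hb, h, h, hD, hE]
  rfl

include hsq hFG in
-- The elements `x, y, D, E` are four distinct members of the PBW basis, so they are linearly
-- independent.
theorem exists_basis_genSpan : ∃ b : Module.Basis (Fin 4) k (genSpan hF),
    b 0 = genSpan.x hF ∧ b 1 = genSpan.y hF ∧ b 2 = genSpan.D hF ∧ b 3 = genSpan.E hF := by
  obtain ⟨b, hb⟩ := exists_basis_tangentAlgebra hF hsq hFG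
  let w : Fin 4 → ℕ × ℕ × ℕ × ℕ := ![(1, 0, 0, 0), (0, 1, 0, 0), (0, 0, 1, 0), (0, 0, 0, 1)]
  have hw : Function.Injective w := by decide
  have hv : b ∘ w = ![genX F, genY F, genD F, genE hF] := by
    funext i
    fin_cases i <;> simp [w, hb]
  have hli : LinearIndependent k ![genX F, genY F, genD F, genE hF] :=
    hv ▸ b.linearIndependent.comp w hw
  have hs : Submodule.span k (Set.range ![genX F, genY F, genD F, genE hF]) = genSpan hF := by
    rw [genSpan]
    congr 1
    ext a
    simp
    tauto
  refine ⟨(Module.Basis.span hli).map (LinearEquiv.ofEq _ _ hs), ?_, ?_, ?_, ?_⟩ <;>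
  · apply Subtype.ext
    rw [Module.Basis.map_apply, LinearEquiv.coe_ofEq_apply, Module.Basis.span_apply]
    rfl

include hsq hFG in
theorem exists_isFreeResolution :
    ∃ P : BimoduleComplex (genSpan hF) (genSpan.x hF) (genSpan.y hF) (genSpan.D hF)
      (genSpan.E hF) F ((n : k) - 1), P.IsFreeResolution := by
  obtain ⟨b, h0, h1, h2, h3⟩ := exists_basis_genSpan hF hsq hFG
  obtain ⟨h, hD, hE⟩ := oreEquiv_values hF hsq hFG
  have hb : IsGeneratingBasis (oreEquiv hF hsq hFG) b := by
    refine ⟨?_, ?_, ?_, ?_⟩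
    · rw [h0, h]; rfl
    · rw [h1, h]; rfl
    · rw [h2, hD]; rfl
    · rw [h3, hE]; rfl
  have hP := bimoduleComplex_isFreeResolution hb
  generalize bimoduleComplex hb = P at hP
  rw [← h0, ← h1, ← h2, ← h3]
  exact ⟨P, hP⟩

end TangentResolution

/-! ### Projective dimension and resolutions of length four -/

section ProjectiveDimension

variable {B : Type u} [Ring B] {C₄ C₃ C₂ C₁ C₀ M : Type u} [AddCommGroup C₄] [AddCommGroup C₃]
  [AddCommGroup C₂] [AddCommGroup C₁] [AddCommGroup C₀] [AddCommGroup M] [Module B C₄]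
  [Module B C₃] [Module B C₂] [Module B C₁] [Module B C₀] [Module B M]

/-- Dimension shift along `0 → ker g → C₀ → M → 0`. -/
theorem hasProjectiveDimensionLT_iff_ker [Module.Projective B C₀] (g : C₀ →ₗ[B] M)
    (hg : Function.Surjective g) (n : ℕ) :
    HasProjectiveDimensionLT (ModuleCat.of B M) (n + 2) ↔
      HasProjectiveDimensionLT (ModuleCat.of B (LinearMap.ker g)) (n + 1) := by
  have h : (LinearMap.shortComplexKer g).ShortExact := LinearMap.shortExact_shortComplexKer hg
  exact h.hasProjectiveDimensionLT_X₃_iff n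
    ((IsProjective.iff_projective C₀).1 inferInstance)

theorem Function.Exact.hasProjectiveDimensionLT_ker_iff [Module.Projective B C₁]
    {f : C₁ →ₗ[B] C₀} {g : C₀ →ₗ[B] M} (h : Function.Exact f g) (n : ℕ) :
    HasProjectiveDimensionLT (ModuleCat.of B (LinearMap.ker g)) (n + 2) ↔
      HasProjectiveDimensionLT (ModuleCat.of B (LinearMap.ker f)) (n + 1) := by
  have hf : ∀ c, f c ∈ LinearMap.ker g := fun c => (h _).2 ⟨c, rfl⟩
  have := hasProjectiveDimensionLT_iff_ker (f.codRestrict (LinearMap.ker g) hf)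
    (fun z => by
      obtain ⟨c, hc⟩ := (h z).1 z.2
      exact ⟨c, Subtype.ext hc⟩) n
  rwa [LinearMap.ker_codRestrict] at this

variable [Module.Projective B C₄] [Module.Projective B C₃] [Module.Projective B C₂]
  [Module.Projective B C₁] [Module.Projective B C₀] {d₄ : C₄ →ₗ[B] C₃} {d₃ : C₃ →ₗ[B] C₂}
  {d₂ : C₂ →ₗ[B] C₁} {d₁ : C₁ →ₗ[B] C₀} {d₀ : C₀ →ₗ[B] M}

/-- Four dimension shifts reduce the claim to the projectivity of `ker d₃`, which is isomorphic to
`C₄` through `d₄`. -/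
theorem hasProjectiveDimensionLE_four (h₄ : Function.Injective d₄) (h₃ : Function.Exact d₄ d₃)
    (h₂ : Function.Exact d₃ d₂) (h₁ : Function.Exact d₂ d₁) (h₀ : Function.Exact d₁ d₀)
    (hs : Function.Surjective d₀) : HasProjectiveDimensionLE (ModuleCat.of B M) 4 := by
  refine (hasProjectiveDimensionLT_iff_ker d₀ hs 3).2 <|
    (h₀.hasProjectiveDimensionLT_ker_iff 2).2 <| (h₁.hasProjectiveDimensionLT_ker_iff 1).2 <|
    (h₂.hasProjectiveDimensionLT_ker_iff 0).2 ?_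
  rw [zero_add, ← projective_iff_hasProjectiveDimensionLT_one, ← IsProjective.iff_projective,
    LinearMap.exact_iff.1 h₃]
  exact Module.Projective.of_equiv (LinearEquiv.ofInjective d₄ h₄)

omit [Module.Projective B C₄] [Module.Projective B C₃] in
-- Three dimension shifts make `ker d₂` projective, so `d₃` splits onto it and its kernel, the image
-- of `d₄`, is a direct summand of `C₃`.
theorem exists_retraction_of_hasProjectiveDimensionLT_four (h₄ : Function.Injective d₄)
    (h₃ : Function.Exact d₄ d₃) (h₂ : Function.Exact d₃ d₂) (h₁ : Function.Exact d₂ d₁)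
    (h₀ : Function.Exact d₁ d₀) (hs : Function.Surjective d₀)
    (hM : HasProjectiveDimensionLT (ModuleCat.of B M) 4) :
    ∃ ρ : C₃ →ₗ[B] C₄, ∀ c, ρ (d₄ c) = c := by
  have hp := (h₁.hasProjectiveDimensionLT_ker_iff 0).1 <|
    (h₀.hasProjectiveDimensionLT_ker_iff 1).1 <| (hasProjectiveDimensionLT_iff_ker d₀ hs 2).1 hM
  rw [zero_add, ← projective_iff_hasProjectiveDimensionLT_one, ← IsProjective.iff_projective] at hp
  have hd : ∀ c, d₃ c ∈ LinearMap.ker d₂ := fun c => (h₂ _).2 ⟨c, rfl⟩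
  obtain ⟨s, hs⟩ := Module.projective_lifting_property (d₃.codRestrict (LinearMap.ker d₂) hd)
    LinearMap.id (fun z => by
      obtain ⟨c, hc⟩ := (h₂ z).1 z.2
      exact ⟨c, Subtype.ext hc⟩)
  -- The projection of `C₃` onto `ker d₃` along the section `s`.
  let τ : C₃ →ₗ[B] C₃ := LinearMap.id - s ∘ₗ d₃.codRestrict (LinearMap.ker d₂) hd
  have hτ : ∀ c, τ c ∈ LinearMap.range d₄ := fun c => by
    refine (h₃ _).1 ?_
    have h := congrArg Subtype.val (LinearMap.congr_fun hs (d₃.codRestrict _ hd c))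
    simp only [LinearMap.comp_apply, LinearMap.codRestrict_apply, LinearMap.id_apply] at h
    simp only [τ, LinearMap.sub_apply, LinearMap.comp_apply, LinearMap.id_apply, map_sub, h,
      sub_self]
  refine ⟨(LinearEquiv.ofInjective d₄ h₄).symm.toLinearMap ∘ₗ τ.codRestrict _ hτ, fun c => ?_⟩
  rw [LinearMap.comp_apply, LinearEquiv.coe_coe, LinearEquiv.symm_apply_eq]
  apply Subtype.ext
  have h : d₃.codRestrict (LinearMap.ker d₂) hd (d₄ c) = 0 :=
    Subtype.ext ((h₃ _).2 ⟨c, rfl⟩)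
  simp [τ, h]

end ProjectiveDimension

/-! ### The global dimension -/

section Upper

variable {k A : Type u} [Field k] [Ring A] [Algebra k A] {n : ℕ} {F : MvPolynomial (Fin 2) k}
  {hF : F.IsHomogeneous n} (e : Ore.Ext (derExt hF) ≃ₐ[k] A)

include e in
-- Over the field `k` every `M` is free, so the modules `Aᵒᵖ ⊗ M` are free over `Aᵒᵖ` and the Koszul
-- complex is a projective resolution of length four.
theorem leftGlobalDimension_mulOpposite_le : leftGlobalDimension Aᵐᵒᵖ ≤ 4 := by
  refine iSup_le fun M => ?_
  let _ : Module k M := Module.compHom M (algebraMap k Aᵐᵒᵖ)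
  have : IsScalarTower k Aᵐᵒᵖ M := ⟨fun c a m => by
    rw [Algebra.smul_def, mul_smul]; rfl⟩
  have h := moduleKoszul_isRegular e (M := M)
  exact (projectiveDimension_le_iff M 4).2 <| hasProjectiveDimensionLE_four h.injective_d₄
    h.exact.2.2 h.exact.2.1 h.exact.1 (moduleKoszul_exact₀ e) augmentation_surjective

end Upper

/-! ### The lower bound by means of characters -/

section Lower

variable {k A : Type u} [Field k] [Ring A] [Algebra k A] {n : ℕ} {F : MvPolynomial (Fin 2) k}
  {hF : F.IsHomogeneous n} (e : Ore.Ext (derExt hF) ≃ₐ[k] A)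

theorem aeval_zero_eq_zero (hF : F.IsHomogeneous n) (hn : 1 ≤ n) :
    aeval (0 : Fin 2 → k) F = 0 := by
  rw [aeval_zero, constantCoeff_eq, hF.coeff_eq_zero (by simp; lia), map_zero]

/-- Sending `x` and `y` to `0` respects `[D, y] = F`, because `F` has no constant term when `n ≥ 1`.
The only other constraint is `[E, D] = (n - 1)D`, which forces `(n - 1)d = 0` and leaves `ε` free.
-/
theorem exists_character (hn : 1 ≤ n) (d ε : k) (hd : ((n : k) - 1) * d = 0) :
    ∃ χ : A →ₐ[k] k, χ (incl₂ e (X 0)) = 0 ∧ χ (incl₂ e (X 1)) = 0 ∧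
      χ (incl₃ e (Ore.t _)) = d ∧ χ (e (Ore.t _)) = ε := by
  let φ₁ : Ore.Ext (AlgDerivation.ofDerivation (derD F)) →ₐ[k] k :=
    Ore.lift _ (aeval (0 : Fin 2 → k)) d (fun s => by
      change d * _ = _ * d + aeval (0 : Fin 2 → k) (F * pderiv 1 s)
      rw [map_mul, aeval_zero_eq_zero hF hn, zero_mul, add_zero, mul_comm])
  let φ : Ore.Ext (derExt hF) →ₐ[k] k :=
    Ore.lift _ φ₁ ε (Ore.commutation_of_generators _ _ _
      (fun s => by
        have h : aeval (0 : Fin 2 → k) (derE k s) = 0 := by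
          simp [derE]
        rw [derExt_C, Ore.lift_C, Ore.lift_C, h, add_zero, mul_comm])
      (by rw [derExt_t, map_smul, Ore.lift_t, smul_eq_mul, hd, add_zero, mul_comm]))
  refine ⟨φ.comp e.symm, ?_, ?_, ?_, ?_⟩
  · simp [incl₂, incl₃, φ, φ₁, Ore.lift_C]
  · simp [incl₂, incl₃, φ, φ₁, Ore.lift_C]
  · simp [incl₃, φ, φ₁, Ore.lift_C, Ore.lift_t]
  · simp [φ, Ore.lift_t]

/-- By linearity `ρ(c)` is a combination of fixed elements with the entries of `c` as left
coefficients, so it vanishes under `φ` with them. -/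
theorem map_eq_zero_of_entries {T N K ι : Type*} [Ring T] [Ring K] [AddCommGroup N] [Module T N]
    [Fintype ι] [DecidableEq ι] (φ : T →+* K) (r : N ≃ₗ[T] T) (ρ : (ι → N) →ₗ[T] N) {c : ι → N}
    (hc : ∀ i, φ (r (c i)) = 0) : φ (r (ρ c)) = 0 := by
  have h : c = ∑ i, r (c i) • Pi.single i (r.symm 1) := by
    have h1 : ∀ i, r (c i) • (Pi.single i (r.symm 1) : ι → N) = Pi.single i (c i) := fun i => by
      rw [← Pi.single_smul, ← map_smul, smul_eq_mul, mul_one, LinearEquiv.symm_apply_apply]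
    simp only [h1, Finset.univ_sum_single]
  rw [h, map_sum, map_sum, map_sum]
  refine Finset.sum_eq_zero fun i _ => ?_
  rw [map_smul, map_smul, smul_eq_mul, map_mul, hc, zero_mul]

/-- The value of a pair of characters on the enveloping algebra. -/
noncomputable def characterPair (χ χ' : A →ₐ[k] k) : Env k A →ₐ[k] k :=
  Algebra.TensorProduct.lift χ (χ'.fromOpposite fun _ _ => Commute.all _ _)
    fun _ _ => Commute.all _ _

theorem characterPair_xi (χ χ' : A →ₐ[k] k) (v : A) :
    characterPair χ χ' (xi k v) = χ v - χ' v := by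
  simp [characterPair, xi]

/-- A term survives only if all its exponents are zero, which happens for the monomial `y` alone. -/
theorem characterPair_gradY (χ χ' : A →ₐ[k] k) {x y : A} (hx : χ x = 0) (hy : χ y = 0)
    (hy' : χ' y = 0) (f : MvPolynomial (Fin 2) k) :
    characterPair χ χ' (gradY x y f) = coeff (Finsupp.single 1 1) f := by
  have h1 : ∀ m : Fin 2 →₀ ℕ, m = Finsupp.single 1 1 ↔ m 0 = 0 ∧ m 1 = 1 := fun m => by
    rw [Finsupp.ext_iff, Fin.forall_fin_two]
    simp
  have h2 : ∀ m : Fin 2 →₀ ℕ, (∑ s ∈ Finset.range (m 1),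
      (0 : k) ^ m 0 * 0 ^ s * 0 ^ (m 1 - 1 - s)) = if m = Finsupp.single 1 1 then 1 else 0 := by
    intro m
    split_ifs with h
    · rw [h1] at h
      simp [h.1, h.2]
    · refine Finset.sum_eq_zero fun s hs => ?_
      rw [Finset.mem_range] at hs
      rw [h1] at h
      simp only [mul_eq_zero, pow_eq_zero_iff', ne_eq, true_and]
      lia
  simp only [gradY, map_sum, map_smul, characterPair, Algebra.TensorProduct.lift_tmul, map_mul,
    map_pow, hx, hy, AlgHom.fromOpposite_apply]
  simp [hy', h2, eq_comm (a := (0 : k))]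

theorem characterPair_eq [Module Aᵐᵒᵖ k] [IsScalarTower k Aᵐᵒᵖ k] (χ χ' : A →ₐ[k] k)
    (hχ : ∀ a, MulOpposite.op a • (1 : k) = χ a) (c : Env k A) :
    χ'.fromOpposite (fun _ _ => Commute.all _ _) (TensorProduct.AlgebraTensorModule.rid k Aᵐᵒᵖ Aᵐᵒᵖ
      ((envAction k A k c).unop (1 ⊗ₜ 1))) = characterPair χ χ' c := by
  induction c using TensorProduct.induction_on with
  | zero => simp
  | add a b ha hb =>
    rw [map_add, MulOpposite.unop_add, LinearMap.add_apply, map_add, map_add, ha, hb, map_add]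
  | tmul a b =>
    rw [envAction_tmul, hχ]
    simp [characterPair]

include e in
-- The hypotheses say that the pair of characters kills all entries of `d₄(1 ⊗ 1)`. If the
-- projective dimension were less than four, `d₄` would have a retraction, and applying it would
-- send `1 ⊗ 1` to `0` under `χ'`, whereas its value is `1`.
theorem not_hasProjectiveDimensionLT_four [Module Aᵐᵒᵖ k] [IsScalarTower k Aᵐᵒᵖ k]
    (χ χ' : A →ₐ[k] k) (hχ : ∀ a, MulOpposite.op a • (1 : k) = χ a)
    (hX : χ (incl₂ e (X 0)) = 0) (hY : χ (incl₂ e (X 1)) = 0)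
    (hX' : χ' (incl₂ e (X 0)) = 0) (hY' : χ' (incl₂ e (X 1)) = 0)
    (hD : χ (incl₃ e (Ore.t _)) - χ' (incl₃ e (Ore.t _)) = coeff (Finsupp.single 1 1) F)
    (hE : χ (e (Ore.t _)) - χ' (e (Ore.t _)) = (n : k) + 1) :
    ¬ HasProjectiveDimensionLT (ModuleCat.of Aᵐᵒᵖ k) 4 := by
  intro hk
  have h := moduleKoszul_isRegular e (M := k)
  obtain ⟨ρ, hρ⟩ := exists_retraction_of_hasProjectiveDimensionLT_four h.injective_d₄
    h.exact.2.2 h.exact.2.1 h.exact.1 (moduleKoszul_exact₀ e) augmentation_surjective hk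
  have hz := map_eq_zero_of_entries
    (χ'.fromOpposite (fun _ _ => Commute.all _ _) : Aᵐᵒᵖ →+* k)
    (TensorProduct.AlgebraTensorModule.rid k Aᵐᵒᵖ Aᵐᵒᵖ) ρ (c := (moduleKoszul e k).d₄ (1 ⊗ₜ 1)) ?_
  · rw [hρ] at hz
    simp at hz
  · have hKX : (moduleKoszul e k).X (1 ⊗ₜ 1)
        = (envAction k A k (xi k (incl₂ e (X 0)))).unop (1 ⊗ₜ 1) := rfl
    have hKY : (moduleKoszul e k).Y (1 ⊗ₜ 1)
        = (envAction k A k (xi k (incl₂ e (X 1)))).unop (1 ⊗ₜ 1) := rfl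
    have hKD : (moduleKoszul e k).D (1 ⊗ₜ 1)
        = (envAction k A k (xi k (incl₃ e (Ore.t _)))).unop (1 ⊗ₜ 1) := rfl
    have hKE : (moduleKoszul e k).E (1 ⊗ₜ 1)
        = (envAction k A k (xi k (e (Ore.t _)))).unop (1 ⊗ₜ 1) := rfl
    have hKQ : (moduleKoszul e k).Q (1 ⊗ₜ 1)
        = (envAction k A k (gradY (incl₂ e (X 0)) (incl₂ e (X 1)) F)).unop (1 ⊗ₜ 1) := rfl
    have key := characterPair_eq χ χ' hχ
    intro i
    rw [RingHom.coe_coe]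
    -- The entries are those of `((n + 1) - E, D - Q, -Y, X)`. The first accounts for the value `n +
    -- 1` required of `χ(E) - χ'(E)`, and the second for the coefficient of `y` in `F`.
    fin_cases i
    · change χ'.fromOpposite _ (TensorProduct.AlgebraTensorModule.rid k Aᵐᵒᵖ Aᵐᵒᵖ
        (((n : k) - 1 + 2) • (1 ⊗ₜ 1) - (moduleKoszul e k).E (1 ⊗ₜ 1))) = 0
      rw [map_sub, map_sub, hKE, key, characterPair_xi, hE,
        TensorProduct.smul_tmul', TensorProduct.AlgebraTensorModule.rid_tmul]
      simp
      ring
    · change χ'.fromOpposite _ (TensorProduct.AlgebraTensorModule.rid k Aᵐᵒᵖ Aᵐᵒᵖ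
        ((moduleKoszul e k).D (1 ⊗ₜ 1) - (moduleKoszul e k).Q (1 ⊗ₜ 1))) = 0
      rw [map_sub, map_sub, hKD, hKQ, key, key, characterPair_xi, hD,
        characterPair_gradY χ χ' hX hY hY', sub_self]
    · change χ'.fromOpposite _ (TensorProduct.AlgebraTensorModule.rid k Aᵐᵒᵖ Aᵐᵒᵖ
        (-(moduleKoszul e k).Y (1 ⊗ₜ 1))) = 0
      rw [map_neg, map_neg, hKY, key, characterPair_xi, hY, hY', sub_self, neg_zero]
    · change χ'.fromOpposite _ (TensorProduct.AlgebraTensorModule.rid k Aᵐᵒᵖ Aᵐᵒᵖ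
        ((moduleKoszul e k).X (1 ⊗ₜ 1))) = 0
      rw [hKX, key, characterPair_xi, hX, hX', sub_self]

include e in
theorem leftGlobalDimension_mulOpposite (hn : 1 ≤ n) : leftGlobalDimension Aᵐᵒᵖ = 4 := by
  refine le_antisymm (leftGlobalDimension_mulOpposite_le e) ?_
  -- For `n = 1` the first factor is zero. Otherwise `F` has no linear term by homogeneity. Hence a
  -- character whose value at `D` is this coefficient exists.
  have hq : ((n : k) - 1) * coeff (Finsupp.single 1 1) F = 0 := by
    by_cases h : n = 1
    · simp [h]
    · rw [hF.coeff_eq_zero (by simpa using Ne.symm h), mul_zero]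
  obtain ⟨χ, hX, hY, hD, hE⟩ := exists_character e hn _ ((n : k) + 1) hq
  obtain ⟨χ', hX', hY', hD', hE'⟩ := exists_character e hn 0 0 (mul_zero _)
  let _ : Module Aᵐᵒᵖ k :=
    Module.compHom k (χ.fromOpposite (fun _ _ => Commute.all _ _) : Aᵐᵒᵖ →+* k)
  have hs : ∀ (a : Aᵐᵒᵖ) (c : k), a • c = χ a.unop * c := fun _ _ => rfl
  have : IsScalarTower k Aᵐᵒᵖ k := ⟨fun c a m => by
    rw [hs, hs, MulOpposite.unop_smul, map_smul, smul_mul_assoc]⟩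
  have h := not_hasProjectiveDimensionLT_four e χ χ' (fun a => by rw [hs]; simp) hX hY hX' hY'
    (by rw [hD, hD', sub_zero]) (by rw [hE, hE', sub_zero])
  exact ((projectiveDimension_ge_iff _ 4).2 h).trans (le_iSup _ (ModuleCat.of Aᵐᵒᵖ k))

end Lower

/-! ### Left and right: the isomorphism with the opposite algebra -/

section Opposite

attribute [local instance] RingHomInvPair.of_ringEquiv in
theorem leftGlobalDimension_le_of_ringEquiv {R R' : Type u} [Ring R] [Ring R'] (e : R ≃+* R') :
    leftGlobalDimension R ≤ leftGlobalDimension R' := by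
  refine iSup_le fun M => ?_
  -- The same abelian group, with `R'` acting through the inverse isomorphism. The identity map is
  -- then semilinear.
  let _ : Module R' M := Module.compHom M (e.symm : R' →+* R)
  let e' : M ≃ₛₗ[RingHomClass.toRingHom e] ModuleCat.of R' M :=
    { AddEquiv.refl M with
      map_smul' := fun r m => by
        change r • m = e.symm (e r) • m
        rw [RingEquiv.symm_apply_apply] }
  rw [ModuleCat.projectiveDimension_eq_of_semiLinearEquiv e e']
  exact le_iSup (fun N : ModuleCat.{u} R' => projectiveDimension N) (ModuleCat.of R' M)

theorem leftGlobalDimension_eq_of_ringEquiv {R R' : Type u} [Ring R] [Ring R'] (e : R ≃+* R') :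
    leftGlobalDimension R = leftGlobalDimension R' :=
  (leftGlobalDimension_le_of_ringEquiv e).antisymm (leftGlobalDimension_le_of_ringEquiv e.symm)

variable {k A : Type*} [Field k] [Ring A] [Algebra k A] {n : ℕ} {F : MvPolynomial (Fin 2) k}
  {hF : F.IsHomogeneous n} (e : Ore.Ext (derExt hF) ≃ₐ[k] A)

/-- The homomorphism `A → Aᵐᵒᵖ` fixing the elements of `S` and changing the signs of `D`
and `E`. -/
theorem exists_opHom : ∃ τ : A →ₐ[k] Aᵐᵒᵖ, (∀ s, τ (incl₂ e s) = MulOpposite.op (incl₂ e s)) ∧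
    τ (incl₃ e (Ore.t _)) = -MulOpposite.op (incl₃ e (Ore.t _)) ∧
    τ (e (Ore.t _)) = -MulOpposite.op (e (Ore.t _)) := by
  let φ : MvPolynomial (Fin 2) k →ₐ[k] Aᵐᵒᵖ :=
    (incl₂ e).toOpposite fun x y => (Commute.all x y).map (incl₂ e)
  let φ₁ : Ore.Ext (AlgDerivation.ofDerivation (derD F)) →ₐ[k] Aᵐᵒᵖ :=
    Ore.lift _ φ (-MulOpposite.op (incl₃ e (Ore.t _))) (fun s => by
      apply MulOpposite.unop_injective
      change incl₂ e s * -incl₃ e (Ore.t _)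
        = -incl₃ e (Ore.t _) * incl₂ e s + incl₂ e (F * pderiv 1 s)
      rw [neg_mul, t_mul_incl₂]
      noncomm_ring)
  let φ₂ : Ore.Ext (derExt hF) →ₐ[k] Aᵐᵒᵖ :=
    Ore.lift _ φ₁ (-MulOpposite.op (e (Ore.t _))) (Ore.commutation_of_generators _ _ _
      (fun s => by
        apply MulOpposite.unop_injective
        rw [derExt_C, Ore.lift_C, Ore.lift_C]
        have h := t_mul_incl₃ e (Ore.C _ s)
        rw [derExt_C] at h
        change incl₂ e s * -e (Ore.t _) = -e (Ore.t _) * incl₂ e s + incl₂ e (derE k s)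
        change e (Ore.t _) * incl₂ e s = incl₂ e s * e (Ore.t _) + incl₂ e (derE k s) at h
        rw [neg_mul, h]
        noncomm_ring)
      (by
        apply MulOpposite.unop_injective
        rw [derExt_t, map_smul, Ore.lift_t]
        have h := t_mul_incl₃ e (Ore.t _)
        rw [derExt_t, map_smul] at h
        change -incl₃ e (Ore.t _) * -e (Ore.t _)
          = -e (Ore.t _) * -incl₃ e (Ore.t _) + ((n : k) - 1) • -incl₃ e (Ore.t _)
        rw [neg_mul_neg, neg_mul_neg, h, smul_neg, add_neg_cancel_right]))
  refine ⟨φ₂.comp e.symm, fun s => ?_, ?_, ?_⟩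
  · simp [incl₂, incl₃, φ₂, φ₁, φ, Ore.lift_C]
  · simp [incl₃, φ₂, φ₁, Ore.lift_C, Ore.lift_t]
  · simp [φ₂, Ore.lift_t]

include e in
-- Applying the sign-changing homomorphism twice fixes `S`, `D` and `E`, hence is the identity. So
-- it is bijective.
theorem exists_opEquiv : Nonempty (A ≃+* Aᵐᵒᵖ) := by
  obtain ⟨τ, hS, hD, hE⟩ := exists_opHom e
  let σ : A →ₐ[k] A := (AlgHom.opComm τ).comp τ
  have hσ : ∀ a, σ a = (τ (τ a).unop).unop := fun _ => rfl
  have h2 : σ.comp (incl₃ e) = incl₃ e := by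
    refine Ore.hom_ext (fun s => ?_) ?_
    · change σ (incl₂ e s) = incl₂ e s
      rw [hσ, hS, MulOpposite.unop_op, hS, MulOpposite.unop_op]
    · rw [AlgHom.comp_apply, hσ, hD, MulOpposite.unop_neg, MulOpposite.unop_op, map_neg, hD, neg_neg,
        MulOpposite.unop_op]
  have h3 : (σ.comp (e : Ore.Ext (derExt hF) →ₐ[k] A)) = e := by
    refine Ore.hom_ext (DFunLike.congr_fun h2) ?_
    change σ (e (Ore.t _)) = e (Ore.t _)
    rw [hσ, hE, MulOpposite.unop_neg, MulOpposite.unop_op, map_neg, hE, neg_neg,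
      MulOpposite.unop_op]
  have h : ∀ a, (τ (τ a).unop).unop = a := fun a => by
    have := DFunLike.congr_fun h3 (e.symm a)
    simpa [← hσ] using this
  exact ⟨RingEquiv.ofBijective τ ⟨fun a b hab => by rw [← h a, hab, h b],
    fun b => ⟨(τ b.unop).unop, MulOpposite.unop_injective (h b.unop)⟩⟩⟩

end Opposite

/-- Here `n` is `r + 1`, so `r ≥ -1` is automatic and `r ≥ 0` reads `1 ≤ n`. Noetherianity is proved
for left ideals and the global dimension for right modules. The isomorphism `ε` of `A` with its
opposite supplies the other side in both cases. -/
theorem mainTheorem7 {k : Type u} [Field k] [CharZero k] (n : ℕ)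
    (F G : MvPolynomial (Fin 2) k) (hF : F.IsHomogeneous n) (hsq : Squarefree F)
    (hFG : F = X 0 * G + X 1 ^ n) :
    -- the iterated Ore extension
    (∃ δ : AlgDerivation k (Ore.Ext (AlgDerivation.ofDerivation (derD F))),
      (∀ s : MvPolynomial (Fin 2) k, δ.toLinearMap (Ore.C _ s) = Ore.C _ (derE k s)) ∧
      δ.toLinearMap (Ore.t _) = ((n : k) - 1) • Ore.t _ ∧
      ∃ e : Ore.Ext δ ≃ₐ[k] TangentAlgebra (X 0 * F),
        (∀ s : MvPolynomial (Fin 2) k,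
          e (Ore.C δ (Ore.C _ s)) = TangentAlgebra.ofS (X 0 * F) s) ∧
        e (Ore.C δ (Ore.t _)) = genD F ∧
        e (Ore.t δ) = genE hF) ∧
    -- a noetherian domain
    IsNoetherianRing (TangentAlgebra (X 0 * F)) ∧
    IsNoetherianRing (TangentAlgebra (X 0 * F))ᵐᵒᵖ ∧
    IsDomain (TangentAlgebra (X 0 * F)) ∧
    -- the PBW basis
    (∃ b : Module.Basis (ℕ × ℕ × ℕ × ℕ) k (TangentAlgebra (X 0 * F)),
      ∀ i j p q : ℕ,
        b (i, j, p, q) = genX F ^ i * genY F ^ j * genD F ^ p * genE hF ^ q) ∧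
    -- the free bimodule resolution
    (∃ P : BimoduleComplex (genSpan hF) (genSpan.x hF) (genSpan.y hF) (genSpan.D hF)
        (genSpan.E hF) F ((n : k) - 1),
      P.IsFreeResolution) ∧
    -- the global dimension
    (1 ≤ n → leftGlobalDimension (TangentAlgebra (X 0 * F)) = 4 ∧
      rightGlobalDimension (TangentAlgebra (X 0 * F)) = 4) := by
  have e := oreEquiv hF hsq hFG
  obtain ⟨hS, hD, hE⟩ := oreEquiv_values hF hsq hFG
  have hN : IsNoetherianRing (TangentAlgebra (X 0 * F)) := by
    have h₁ := Ore.isNoetherianRing_ext (AlgDerivation.ofDerivation (derD F))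
    have h₂ := Ore.isNoetherianRing_ext (derExt hF)
    exact isNoetherianRing_of_ringEquiv _ e.toRingEquiv
  obtain ⟨ε⟩ := exists_opEquiv e
  have hdom : IsDomain (TangentAlgebra (X 0 * F)) := by
    have h₁ := Ore.isDomain_ext (AlgDerivation.ofDerivation (derD F))
    have h₂ := Ore.isDomain_ext (derExt hF)
    exact e.symm.toMulEquiv.isDomain _
  have hgd : 1 ≤ n → leftGlobalDimension (TangentAlgebra (X 0 * F))ᵐᵒᵖ = 4 :=
    leftGlobalDimension_mulOpposite e
  exact ⟨⟨derExt hF, derExt_C hF, derExt_t hF, oreEquiv hF hsq hFG, hS, hD, hE⟩, hN,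
    isNoetherianRing_of_ringEquiv _ ε, hdom, exists_basis_tangentAlgebra hF hsq hFG,
    exists_isFreeResolution hF hsq hFG,
    fun hn => ⟨(leftGlobalDimension_eq_of_ringEquiv ε).trans (hgd hn), hgd hn⟩⟩
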